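/- **Setting.** Let $q$ be a nonzero complex number which is not a root of unity, with a fixed square root $q^{1/2}$. Let $\mathfrak g$ be one of $\mathfrak o_{2n+1}$ ($n\ge1$, $N=2n+1$), $\mathfrak{sp}_{2n}$ ($n\ge1$, $N=2n$), $\mathfrak o_{2n}$ ($n\ge3$, $N=2n$). Put $i'=N+1-i$ and let $(\bar1,\dots,\bar N)$ be $(n-\frac12,\dots,\frac12,0,-\frac12,\dots,-n+\frac12)$, $(n,\dots,1,-1,\dots,-n)$, $(n-1,\dots,1,0,0,-1,\dots,-n+1)$ respectively. Let $\varepsilon_i=1$, except that $\varepsilon_i=-1$ for $i>n$ if $\mathfrak g=\mathfrak{sp}_{2n}$. Let $\xi=q^{2-N}$ for $\mathfrak g=\mathfrak o_N$ and $\xi=q^{-N-2}$ for $\mathfrak g=\mathfrak{sp}_N$, and let $D=\mathrm{diag}(q^{\bar1},\dots,q^{\bar N})$. Set $$R(u,v)=\sum_{i,j}(uq^{\delta_{ij}}-vq^{-\delta_{ij}})\,e_{ii}\otimes e_{jj}+(q-q^{-1})\sum_{i,j}(u\,\delta_{i<j}+v\,\delta_{i>j})\,e_{ij}\otimes e_{ji}-\frac{u-v}{u-v\xi}\sum_{i,j}d_{ij}(u,v)\,e_{i'j'}\otimes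 e_{ij},$$ where $d_{ij}(u,v)$ equals $(q-q^{-1})\xi v\,q^{\bar\imath-\bar\jmath}\varepsilon_i\varepsilon_j$ for $i<j$; $(q-q^{-1})u\,q^{\bar\imath-\bar\jmath}\varepsilon_i\varepsilon_j$ for $i>j$; $(1-q^{-1})(u+vq\xi)$ for $i=j\ne i'$; and $(1-q^{-1})(uq+v\xi)$ for $i=j=i'$. The extended quantum affine algebra $\mathrm U^{\rm ext}_q(\widehat{\mathfrak g})$ is the unital associative $\mathbb C$-algebra generated by $l^\pm_{ij}[\mp m]$ ($1\le i,j\le N$, $m\ge0$) subject to $l^+_{ij}[0]=l^-_{ji}[0]=0$ for $i<j$, $l^+_{ii}[0]l^-_{ii}[0]=l^-_{ii}[0]l^+_{ii}[0]=1$, and $$R(u,v)L^\pm_1(u)L^\pm_2(v)=L^\pm_2(v)L^\pm_1(u)R(u,v),\qquad R(u,v)L^+_1(u)L^-_2(v)=L^-_2(v)L^+_1(u)R(u,v),$$ where $L^\pm(u)=[l^\pm_{ij}(u)]$ and $l^\pm_{ij}(u)=\sum_{m\ge0}l^\pm_{ij}[\mp m]u^{\pm m}$. For $N=2n$ one also adjoins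 mutually inverse central elements $z^\pm[0]^{1/2}$ with squares $l^\pm_{nn}[0]\,l^\pm_{n'n'}[0]$. Let $h^\pm_1(u),\dots,h^\pm_N(u)$ be the diagonal entries of $H^\pm(u)$ in the Gauss decomposition $L^\pm(u)=F^\pm(u)H^\pm(u)E^\pm(u)$ (lower unitriangular, diagonal, upper unitriangular), and set $$z^\pm(u)=\prod_{i=1}^{n}h^\pm_i(u\xi q^{2i})^{-1}\prod_{i=1}^{n}h^\pm_i(u\xi q^{2i-2})\cdot h^\pm_{n+1}(u)\,h^\pm_{n+1}(uq)\quad(N=2n+1),$$ $$z^\pm(u)=\prod_{i=1}^{n-1}h^\pm_i(u\xi q^{2i})^{-1}\prod_{i=1}^{n}h^\pm_i(u\xi q^{2i-2})\cdot h^\pm_{n+1}(u)\quad(N=2n).$$ The algebra $\mathrm U_q(\widehat{\mathfrak g})\subset\mathrm U^{\rm ext}_q(\widehat{\mathfrak g})$ is the subalgebra of elements fixed by all automorphisms $L^\pm(u)\mapsto f^\pm(u)L^\pm(u)$, $z^\pm[0]^{1/2}\mapsto f^\pm[0]\,z^\pm[0]^{1/2}$ (the latter for $N=2n$), where $f^\pm(u)=\sum_{m\ge0}f^\pm[\mp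 m]u^{\pm m}$ are series with complex coefficients and $f^+[0]f^-[0]=1$. **Proposition.** $\mathrm U^{\rm ext}_q(\widehat{\mathfrak g})$ is a Hopf algebra with $$\Delta:l^\pm_{ij}(u)\mapsto\sum_{k=1}^N l^\pm_{ik}(u)\otimes l^\pm_{kj}(u),\qquad S:L^\pm(u)\mapsto L^\pm(u)^{-1},\qquad \varepsilon:L^\pm(u)\mapsto1$$ (and with $z^\pm[0]^{1/2}$ group-like for $N=2n$). The coefficients of $z^\pm(u)$ are central, the series $z^\pm(u)$ is invertible, and $$\Delta:z^\pm(u)\mapsto z^\pm(u)\otimes z^\pm(u),\qquad S:z^\pm(u)\mapsto z^\pm(u)^{-1}.$$ The subalgebra $\mathrm U_q(\widehat{\mathfrak g})$ is a Hopf subalgebra of $\mathrm U^{\rm ext}_q(\widehat{\mathfrak g})$. Moreover, $$S^2:L^\pm(u)\mapsto\frac{z^\pm(u)}{z^\pm(u\xi)}\,D^{2}\,L^\pm(u\xi^2)\,D^{-2}.$$ -/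

import Mathlib

open scoped TensorProduct Polynomial

noncomputable section

namespace QAff

/-! ### The classical types and their numerical data -/

/-- The types `B_n`, `C_n`, `D_n`: the Lie algebras `o_{2n+1}`, `sp_{2n}`, `o_{2n}`. -/
inductive ClassicalType
  | B
  | C
  | D

/-- The smallest rank for which the Lie algebra of the given type is simple
(`o_3`, `sp_2` and `o_6` respectively). -/
def ClassicalType.minRank : ClassicalType → ℕ
  | .B => 1
  | .C => 1
  | .D => 3

/-- The dimension `N` of the vector representation. -/
def dimN : ClassicalType → ℕ → ℕ
  | .B, n => 2 * n + 1
  | .C, n => 2 * n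
  | .D, n => 2 * n

/-- Indices are `0`-based: the index `i : Fin N` stands for the usual `i + 1`, and `i' = i.rev`. -/
abbrev Idx (T : ClassicalType) (n : ℕ) : Type := Fin (dimN T n)

/-- Twice the number `ī` (the `ī` are half-integers in type `B`):
* `B`: `(n - 1/2, …, 3/2, 1/2, 0, -1/2, -3/2, …, -n + 1/2)`;
* `C`: `(n, …, 2, 1, -1, -2, …, -n)`;
* `D`: `(n - 1, …, 1, 0, 0, -1, …, -n + 1)`. -/
def bar2 (T : ClassicalType) (n : ℕ) (i : Idx T n) : ℤ :=
  match T with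
  | .B => if i.val < n then 2 * n - 2 * i.val - 1
          else if i.val = n then 0 else 2 * n - 2 * i.val + 1
  | .C => if i.val < n then 2 * n - 2 * i.val else 2 * n - 2 * i.val - 2
  | .D => if i.val < n then 2 * n - 2 * i.val - 2 else 2 * n - 2 * i.val

/-- The signs `ε_i`. -/
def eps (T : ClassicalType) (n : ℕ) (i : Idx T n) : ℂ :=
  match T with
  | .B => 1
  | .C => if i.val < n then 1 else -1
  | .D => 1

/-- `ξ = q^{-N+2}` in the orthogonal case and `ξ = q^{-N-2}` in the symplectic case. -/
def xi (T : ClassicalType) (n : ℕ) (q : ℂ) : ℂ :=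
  match T with
  | .B => q ^ (2 - (dimN .B n : ℤ))
  | .C => q ^ (-2 - (dimN .C n : ℤ))
  | .D => q ^ (2 - (dimN .D n : ℤ))

/-! ### The R-matrix

Throughout, `p` is a square root of `q`, so that `q^{ī - j̄}` is `p ^ (bar2 i - bar2 j)`. -/

/-- `d_{ij}(x, 1)` as a polynomial in `x`. The numerator `d_{ij}(u, v)` is homogeneous of
degree one, `d_{ij}(u, v) = v d_{ij}(u / v, 1)`. -/
def dPoly (T : ClassicalType) (n : ℕ) (q p : ℂ) (i j : Idx T n) : ℂ[X] :=
  if i < j then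
    Polynomial.C ((q - q⁻¹) * xi T n q * p ^ (bar2 T n i - bar2 T n j) * eps T n i * eps T n j)
  else if j < i then
    Polynomial.C ((q - q⁻¹) * p ^ (bar2 T n i - bar2 T n j) * eps T n i * eps T n j)
      * Polynomial.X
  else if i ≠ i.rev then
    Polynomial.C (1 - q⁻¹) * (Polynomial.X + Polynomial.C (q * xi T n q))
  else
    Polynomial.C (1 - q⁻¹) * (Polynomial.C q * Polynomial.X + Polynomial.C (xi T n q))

/-- The coefficient of `e_{ik} ⊗ e_{jl}` in `(x - ξ) R(x, 1)`, a polynomial in `x` of degree at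
most two; here
`R(u,v) = ∑_{i,j} (u q^{δ_ij} - v q^{-δ_ij}) e_ii ⊗ e_jj
  + (q - q⁻¹) ∑_{i,j} (u δ_{i<j} + v δ_{i>j}) e_ij ⊗ e_ji
  - (u - v) / (u - v ξ) ∑_{i,j} d_ij(u,v) e_{i'j'} ⊗ e_ij`. -/
def rPoly (T : ClassicalType) (n : ℕ) (q p : ℂ) (i j k l : Idx T n) : ℂ[X] :=
  (Polynomial.X - Polynomial.C (xi T n q)) *
      ((if i = k ∧ j = l then
          (if i = j then Polynomial.C q * Polynomial.X - Polynomial.C q⁻¹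
            else Polynomial.X - 1)
        else 0)
      + (if j = k ∧ i = l then
          Polynomial.C (q - q⁻¹) *
            ((if i < j then Polynomial.X else 0) + (if j < i then 1 else 0))
        else 0))
    - (if i = j.rev ∧ k = l.rev then (Polynomial.X - 1) * dPoly T n q p j l else 0)

/-- The coefficient of `u^t v^{2-t}` in the `e_{ik} ⊗ e_{jl}` entry of the polynomial matrix
`(u - v ξ) R(u, v) = v² · (x - ξ) R(x, 1)` at `x = u / v`. -/
def rCoeff (T : ClassicalType) (n : ℕ) (q p : ℂ) (i j k l : Idx T n) (t : ℕ) : ℂ :=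
  (rPoly T n q p i j k l).coeff t

/-! ### The extended quantum affine algebra -/

/-- The two signs `±`. -/
inductive Sgn
  | plus
  | minus

/-- `±1`. -/
def Sgn.toInt : Sgn → ℤ
  | .plus => 1
  | .minus => -1

/-- The opposite sign. -/
def Sgn.neg : Sgn → Sgn
  | .plus => .minus
  | .minus => .plus

/-- Generators: `l s i j m` is `l^±_{ij}[∓m]`, the coefficient of `u^{±m}` in `l^±_{ij}(u)`;
for `N = 2n` there are two more, the square roots `z^±[0]^{1/2}`. -/
inductive Gen (T : ClassicalType) (n : ℕ)
  | l (s : Sgn) (i j : Idx T n) (m : ℕ)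
  | root (hT : T ≠ .B) (s : Sgn)

/-- The coefficient of `u^k` (`k ∈ ℤ`) in the series `∑_m x_m u^{±m}`. -/
def laurentCoeff {A : Type*} [Zero A] (s : Sgn) (x : ℕ → A) (k : ℤ) : A :=
  if 0 ≤ s.toInt * k then x k.natAbs else 0

/-- The free algebra on the generators. -/
abbrev Free (T : ClassicalType) (n : ℕ) : Type := FreeAlgebra ℂ (Gen T n)

/-- The generator `l^±_{ij}[∓m]` of the free algebra. -/
def fl {T : ClassicalType} {n : ℕ} (s : Sgn) (i j : Idx T n) (m : ℕ) : Free T n :=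
  FreeAlgebra.ι ℂ (Gen.l s i j m)

/-- The generator `z^±[0]^{1/2}` of the free algebra. -/
def froot {T : ClassicalType} {n : ℕ} (hT : T ≠ .B) (s : Sgn) : Free T n :=
  FreeAlgebra.ι ℂ (Gen.root hT s)

/-- The coefficient of `u^c v^d` in the `e_{ia} ⊗ e_{jb}` entry of
`(u - v ξ) R(u,v) L^s_1(u) L^{s'}_2(v)`. -/
def rllLeft (T : ClassicalType) (n : ℕ) (q p : ℂ) (s s' : Sgn) (i j a b : Idx T n) (c d : ℤ) :
    Free T n :=
  ∑ k, ∑ l, ∑ t ∈ Finset.range 3,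
    rCoeff T n q p i j k l t •
      (laurentCoeff s (fl s k a) (c - t) * laurentCoeff s' (fl s' l b) (d - (2 - t)))

/-- The coefficient of `u^c v^d` in the `e_{ia} ⊗ e_{jb}` entry of
`L^{s'}_2(v) L^s_1(u) (u - v ξ) R(u,v)`. -/
def rllRight (T : ClassicalType) (n : ℕ) (q p : ℂ) (s s' : Sgn) (i j a b : Idx T n) (c d : ℤ) :
    Free T n :=
  ∑ k, ∑ l, ∑ t ∈ Finset.range 3,
    rCoeff T n q p k l a b t •
      (laurentCoeff s' (fl s' j l) (d - (2 - t)) * laurentCoeff s (fl s i k) (c - t))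

/-- The defining relations. The relations `R L_1 L_2 = L_2 L_1 R` are written after
multiplication by the denominator `u - v ξ` of `R(u,v)`. This changes nothing: multiplication by
`u - v ξ` is injective on the series with nonnegative (or nonpositive) powers of both variables,
and in the mixed relation, where the powers of `u` are nonnegative and those of `v` are bounded
above, `u - v ξ` is invertible. -/
inductive Rel (T : ClassicalType) (n : ℕ) (q p : ℂ) : Free T n → Free T n → Prop
  | zero_plus (i j : Idx T n) (h : i < j) : Rel T n q p (fl .plus i j 0) 0
  | zero_minus (i j : Idx T n) (h : i < j) : Rel T n q p (fl .minus j i 0) 0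
  | plus_minus (i : Idx T n) : Rel T n q p (fl .plus i i 0 * fl .minus i i 0) 1
  | minus_plus (i : Idx T n) : Rel T n q p (fl .minus i i 0 * fl .plus i i 0) 1
  | rll_same (s : Sgn) (i j a b : Idx T n) (c d : ℤ) :
      Rel T n q p (rllLeft T n q p s s i j a b c d) (rllRight T n q p s s i j a b c d)
  | rll_mixed (i j a b : Idx T n) (c d : ℤ) :
      Rel T n q p (rllLeft T n q p .plus .minus i j a b c d)
        (rllRight T n q p .plus .minus i j a b c d)
  | root_comm (hT : T ≠ .B) (s : Sgn) (g : Gen T n) :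
      Rel T n q p (froot hT s * FreeAlgebra.ι ℂ g) (FreeAlgebra.ι ℂ g * froot hT s)
  /-- `(z^±[0]^{1/2})² = l^±_{nn}[0] l^±_{n'n'}[0]`, which is `z^±[0]`. -/
  | root_sq (hT : T ≠ .B) (s : Sgn) (i : Idx T n) (hi : i.val + 1 = n) :
      Rel T n q p (froot hT s * froot hT s) (fl s i i 0 * fl s i.rev i.rev 0)
  /-- The roots are compatible with `z^+[0] z^-[0] = 1`. -/
  | root_inv (hT : T ≠ .B) : Rel T n q p (froot hT .plus * froot hT .minus) 1

/-- The extended quantum affine algebra `U^ext_q(ĝ)` in its R-matrix presentation. -/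
def Uext (T : ClassicalType) (n : ℕ) (q p : ℂ) : Type := RingQuot (Rel T n q p)

instance (T : ClassicalType) (n : ℕ) (q p : ℂ) : Ring (Uext T n q p) :=
  inferInstanceAs (Ring (RingQuot (Rel T n q p)))

instance (T : ClassicalType) (n : ℕ) (q p : ℂ) : Algebra ℂ (Uext T n q p) :=
  inferInstanceAs (Algebra ℂ (RingQuot (Rel T n q p)))

section Elements

variable (T : ClassicalType) (n : ℕ) (q p : ℂ)

/-- The projection from the free algebra. -/
def proj : Free T n →ₐ[ℂ] Uext T n q p := RingQuot.mkAlgHom ℂ (Rel T n q p)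

/-- The generator `l^±_{ij}[∓m]` of `U^ext_q(ĝ)`. -/
def lgen (s : Sgn) (i j : Idx T n) (m : ℕ) : Uext T n q p := proj T n q p (fl s i j m)

/-- The generator `z^±[0]^{1/2}` of `U^ext_q(ĝ)` in types `C` and `D`. -/
def rootgen (hT : T ≠ .B) (s : Sgn) : Uext T n q p := proj T n q p (froot hT s)

/-- The matrix `L^±(u)`. A series `∑_m x_m u^{±m}` attached to the sign `±` is stored as the
formal power series with coefficients `x_m`, that is, in the variable `u^{±1}`. -/
def Lmat (s : Sgn) : Matrix (Idx T n) (Idx T n) (PowerSeries (Uext T n q p)) :=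
  Matrix.of fun i j => PowerSeries.mk (lgen T n q p s i j)

end Elements

/-! ### Series and the Gauss decomposition -/

/-- The substitution `u ↦ u c` in a series `f(u) = ∑_m x_m u^{±m}`. -/
def scaleArg {A : Type*} [Ring A] [Algebra ℂ A] (s : Sgn) (c : ℂ) (f : PowerSeries A) :
    PowerSeries A :=
  PowerSeries.mk fun m => c ^ (s.toInt * (m : ℤ)) • PowerSeries.coeff m f

/-- Coefficientwise application of a map to a series. -/
def seriesMap {A B : Type*} [Ring A] [Ring B] (φ : A → B) (f : PowerSeries A) : PowerSeries B :=
  PowerSeries.mk fun m => φ (PowerSeries.coeff m f)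

/-- The quasideterminant of the leading `(i+1) × (i+1)` block of `M` with the box at `(i, i)`,
`M_ii - row · (M_{<i,<i})⁻¹ · column`. This is the diagonal entry of the Gauss decomposition
`M = F H E`. -/
def quasiDet {A : Type*} [Ring A] {N : ℕ} (M : Matrix (Fin N) (Fin N) A) (i : Fin N) : A :=
  M i i - ∑ a : {a : Fin N // a < i}, ∑ b : {b : Fin N // b < i},
    M i a * Ring.inverse (M.submatrix (fun x : {a : Fin N // a < i} => x.val)
      (fun x : {a : Fin N // a < i} => x.val)) a b * M b i

/-- The product defining `z^±(u)` in terms of the series `h_i(u)`: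
`∏_{i=1}^{n} h_i(u ξ q^{2i})⁻¹ ∏_{i=1}^{n} h_i(u ξ q^{2i-2}) · h_{n+1}(u) h_{n+1}(u q)` for
`N = 2n + 1`, and
`∏_{i=1}^{n-1} h_i(u ξ q^{2i})⁻¹ ∏_{i=1}^{n} h_i(u ξ q^{2i-2}) · h_{n+1}(u)` for `N = 2n`. -/
def zFormula (T : ClassicalType) (n : ℕ) (q : ℂ) {A : Type*} [Ring A] [Algebra ℂ A] (s : Sgn)
    (h : ℕ → PowerSeries A) : PowerSeries A :=
  let inv (m : ℕ) : PowerSeries A := ((List.range m).map fun i =>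
    Ring.inverse (scaleArg s (xi T n q * q ^ (2 * (i + 1))) (h (i + 1)))).prod
  let dir (m : ℕ) : PowerSeries A := ((List.range m).map fun i =>
    scaleArg s (xi T n q * q ^ (2 * i)) (h (i + 1))).prod
  match T with
  | .B => inv n * dir n * (h (n + 1) * scaleArg s q (h (n + 1)))
  | .C => inv (n - 1) * dir n * h (n + 1)
  | .D => inv (n - 1) * dir n * h (n + 1)

section Central

variable (T : ClassicalType) (n : ℕ) (q p : ℂ)

/-- The Gaussian generator series `h^±_i(u)`, for the `1`-based index `1 ≤ i ≤ N`. -/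
def gaussH (s : Sgn) (i : ℕ) : PowerSeries (Uext T n q p) :=
  if hi : i - 1 < dimN T n then quasiDet (Lmat T n q p s) ⟨i - 1, hi⟩ else 1

/-- The series `z^±(u)` of `U^ext_q(ĝ)`. -/
def zser (s : Sgn) : PowerSeries (Uext T n q p) :=
  zFormula T n q s (gaussH T n q p s)

/-! ### The subalgebra `U_q(ĝ)` -/

/-- `φ` is the multiplication automorphism `μ_f : L^±(u) ↦ f^±(u) L^±(u)` for some scalar series
`f^±(u)` with `f^+[0] f^-[0] = 1`. On the square roots it is the natural extension
`z^±[0]^{1/2} ↦ f^±[0] z^±[0]^{1/2}`. -/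
def IsMultAut (φ : Uext T n q p ≃ₐ[ℂ] Uext T n q p) : Prop :=
  ∃ f : Sgn → PowerSeries ℂ,
    PowerSeries.coeff 0 (f .plus) * PowerSeries.coeff 0 (f .minus) = 1 ∧
    (∀ s i j m, φ (lgen T n q p s i j m) =
      ∑ r ∈ Finset.HasAntidiagonal.antidiagonal m, PowerSeries.coeff r.1 (f s) • lgen T n q p s i j r.2) ∧
    (∀ (hT : T ≠ .B) s, φ (rootgen T n q p hT s) =
      PowerSeries.coeff 0 (f s) • rootgen T n q p hT s)

/-- The quantum affine algebra `U_q(ĝ)` inside `U^ext_q(ĝ)`: the elements fixed by all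
multiplication automorphisms. -/
def Uq : Subalgebra ℂ (Uext T n q p) where
  carrier := {x | ∀ φ, IsMultAut T n q p φ → φ x = x}
  mul_mem' ha hb φ hφ := by rw [map_mul, ha φ hφ, hb φ hφ]
  add_mem' ha hb φ hφ := by rw [map_add, ha φ hφ, hb φ hφ]
  algebraMap_mem' r φ _ := φ.commutes r

end Central

/-! ### Hopf algebra structures on a given algebra -/

/-- A Hopf algebra structure on a given `ℂ`-algebra. It is the same as an instance of Mathlib's
`HopfAlgebra ℂ A` extending the given algebra structure (`HopfStructure.toHopfAlgebra`). -/
structure HopfStructure (A : Type*) [Ring A] [Algebra ℂ A] where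
  /-- The coproduct. -/
  comul : A →ₐ[ℂ] A ⊗[ℂ] A
  /-- The counit. -/
  counit : A →ₐ[ℂ] ℂ
  /-- The antipode. -/
  antipode : A →ₗ[ℂ] A
  coassoc : (Algebra.TensorProduct.assoc ℂ ℂ ℂ A A A).toAlgHom.comp
      ((Algebra.TensorProduct.map comul (.id ℂ A)).comp comul)
    = (Algebra.TensorProduct.map (.id ℂ A) comul).comp comul
  rTensor_counit_comp_comul :
    (Algebra.TensorProduct.map counit (.id ℂ A)).comp comul =
      (Algebra.TensorProduct.lid ℂ A).symm
  lTensor_counit_comp_comul :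
    (Algebra.TensorProduct.map (.id ℂ A) counit).comp comul =
      (Algebra.TensorProduct.rid ℂ ℂ A).symm
  mul_antipode_rTensor_comul :
    LinearMap.mul' ℂ A ∘ₗ antipode.rTensor A ∘ₗ comul.toLinearMap =
      Algebra.linearMap ℂ A ∘ₗ counit.toLinearMap
  mul_antipode_lTensor_comul :
    LinearMap.mul' ℂ A ∘ₗ antipode.lTensor A ∘ₗ comul.toLinearMap =
      Algebra.linearMap ℂ A ∘ₗ counit.toLinearMap

namespace HopfStructure

variable {A : Type*} [Ring A] [Algebra ℂ A]

/-- The corresponding Mathlib structure. -/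
abbrev toHopfAlgebra (H : HopfStructure A) : HopfAlgebra ℂ A :=
  { Bialgebra.ofAlgHom H.comul H.counit H.coassoc H.rTensor_counit_comp_comul
      H.lTensor_counit_comp_comul with
    antipode := H.antipode
    mul_antipode_rTensor_comul := H.mul_antipode_rTensor_comul
    mul_antipode_lTensor_comul := H.mul_antipode_lTensor_comul }

/-- `V` is a Hopf subalgebra: `Δ(V) ⊆ V ⊗ V` and `S(V) ⊆ V`. -/
def IsHopfSubalgebra (H : HopfStructure A) (V : Subalgebra ℂ A) : Prop :=
  (∀ x ∈ V, H.comul x ∈ (Algebra.TensorProduct.map V.val V.val).range) ∧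
    ∀ x ∈ V, H.antipode x ∈ V

end HopfStructure

section HopfOnUext

variable {T : ClassicalType} {n : ℕ} {q p : ℂ}

/-- `H` is the Hopf algebra structure on `U^ext_q(ĝ)` defined by the R-matrix formulas
`Δ : l^±_{ij}(u) ↦ ∑_k l^±_{ik}(u) ⊗ l^±_{kj}(u)`, `ε : L^±(u) ↦ 1`, `S : L^±(u) ↦ L^±(u)⁻¹`,
the square roots `z^±[0]^{1/2}` being group-like. -/
structure IsRMatrixHopf (H : HopfStructure (Uext T n q p)) : Prop where
  comul_l : ∀ s i j m, H.comul (lgen T n q p s i j m) =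
    ∑ k, ∑ r ∈ Finset.HasAntidiagonal.antidiagonal m, lgen T n q p s i k r.1 ⊗ₜ[ℂ] lgen T n q p s k j r.2
  counit_l : ∀ s i j m, H.counit (lgen T n q p s i j m) = if i = j ∧ m = 0 then 1 else 0
  antipode_l_mul : ∀ s,
    (Lmat T n q p s).map (seriesMap H.antipode) * Lmat T n q p s = 1
  mul_antipode_l : ∀ s,
    Lmat T n q p s * (Lmat T n q p s).map (seriesMap H.antipode) = 1
  comul_root : ∀ hT s, H.comul (rootgen T n q p hT s) =
    rootgen T n q p hT s ⊗ₜ[ℂ] rootgen T n q p hT s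
  counit_root : ∀ hT s, H.counit (rootgen T n q p hT s) = 1
  antipode_root : ∀ hT s, H.antipode (rootgen T n q p hT s) = rootgen T n q p hT s.neg

end HopfOnUext

end QAff

end

open QAff

/-!
The proof works with matrices over arbitrary algebras. Matrices of series `L^±(u)` over an algebra
`A` satisfying the defining relations (`IsRealization`) are the same as homomorphisms from the
extended algebra to `A` (`IsRealization.lift`). The relation `R L_1 L_2 = L_2 L_1 R` is read in the
series in two variables, where the denominator `u - ξ v` of the R-matrix is not a zero divisor
(`RLL_biv_iff`). Realizations with commuting entries can be multiplied, and the inverse matrices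
form a realization in the opposite algebra (`IsRealization.mul`, `IsRealization.inverse`): this gives
the coproduct and the antipode, and the Hopf algebra axioms reduce to matrix identities on the
generators.

*The series `z(u)`.* At `u = ξ v` the R-matrix is, up to a scalar, the rank one operator given by
the vector `∑_l η_l e_{l'} ⊗ e_l` with `η_l = q^{-l̄} ε_l` (`rho_residue`). Hence both sides of the
relation are multiples of one series `z(u)`, which is characterised by
`∑_l η_l l_{l'a}(uξ) l_{lb}(u) = δ_{ab'} η_b z(u)` (`IsContraction`, `exists_contraction`). Equivalently,
`L(u)⁻¹ z(u) = D L(uξ)ᵗ D⁻¹` for the transposition `t` defined by `i ↦ i'` and the signs `ε_i`.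
Centrality follows from crossing symmetry: the contraction of `R_{13}(uξ, v) R_{23}(u, v)` with the
same vector is a scalar (`crossing`), so that moving a third matrix through the contraction of the
first two multiplies both sides by the same factor (`commute_of_crossing`). The characterisation
makes `z(u)` multiplicative, hence group-like, and the antipode axiom then shows that
`S(z(u)) = z(u)⁻¹`. Applying `S` to the formula for `L(u)⁻¹` and using it once more at `uξ` gives the
square of the antipode (`antipode_antipode_Lmat`).

*The product formula.* That `z(u)` is the product of the Gaussian generators `h_i` is proved by
computing one corner of the defining relation (`GaussData.contraction`). The entries away from the
antidiagonal satisfy the relations of the R-matrix of type `A` (`typeARel_of_RLL`). These express,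
for a leading `m × m` block, the quasideterminants of the transposed block in terms of those of the
block itself: at `v = u q^{2m}` the transpose of a block and the transpose of its inverse are inverse
to each other up to a conjugation and a scalar (`IsBlockInv.row_relation`), and an induction on `m`
turns the scalar into a product of `h_i` (`GaussData.row_mul_last`). The order of the factors is
rearranged by the commutation of the `h_i` at different points, and by the centrality of `z(u)` in
types `C` and `D` (`IsContraction.eq_zFormula`).

*The subalgebra.* The multiplication automorphisms `φ` satisfy
`Δ φ = (φ ⊗ 1) Δ = (1 ⊗ φ) Δ` and `φ S φ = S`. An element of `U ⊗ U` fixed by all `φ ⊗ 1` and all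
`1 ⊗ φ` lies in the tensor square of the invariants (`mem_range_map_of_fixed`), because the scalars
are a field.
-/

noncomputable section

namespace QAff

/-! ### Invertibility of matrices of power series -/

section MatrixUnits

variable {ι A : Type*} [Fintype ι] [DecidableEq ι] [Ring A]

/-- A matrix of power series, read as a power series with matrix coefficients. -/
def matrixSeriesEquiv : Matrix ι ι (PowerSeries A) ≃+* PowerSeries (Matrix ι ι A) where
  toFun M := PowerSeries.mk fun m => M.map (PowerSeries.coeff m)
  invFun f := Matrix.of fun i j => PowerSeries.mk fun m => PowerSeries.coeff m f i j
  left_inv M := by ext i j m; simp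
  right_inv f := by ext m i j; simp
  map_mul' M N := by
    ext m i j
    simp only [PowerSeries.coeff_mk, Matrix.map_apply, Matrix.mul_apply, PowerSeries.coeff_mul,
      map_sum, Matrix.sum_apply]
    rw [Finset.sum_comm]
  map_add' M N := by ext m i j; simp

lemma isUnit_of_isUnit_constantCoeff {M : Matrix ι ι (PowerSeries A)}
    (h : IsUnit (M.map (PowerSeries.coeff 0))) : IsUnit M := by
  rw [← MulEquiv.isUnit_map (matrixSeriesEquiv (ι := ι) (A := A)),
    PowerSeries.isUnit_iff_constantCoeff]
  convert h using 1
  ext i j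
  simp [matrixSeriesEquiv]

lemma pow_eq_zero_of_strictly_triangular (f : ι → ℕ) {N : Matrix ι ι A}
    (hN : ∀ i j, N i j ≠ 0 → f j < f i) (k : ℕ) (i j : ι) (h : (N ^ k) i j ≠ 0) :
    f j + k ≤ f i := by
  induction k generalizing i j with
  | zero =>
    rw [pow_zero, Matrix.one_apply] at h
    have : i = j := by by_contra hij; simp [hij] at h
    simp [this]
  | succ k ih =>
    rw [pow_succ', Matrix.mul_apply] at h
    obtain ⟨l, -, hl⟩ := Finset.exists_ne_zero_of_sum_ne_zero h
    have h1 := hN i l (left_ne_zero_of_mul hl)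
    have h2 := ih l j (right_ne_zero_of_mul hl)
    omega

/-- A matrix which is triangular for some linear order on the indices and has invertible diagonal
entries is invertible. The order is given by an injective rank function. -/
lemma isUnit_of_triangular {f : ι → ℕ} (hf : Function.Injective f) {M : Matrix ι ι A}
    (hM : ∀ i j, f i < f j → M i j = 0) (hd : ∀ i, IsUnit (M i i)) : IsUnit M := by
  choose d hd using hd
  have hD1 : Matrix.diagonal (fun i => (↑(d i)⁻¹ : A)) * Matrix.diagonal (fun i => M i i) = 1 := by
    rw [Matrix.diagonal_mul_diagonal, ← Matrix.diagonal_one]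
    congr 1; ext i; simp [← hd]
  have hD2 : Matrix.diagonal (fun i => M i i) * Matrix.diagonal (fun i => (↑(d i)⁻¹ : A)) = 1 := by
    rw [Matrix.diagonal_mul_diagonal, ← Matrix.diagonal_one]
    congr 1; ext i; simp [← hd]
  set Di := Matrix.diagonal (fun i => (↑(d i)⁻¹ : A)) with hDi
  have hDu : IsUnit Di := ⟨⟨Di, _, hD1, hD2⟩, rfl⟩
  set N := Di * M - 1 with hN
  have hN' : ∀ i j, N i j ≠ 0 → f j < f i := by
    intro i j h
    by_contra hlt
    apply h
    rcases eq_or_ne i j with rfl | hij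
    · simp [hN, hDi, ← hd]
    · have : f i < f j := lt_of_le_of_ne (not_lt.mp hlt) (fun h => hij (hf h))
      simp [hN, hDi, hM i j this, hij]
  have hnil : IsNilpotent N := by
    refine ⟨(∑ i, f i) + 1, ?_⟩
    ext i j
    by_contra h
    have h1 := pow_eq_zero_of_strictly_triangular f hN' _ i j h
    have h2 := Finset.single_le_sum (f := f) (fun _ _ => Nat.zero_le _) (Finset.mem_univ i)
    omega
  have h1 : IsUnit (Di * M) := by
    have := hnil.isUnit_one_add
    rwa [hN, add_sub_cancel] at this
  obtain ⟨u, hu⟩ := hDu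
  rw [← hu] at h1
  simpa using h1

lemma left_inverse_triangular {f : ι → ℕ} (hf : Function.Injective f) {M N : Matrix ι ι A}
    (hM : ∀ i j, f i < f j → M i j = 0) (hd : ∀ i, IsUnit (M i i)) (hNM : N * M = 1) :
    (∀ i j, f i < f j → N i j = 0) ∧ ∀ i, N i i * M i i = 1 := by
  classical
  have key : ∀ i j, f i < f j → N i j = 0 := by
    intro i
    by_contra! hcon
    obtain ⟨j0, hj0, hne0⟩ := hcon
    -- a counterexample `j` of maximal rank
    obtain ⟨j, hj, hmax⟩ := Finset.exists_max_image
      (Finset.univ.filter fun j => f i < f j ∧ N i j ≠ 0) f ⟨j0, by simp [hj0, hne0]⟩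
    simp only [Finset.mem_filter, Finset.mem_univ, true_and] at hj hmax
    have h := congrFun (congrFun hNM i) j
    rw [Matrix.mul_apply, Finset.sum_eq_single j, Matrix.one_apply_ne
      (by rintro rfl; exact lt_irrefl _ hj.1)] at h
    · exact hj.2 ((hd j).mul_left_eq_zero.mp h)
    · intro l _ hl
      rcases lt_trichotomy (f l) (f j) with h' | h' | h'
      · rw [hM l j h', mul_zero]
      · exact absurd (hf h') hl
      · by_cases h0 : N i l = 0
        · rw [h0, zero_mul]
        · exact absurd (hmax l ⟨hj.1.trans h', h0⟩) (not_le.mpr h')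
    · simp
  refine ⟨key, fun i => ?_⟩
  have h := congrFun (congrFun hNM i) i
  rw [Matrix.mul_apply, Finset.sum_eq_single i, Matrix.one_apply_eq] at h
  · exact h
  · intro l _ hl
    rcases lt_trichotomy (f l) (f i) with h' | h' | h'
    · rw [hM l i h', mul_zero]
    · exact absurd (hf h') hl
    · rw [key i l h', zero_mul]
  · simp

end MatrixUnits

/-! ### The R-matrix relation in an arbitrary ring -/

section RLL

variable (T : ClassicalType) (n : ℕ) (q p : ℂ)

/-- The coefficient of `e_{ik} ⊗ e_{jl}` in `(U - V ξ) R(U, V)`, for `U` and `V` in an algebra. -/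
def rho {A : Type*} [Ring A] [Algebra ℂ A] (U V : A) (i j k l : Idx T n) : A :=
  ∑ t ∈ Finset.range 3, rCoeff T n q p i j k l t • (U ^ t * V ^ (2 - t))

variable {A : Type*} [Ring A] [Algebra ℂ A]

/-- The operator `(U - V ξ) R(U, V)`, as a matrix over the first tensor factor whose entries are
matrices over the second one. -/
def RMat (U V : A) : Matrix (Idx T n) (Idx T n) (Matrix (Idx T n) (Idx T n) A) :=
  Matrix.of fun i k => Matrix.of fun j l => rho T n q p U V i j k l

/-- The matrix `P_1 = P ⊗ 1`. -/
def leg1 {B ι : Type*} [Ring B] [Fintype ι] [DecidableEq ι] :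
    Matrix ι ι B →+* Matrix ι ι (Matrix ι ι B) := (Matrix.scalar ι).mapMatrix

/-- The matrix `P_2 = 1 ⊗ P`. -/
def leg2 {B ι : Type*} [Ring B] [Fintype ι] [DecidableEq ι] :
    Matrix ι ι B →+* Matrix ι ι (Matrix ι ι B) := Matrix.scalar ι

/-- The relation `R(U, V) P_1 P'_2 = P'_2 P_1 R(U, V)`, multiplied by `U - V ξ`. -/
def RLL (U V : A) (P P' : Matrix (Idx T n) (Idx T n) A) : Prop :=
  RMat T n q p U V * leg1 P * leg2 P' = leg2 P' * leg1 P * RMat T n q p U V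

section Legs

variable {B ι : Type*} [Ring B] [Fintype ι] [DecidableEq ι]

lemma mul_leg1_apply (M : Matrix ι ι (Matrix ι ι B)) (P : Matrix ι ι B) (i a j b : ι) :
    (M * leg1 P) i a j b = ∑ k, M i k j b * P k a := by
  simp [Matrix.mul_apply, Matrix.sum_apply, leg1, Matrix.diagonal_apply]

lemma leg1_mul_apply (M : Matrix ι ι (Matrix ι ι B)) (P : Matrix ι ι B) (i a j b : ι) :
    (leg1 P * M) i a j b = ∑ k, P i k * M k a j b := by
  simp [Matrix.mul_apply, Matrix.sum_apply, leg1, Matrix.diagonal_apply]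

lemma mul_leg2_apply (M : Matrix ι ι (Matrix ι ι B)) (P : Matrix ι ι B) (i a j b : ι) :
    (M * leg2 P) i a j b = ∑ l, M i a j l * P l b := by
  simp only [leg2, Matrix.scalar_apply, Matrix.mul_diagonal]
  rw [Matrix.mul_apply]

lemma leg2_mul_apply (M : Matrix ι ι (Matrix ι ι B)) (P : Matrix ι ι B) (i a j b : ι) :
    (leg2 P * M) i a j b = ∑ l, P j l * M i a l b := by
  simp only [leg2, Matrix.scalar_apply, Matrix.diagonal_mul]
  rw [Matrix.mul_apply]

lemma leg2_mul_leg1 {P P' : Matrix ι ι B}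
    (h : ∀ i j k l, Commute (P i j) (P' k l)) : leg2 P' * leg1 P = leg1 P * leg2 P' := by
  ext i a j b
  simp only [leg2, Matrix.scalar_apply, Matrix.diagonal_mul, Matrix.mul_diagonal, leg1,
    RingHom.mapMatrix_apply, Matrix.map_apply]
  exact (h _ _ _ _).symm.eq

end Legs

variable {T n q p}

lemma RLL_iff {U V : A} {P P' : Matrix (Idx T n) (Idx T n) A} :
    RLL T n q p U V P P' ↔ ∀ i j a b,
      ∑ k, ∑ l, rho T n q p U V i j k l * (P k a * P' l b) =
        ∑ k, ∑ l, P' j l * P i k * rho T n q p U V k l a b := by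
  have hl : ∀ i j a b, (RMat T n q p U V * leg1 P * leg2 P') i a j b =
      ∑ k, ∑ l, rho T n q p U V i j k l * (P k a * P' l b) := by
    intro i j a b
    simp only [mul_leg1_apply, mul_leg2_apply, Finset.sum_mul, mul_assoc]
    rw [Finset.sum_comm]
    rfl
  have hr : ∀ i j a b, (leg2 P' * leg1 P * RMat T n q p U V) i a j b =
      ∑ k, ∑ l, P' j l * P i k * rho T n q p U V k l a b := by
    intro i j a b
    rw [mul_assoc]
    simp only [leg1_mul_apply, leg2_mul_apply, Finset.mul_sum, mul_assoc]
    rw [Finset.sum_comm]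
    rfl
  constructor
  · intro h i j a b
    rw [← hl, ← hr, h]
  · intro h
    ext i a j b
    rw [hl, hr, h]

/-- Matrices satisfying the R-matrix relation can be multiplied if the entries of different
factors commute. -/
lemma RLL.mul {U V : A} {P P' Q Q' : Matrix (Idx T n) (Idx T n) A}
    (h : RLL T n q p U V P P') (h' : RLL T n q p U V Q Q')
    (hc : ∀ i j k l, Commute (Q i j) (P' k l)) (hc' : ∀ i j k l, Commute (P i j) (Q' k l)) :
    RLL T n q p U V (P * Q) (P' * Q') := by
  have e1 := leg2_mul_leg1 hc
  have e2 := leg2_mul_leg1 hc'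
  unfold RLL at *
  calc RMat T n q p U V * leg1 (P * Q) * leg2 (P' * Q')
      = RMat T n q p U V * leg1 P * (leg1 Q * leg2 P') * leg2 Q' := by
        simp only [map_mul, mul_assoc]
    _ = (RMat T n q p U V * leg1 P * leg2 P') * leg1 Q * leg2 Q' := by
        rw [← e1]; simp only [mul_assoc]
    _ = leg2 P' * leg1 P * (RMat T n q p U V * leg1 Q * leg2 Q') := by
        rw [h]; simp only [mul_assoc]
    _ = leg2 P' * (leg1 P * leg2 Q') * leg1 Q * RMat T n q p U V := by
        rw [h']; simp only [mul_assoc]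
    _ = leg2 (P' * Q') * leg1 (P * Q) * RMat T n q p U V := by
        rw [← e2]; simp only [map_mul, mul_assoc]

/-- The relation satisfied by the inverses of two matrices subject to the R-matrix relation. -/
lemma RLL.inv {U V : A} {P P' N N' : Matrix (Idx T n) (Idx T n) A}
    (h : RLL T n q p U V P P') (hP : P * N = 1) (hP' : P' * N' = 1) (hN : N * P = 1)
    (hN' : N' * P' = 1) :
    leg1 N * leg2 N' * RMat T n q p U V = RMat T n q p U V * leg2 N' * leg1 N := by
  have a1 : leg1 P * leg1 N = 1 := by rw [← map_mul, hP, map_one]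
  have a2 : leg2 P' * leg2 N' = 1 := by rw [← map_mul, hP', map_one]
  have a3 : leg1 N * leg1 P = 1 := by rw [← map_mul, hN, map_one]
  have a4 : leg2 N' * leg2 P' = 1 := by rw [← map_mul, hN', map_one]
  unfold RLL at h
  calc leg1 N * leg2 N' * RMat T n q p U V
      = leg1 N * leg2 N' * (RMat T n q p U V * leg1 P * (leg2 P' * leg2 N') * leg1 N) := by
        rw [a2, mul_one, mul_assoc (RMat T n q p U V), a1, mul_one]
    _ = leg1 N * leg2 N' * (RMat T n q p U V * leg1 P * leg2 P') * leg2 N' * leg1 N := by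
        simp only [mul_assoc]
    _ = leg1 N * ((leg2 N' * leg2 P') * leg1 P) * RMat T n q p U V * leg2 N' * leg1 N := by
        rw [h]; simp only [mul_assoc]
    _ = RMat T n q p U V * leg2 N' * leg1 N := by
        rw [a4, one_mul, a3, one_mul]

/-! ### The entries of the R-matrix -/

variable (q) in
/-- The coefficient of `U` in the entry of the part
`∑ (U q^{δ_ij} - V q^{-δ_ij}) e_ii ⊗ e_jj + (q - q⁻¹) ∑ (U δ_{i<j} + V δ_{i>j}) e_ij ⊗ e_ji`
of the R-matrix. -/
def aU {ι : Type*} [LinearOrder ι] (i j k l : ι) : ℂ :=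
  (if i = k ∧ j = l then (if i = j then q else 1) else 0) +
    (if j = k ∧ i = l then (if i < j then q - q⁻¹ else 0) else 0)

variable (q) in
/-- The coefficient of `V` in the entry described at `aU`. -/
def aV {ι : Type*} [LinearOrder ι] (i j k l : ι) : ℂ :=
  (if i = k ∧ j = l then (if i = j then -q⁻¹ else -1) else 0) +
    (if j = k ∧ i = l then (if j < i then q - q⁻¹ else 0) else 0)

variable (T n q p) in
/-- The coefficient of `U` in `d_ij(U, V)`. -/
def dU (i j : Idx T n) : ℂ :=
  if i < j then 0
  else if j < i then (q - q⁻¹) * p ^ (bar2 T n i - bar2 T n j) * eps T n i * eps T n j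
  else if i ≠ i.rev then 1 - q⁻¹ else (1 - q⁻¹) * q

variable (T n q p) in
/-- The coefficient of `V` in `d_ij(U, V)`. -/
def dV (i j : Idx T n) : ℂ :=
  if i < j then (q - q⁻¹) * xi T n q * p ^ (bar2 T n i - bar2 T n j) * eps T n i * eps T n j
  else if j < i then 0
  else if i ≠ i.rev then (1 - q⁻¹) * (q * xi T n q) else (1 - q⁻¹) * xi T n q

lemma dPoly_eq (i j : Idx T n) : dPoly T n q p i j =
    Polynomial.C (dU T n q p i j) * Polynomial.X + Polynomial.C (dV T n q p i j) := by
  unfold dPoly dU dV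
  split_ifs <;> simp <;> ring

lemma rPoly_eq (i j k l : Idx T n) : rPoly T n q p i j k l =
    (Polynomial.X - Polynomial.C (xi T n q)) *
      (Polynomial.C (aU q i j k l) * Polynomial.X + Polynomial.C (aV q i j k l)) -
    (if i = j.rev ∧ k = l.rev then (Polynomial.X - 1) *
      (Polynomial.C (dU T n q p j l) * Polynomial.X + Polynomial.C (dV T n q p j l)) else 0) := by
  rw [rPoly, dPoly_eq]
  congr 2
  unfold aU aV
  split_ifs <;> first | (exfalso; order) | (simp; try ring)

lemma sum_coeff_quadratic {U V : A} (hUV : Commute U V) (c a b : ℂ) :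
    ∑ t ∈ Finset.range 3, ((Polynomial.X - Polynomial.C c) *
      (Polynomial.C a * Polynomial.X + Polynomial.C b)).coeff t • (U ^ t * V ^ (2 - t)) =
    (U - c • V) * (a • U + b • V) := by
  have : (Polynomial.X - Polynomial.C c) * (Polynomial.C a * Polynomial.X + Polynomial.C b) =
      Polynomial.C a * Polynomial.X ^ 2 + Polynomial.C (b - c * a) * Polynomial.X +
        Polynomial.C (-(c * b)) := by
    simp only [map_sub, map_mul, map_neg]; ring
  rw [this]
  simp only [Finset.sum_range_succ, Finset.range_zero, Finset.sum_empty, Polynomial.coeff_add,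
    Polynomial.coeff_C_mul, Polynomial.coeff_X_pow, Polynomial.coeff_X, Polynomial.coeff_C]
  simp only [sub_mul, mul_add, smul_mul_assoc, mul_smul_comm, hUV.symm.eq]
  simp [pow_two]
  module

lemma rho_eq {U V : A} (hUV : Commute U V) (i j k l : Idx T n) :
    rho T n q p U V i j k l =
      (U - xi T n q • V) * (aU q i j k l • U + aV q i j k l • V) -
      (if i = j.rev ∧ k = l.rev then
        (U - V) * (dU T n q p j l • U + dV T n q p j l • V) else 0) := by
  have h1 := sum_coeff_quadratic hUV (xi T n q) (aU q i j k l) (aV q i j k l)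
  have h2 := sum_coeff_quadratic hUV 1 (dU T n q p j l) (dV T n q p j l)
  rw [one_smul, map_one] at h2
  unfold rho rCoeff
  rw [rPoly_eq]
  simp only [Polynomial.coeff_sub, sub_smul, Finset.sum_sub_distrib]
  rw [h1]
  congr 1
  split_ifs
  · exact h2
  · simp

end RLL

/-! ### Series in two variables -/

section Bivariate

variable {A : Type*} [Ring A]

/-- Series in two variables: the outer variable is `v^{±1}`, the inner one is `u^{±1}`. -/
abbrev Biv (A : Type*) [Ring A] : Type _ := PowerSeries (PowerSeries A)

/-- A series `f(u)` as a series in two variables. -/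
def inU : PowerSeries A →+* Biv A := PowerSeries.C

/-- A series `f(v)` as a series in two variables. -/
def inV : PowerSeries A →+* Biv A := PowerSeries.map PowerSeries.C

/-- The coefficient of `u^{±c} v^{±d}`. -/
def coeff₂ (c d : ℕ) (f : Biv A) : A := PowerSeries.coeff c (PowerSeries.coeff d f)

/-- The variable `u^{±1}`. -/
def varU : Biv A := PowerSeries.C PowerSeries.X

/-- The variable `v^{±1}`. -/
def varV : Biv A := PowerSeries.X

lemma biv_ext {f g : Biv A} (h : ∀ c d, coeff₂ c d f = coeff₂ c d g) : f = g := by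
  ext d c
  exact h c d

@[simp] lemma coeff₂_add (c d : ℕ) (f g : Biv A) :
    coeff₂ c d (f + g) = coeff₂ c d f + coeff₂ c d g := by
  simp [coeff₂]

@[simp] lemma coeff₂_sum {κ : Type*} (c d : ℕ) (s : Finset κ) (f : κ → Biv A) :
    coeff₂ c d (∑ k ∈ s, f k) = ∑ k ∈ s, coeff₂ c d (f k) := by
  simp [coeff₂]

@[simp] lemma coeff₂_smul [Algebra ℂ A] (c d : ℕ) (r : ℂ) (f : Biv A) :
    coeff₂ c d (r • f) = r • coeff₂ c d f := by
  simp [coeff₂]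

lemma coeff₂_inU_mul_inV (c d : ℕ) (f g : PowerSeries A) :
    coeff₂ c d (inU f * inV g) = PowerSeries.coeff c f * PowerSeries.coeff d g := by
  simp [coeff₂, inU, inV]

lemma coeff₂_inV_mul_inU (c d : ℕ) (f g : PowerSeries A) :
    coeff₂ c d (inV g * inU f) = PowerSeries.coeff d g * PowerSeries.coeff c f := by
  simp [coeff₂, inU, inV]

lemma coeff₂_varU_pow_mul_varV_pow_mul (c d e e' : ℕ) (f : Biv A) :
    coeff₂ c d (varU ^ e * varV ^ e' * f) =
      if e ≤ c ∧ e' ≤ d then coeff₂ (c - e) (d - e') f else 0 := by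
  rw [mul_assoc, varU, varV, ← map_pow, coeff₂, PowerSeries.coeff_C_mul,
    PowerSeries.coeff_X_pow_mul', PowerSeries.coeff_X_pow_mul']
  split_ifs <;> simp_all [coeff₂]

lemma varV_commute (f : Biv A) : Commute varV f := (PowerSeries.commute_X f).symm

lemma varU_commute (f : Biv A) : Commute varU f := by
  ext d : 1
  rw [varU, PowerSeries.coeff_C_mul, PowerSeries.coeff_mul_C]
  exact (PowerSeries.commute_X _).symm.eq

/-- The parameter `U` with `(U : V) = (u : v)`, for series in `u^{±1}` and `v^{±1}` with the given
signs. -/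
def parU : Sgn → Sgn → Biv A
  | .plus, .plus => varU
  | .minus, .minus => varV
  | .plus, .minus => varU * varV
  | .minus, .plus => 1

/-- The parameter `V` with `(U : V) = (u : v)`. -/
def parV : Sgn → Sgn → Biv A
  | .plus, .plus => varV
  | .minus, .minus => varU
  | .plus, .minus => 1
  | .minus, .plus => varU * varV

lemma parU_commute (s s' : Sgn) (f : Biv A) : Commute (parU s s') f := by
  cases s <;> cases s' <;> simp only [parU]
  · exact varU_commute f
  · exact (varU_commute f).mul_left (varV_commute f)
  · exact Commute.one_left f
  · exact varV_commute f

lemma parV_commute (s s' : Sgn) (f : Biv A) : Commute (parV s s') f := by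
  cases s <;> cases s' <;> simp only [parV]
  · exact varV_commute f
  · exact Commute.one_left f
  · exact (varU_commute f).mul_left (varV_commute f)
  · exact varU_commute f

/-- The exponent of `u^{±1}` in `u^t`, up to the shift by two in case of the sign `-`. -/
def expo : Sgn → ℕ → ℕ
  | .plus, t => t
  | .minus, t => 2 - t

/-- The power of `u` corresponding to the exponent `c` of `u^{±1}`, up to the shift by two in case
of the sign `-`. -/
def idx : Sgn → ℤ → ℤ
  | .plus, c => c
  | .minus, c => 2 - c

lemma parU_pow_mul_parV_pow (s s' : Sgn) {t : ℕ} (ht : t < 3) :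
    parU s s' ^ t * parV s s' ^ (2 - t) =
      varU ^ expo s t * varV ^ expo s' (2 - t) * (1 : Biv A) := by
  have h2 : 2 - (2 - t) = t := by omega
  have hc : Commute (varU : Biv A) varV := varU_commute _
  cases s <;> cases s' <;> simp only [parU, parV, expo, h2, one_pow, mul_one, one_mul]
  · exact hc.mul_pow t
  · exact hc.mul_pow _
  · exact ((hc.pow_pow _ _).symm).eq

lemma laurentCoeff_idx (s : Sgn) (x : ℕ → A) (c : ℕ) {t : ℕ} (ht : t < 3) :
    laurentCoeff s x (idx s c - t) = if expo s t ≤ c then x (c - expo s t) else 0 := by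
  unfold laurentCoeff
  cases s
  · change (if 0 ≤ (1 : ℤ) * (c - t) then x (c - t : ℤ).natAbs else 0) = if t ≤ c then x (c - t) else 0
    by_cases h : t ≤ c
    · rw [if_pos (by omega), if_pos h]; congr 1; omega
    · rw [if_neg (by omega), if_neg h]
  · change (if 0 ≤ (-1 : ℤ) * (2 - c - t) then x (2 - c - t : ℤ).natAbs else 0) =
      if 2 - t ≤ c then x (c - (2 - t)) else 0
    by_cases h : 2 - t ≤ c
    · rw [if_pos (by omega), if_pos h]; congr 1; omega
    · rw [if_neg (by omega), if_neg h]

lemma laurentCoeff_idx_neg (s : Sgn) (x : ℕ → A) {c : ℤ} (hc : c < 0) {t : ℕ} (ht : t < 3) :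
    laurentCoeff s x (idx s c - t) = 0 := by
  unfold laurentCoeff
  cases s
  · change (if 0 ≤ (1 : ℤ) * (c - t) then x (c - t : ℤ).natAbs else 0) = 0
    rw [if_neg (by omega)]
  · change (if 0 ≤ (-1 : ℤ) * (2 - c - t) then x (2 - c - t : ℤ).natAbs else 0) = 0
    rw [if_neg (by omega)]

lemma idx_idx (s : Sgn) (c : ℤ) : idx s (idx s c) = c := by
  cases s <;> simp [idx]

variable [Algebra ℂ A]

/-- The linear forms `α U - β V` with `α β ≠ 0` are not zero divisors. -/
lemma eq_zero_of_linear_mul (s s' : Sgn) {α β : ℂ} (hα : α ≠ 0) (hβ : β ≠ 0) {f : Biv A}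
    (h : (α • parU s s' - β • parV s s') * f = 0) : f = 0 := by
  have hX : ∀ g : PowerSeries A, PowerSeries.X * g = 0 → g = 0 := fun g hg => by
    ext m
    simpa using congrArg (PowerSeries.coeff (m + 1)) hg
  have hs : ∀ {r : ℂ} {g : PowerSeries A}, r ≠ 0 → r • g = 0 → g = 0 := fun hr hg =>
    (smul_eq_zero_iff_right hr).mp hg
  rw [sub_mul, sub_eq_zero, smul_mul_assoc, smul_mul_assoc] at h
  have hm : ∀ d, α • PowerSeries.coeff d (parU s s' * f) = β • PowerSeries.coeff d (parV s s' * f) :=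
    fun d => by simpa using congrArg (PowerSeries.coeff d) h
  have h0 : ∀ g : Biv A, PowerSeries.coeff 0 (varV * g) = 0 := by simp [varV]
  have h1 : ∀ d (g : Biv A), PowerSeries.coeff (d + 1) (varV * g) = PowerSeries.coeff d g := by
    simp [varV, PowerSeries.coeff_succ_X_mul]
  have h2 : ∀ d (g : Biv A),
      PowerSeries.coeff d (varU * g) = PowerSeries.X * PowerSeries.coeff d g := by
    simp [varU]
  ext d : 1
  rw [map_zero]
  induction d with
  | zero =>
    have := hm 0
    cases s <;> cases s' <;>
      simp only [parU, parV, one_mul, mul_assoc, h0, h2, mul_zero, smul_zero] at this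
    · exact hX _ (hs hα this)
    · exact hs hβ this.symm
    · exact hs hα this
    · exact hX _ (hs hβ this.symm)
  | succ d ih =>
    have := hm (d + 1)
    cases s <;> cases s' <;>
      simp only [parU, parV, one_mul, mul_assoc, h1, h2, ih, mul_zero, smul_zero] at this
    · exact hX _ (hs hα this)
    · exact hs hβ this.symm
    · exact hs hα this
    · exact hX _ (hs hβ this.symm)

/-! ### Specialisation of the second variable -/

/-- The dilation `∑ x_m u^m ↦ ∑ c^m x_m u^m` of power series. -/
def dil (c : ℂ) : PowerSeries A →+* PowerSeries A where
  toFun f := PowerSeries.mk fun m => c ^ m • PowerSeries.coeff m f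
  map_one' := by
    ext m
    rcases m with _ | m <;> simp [PowerSeries.coeff_one]
  map_mul' f g := by
    ext m
    simp only [PowerSeries.coeff_mk, PowerSeries.coeff_mul, Finset.smul_sum]
    refine Finset.sum_congr rfl fun r hr => ?_
    rw [← Finset.HasAntidiagonal.mem_antidiagonal.mp hr, pow_add, smul_mul_smul_comm]
  map_zero' := by ext m; simp
  map_add' f g := by ext m; simp

@[simp] lemma coeff_dil (c : ℂ) (f : PowerSeries A) (m : ℕ) :
    PowerSeries.coeff m (dil c f) = c ^ m • PowerSeries.coeff m f := by
  simp [dil]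

lemma dil_smul (c r : ℂ) (f : PowerSeries A) : dil c (r • f) = r • dil c f := by
  ext m
  simp [smul_comm r]

lemma dil_dil (c c' : ℂ) (f : PowerSeries A) : dil c (dil c' f) = dil (c * c') f := by
  ext m
  simp [smul_smul, mul_pow]

lemma dil_one (f : PowerSeries A) : dil 1 f = f := by
  ext m
  simp

lemma scaleArg_eq_dil (s : Sgn) (c : ℂ) (f : PowerSeries A) :
    scaleArg s c f = dil (c ^ s.toInt) f := by
  ext m
  simp [scaleArg, zpow_mul]

/-- The substitution `v^{±1} = c u^{±1}`. -/
def diag (c : ℂ) : Biv A →ₗ[ℂ] PowerSeries A where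
  toFun f := PowerSeries.mk fun m => ∑ r ∈ Finset.HasAntidiagonal.antidiagonal m, c ^ r.2 • coeff₂ r.1 r.2 f
  map_add' f g := by ext m; simp [Finset.sum_add_distrib]
  map_smul' r f := by
    ext m
    simp [Finset.smul_sum, smul_comm r]

lemma coeff_diag (c : ℂ) (f : Biv A) (m : ℕ) : PowerSeries.coeff m (diag c f) =
    ∑ r ∈ Finset.HasAntidiagonal.antidiagonal m, c ^ r.2 • coeff₂ r.1 r.2 f := by
  simp [diag]

lemma diag_inU_mul_inV (c : ℂ) (f g : PowerSeries A) : diag c (inU f * inV g) = f * dil c g := by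
  ext m
  simp [coeff_diag, PowerSeries.coeff_mul, coeff₂_inU_mul_inV]

lemma diag_inV_mul_inU (c : ℂ) (f g : PowerSeries A) : diag c (inV g * inU f) = dil c g * f := by
  ext m
  rw [coeff_diag, PowerSeries.coeff_mul, ← Finset.Nat.sum_antidiagonal_swap]
  simp [coeff₂_inV_mul_inU]

lemma diag_varU_mul (c : ℂ) (f : Biv A) : diag c (varU * f) = PowerSeries.X * diag c f := by
  have h : ∀ m d, coeff₂ (m + 1) d (varU * f) = coeff₂ m d f := fun m d => by
    simp [coeff₂, varU, PowerSeries.coeff_succ_X_mul]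
  have h0 : ∀ d, coeff₂ 0 d (varU * f) = 0 := fun d => by
    simp [coeff₂, varU]
  ext m
  rcases m with _ | m
  · simp [coeff_diag, h0]
  · rw [coeff_diag, Finset.Nat.antidiagonal_succ, PowerSeries.coeff_succ_X_mul, coeff_diag]
    simp [h0, h]

lemma diag_varV_mul (c : ℂ) (f : Biv A) : diag c (varV * f) = c • (PowerSeries.X * diag c f) := by
  have h : ∀ m d, coeff₂ m (d + 1) (varV * f) = coeff₂ m d f := fun m d => by
    simp [coeff₂, varV, PowerSeries.coeff_succ_X_mul]
  have h0 : ∀ d, coeff₂ d 0 (varV * f) = 0 := fun d => by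
    simp [coeff₂, varV]
  ext m
  rcases m with _ | m
  · simp [coeff_diag, h0]
  · rw [coeff_diag, Finset.Nat.antidiagonal_succ', PowerSeries.coeff_smul, PowerSeries.coeff_succ_X_mul,
      coeff_diag, Finset.smul_sum]
    simp [h0, h, smul_smul, pow_succ']

/-- The scalar by which `U` differs from the variable of the specialised series. -/
def diagFactor (s : Sgn) (c : ℂ) : ℂ :=
  match s with
  | .plus => 1
  | .minus => c⁻¹

lemma diagFactor_ne_zero (s : Sgn) {c : ℂ} (hc : c ≠ 0) : diagFactor s c ≠ 0 := by
  cases s <;> simp [diagFactor, hc]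

/-- At `v = c u` the form `α U + β V` becomes proportional to `α + β c`. -/
lemma diag_linear_mul (s : Sgn) {c : ℂ} (hc : c ≠ 0) (α β : ℂ) (f : Biv A) :
    diag (c ^ s.toInt) ((α • parU s s + β • parV s s) * f) =
      (diagFactor s c * (α + β * c)) • (PowerSeries.X * diag (c ^ s.toInt) f) := by
  rw [add_mul, map_add, smul_mul_assoc, smul_mul_assoc, map_smul, map_smul]
  cases s <;> simp only [parU, parV, Sgn.toInt, diag_varU_mul, diag_varV_mul, diagFactor,
    smul_smul, ← add_smul]
  · simp
  · congr 1
    rw [zpow_neg_one]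
    field_simp

lemma eq_zero_of_smul_X_mul {r : ℂ} (hr : r ≠ 0) {f : PowerSeries A}
    (h : r • (PowerSeries.X * f) = 0) : f = 0 := by
  ext m
  have := congrArg (PowerSeries.coeff (m + 1)) ((smul_eq_zero_iff_right hr).mp h)
  simpa using this

end Bivariate

/-! ### The defining relations in terms of series -/

section Relations

variable {T : ClassicalType} {n : ℕ} {q p : ℂ} {A : Type*} [Ring A] [Algebra ℂ A]

lemma rho_commute {B : Type*} [Ring B] [Algebra ℂ B] {U V : B} {x : B} (hU : Commute U x)
    (hV : Commute V x) (i j k l : Idx T n) : Commute (rho T n q p U V i j k l) x := by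
  unfold rho
  exact Commute.sum_left _ _ _ fun t _ =>
    ((hU.pow_left t).mul_left (hV.pow_left (2 - t))).smul_left _

lemma coeff₂_rho_mul (s s' : Sgn) (i j k l : Idx T n) (f : Biv A) (c d : ℕ) :
    coeff₂ c d (rho T n q p (parU s s') (parV s s') i j k l * f) =
      ∑ t ∈ Finset.range 3, rCoeff T n q p i j k l t •
        if expo s t ≤ c ∧ expo s' (2 - t) ≤ d then
          coeff₂ (c - expo s t) (d - expo s' (2 - t)) f else 0 := by
  rw [rho, Finset.sum_mul, coeff₂_sum]
  refine Finset.sum_congr rfl fun t ht => ?_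
  rw [smul_mul_assoc, coeff₂_smul, parU_pow_mul_parV_pow s s' (Finset.mem_range.mp ht), mul_one,
    coeff₂_varU_pow_mul_varV_pow_mul]

/-- The relation `R(u, v) x_1(u) y_2(v) = y_2(v) x_1(u) R(u, v)` between matrices of series of the
signs `s`, `s'`, written in terms of coefficients, is the same relation between matrices over the
ring of series in two variables. -/
lemma RLL_biv_iff (s s' : Sgn) (x y : Idx T n → Idx T n → ℕ → A) :
    RLL T n q p (parU s s') (parV s s')
      (Matrix.of fun i j => inU (PowerSeries.mk (x i j)))
      (Matrix.of fun i j => inV (PowerSeries.mk (y i j))) ↔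
    ∀ (i j a b : Idx T n) (c d : ℤ),
      ∑ k, ∑ l, ∑ t ∈ Finset.range 3, rCoeff T n q p i j k l t •
        (laurentCoeff s (x k a) (c - t) * laurentCoeff s' (y l b) (d - (2 - t))) =
      ∑ k, ∑ l, ∑ t ∈ Finset.range 3, rCoeff T n q p k l a b t •
        (laurentCoeff s' (y j l) (d - (2 - t)) * laurentCoeff s (x i k) (c - t)) := by
  have hl : ∀ (i j a b : Idx T n) (c d : ℕ),
      coeff₂ c d (∑ k, ∑ l, rho T n q p (parU s s') (parV s s') i j k l *
        (inU (PowerSeries.mk (x k a)) * inV (PowerSeries.mk (y l b)))) =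
      ∑ k, ∑ l, ∑ t ∈ Finset.range 3, rCoeff T n q p i j k l t •
        (laurentCoeff s (x k a) (idx s c - t) * laurentCoeff s' (y l b) (idx s' d - (2 - t))) := by
    intro i j a b c d
    simp only [coeff₂_sum, coeff₂_rho_mul, coeff₂_inU_mul_inV, PowerSeries.coeff_mk]
    refine Finset.sum_congr rfl fun k _ => Finset.sum_congr rfl fun l _ =>
      Finset.sum_congr rfl fun t ht => ?_
    have ht' := Finset.mem_range.mp ht
    have e : (2 : ℤ) - t = ((2 - t : ℕ) : ℤ) := by omega
    rw [e, laurentCoeff_idx s _ c ht', laurentCoeff_idx s' _ d (t := 2 - t) (by omega)]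
    split_ifs <;> simp_all
  have hr : ∀ (i j a b : Idx T n) (c d : ℕ),
      coeff₂ c d (∑ k, ∑ l, inV (PowerSeries.mk (y j l)) * inU (PowerSeries.mk (x i k)) *
        rho T n q p (parU s s') (parV s s') k l a b) =
      ∑ k, ∑ l, ∑ t ∈ Finset.range 3, rCoeff T n q p k l a b t •
        (laurentCoeff s' (y j l) (idx s' d - (2 - t)) * laurentCoeff s (x i k) (idx s c - t)) := by
    intro i j a b c d
    have hcomm : ∀ (k l : Idx T n) (f : Biv A),
        f * rho T n q p (parU s s') (parV s s') k l a b =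
          rho T n q p (parU s s') (parV s s') k l a b * f := fun k l f =>
      (rho_commute (parU_commute s s' f) (parV_commute s s' f) k l a b).eq.symm
    simp only [hcomm]
    simp only [coeff₂_sum, coeff₂_rho_mul, coeff₂_inV_mul_inU, PowerSeries.coeff_mk]
    refine Finset.sum_congr rfl fun k _ => Finset.sum_congr rfl fun l _ =>
      Finset.sum_congr rfl fun t ht => ?_
    have ht' := Finset.mem_range.mp ht
    have e : (2 : ℤ) - t = ((2 - t : ℕ) : ℤ) := by omega
    rw [e, laurentCoeff_idx s _ c ht', laurentCoeff_idx s' _ d (t := 2 - t) (by omega)]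
    split_ifs <;> simp_all
  rw [RLL_iff]
  simp only [Matrix.of_apply]
  constructor
  · intro h i j a b c d
    rw [← idx_idx s c, ← idx_idx s' d]
    by_cases hc : 0 ≤ idx s c ∧ 0 ≤ idx s' d
    · obtain ⟨c', hc'⟩ := Int.eq_ofNat_of_zero_le hc.1
      obtain ⟨d', hd'⟩ := Int.eq_ofNat_of_zero_le hc.2
      rw [hc', hd', ← hl, ← hr, h]
    · have e : ∀ t ∈ Finset.range 3, (2 : ℤ) - t = ((2 - t : ℕ) : ℤ) := by
        intro t ht; have := Finset.mem_range.mp ht; omega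
      have hz : ∀ (x' y' : ℕ → A), ∀ t ∈ Finset.range 3,
          laurentCoeff s x' (idx s (idx s c) - t) = 0 ∨
          laurentCoeff s' y' (idx s' (idx s' d) - (2 - t)) = 0 := by
        intro x' y' t ht
        have ht' := Finset.mem_range.mp ht
        rcases not_and_or.mp hc with hc | hc
        · exact Or.inl (laurentCoeff_idx_neg s x' (not_le.mp hc) ht')
        · rw [e t ht]
          exact Or.inr (laurentCoeff_idx_neg s' y' (not_le.mp hc) (by omega))
      rw [Finset.sum_eq_zero, Finset.sum_eq_zero]
      · intro k _
        refine Finset.sum_eq_zero fun l _ => Finset.sum_eq_zero fun t ht => ?_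
        rcases hz (x i k) (y j l) t ht with h | h <;> simp [h]
      · intro k _
        refine Finset.sum_eq_zero fun l _ => Finset.sum_eq_zero fun t ht => ?_
        rcases hz (x k a) (y l b) t ht with h | h <;> simp [h]
  · intro h i j a b
    refine biv_ext fun c d => ?_
    rw [hl, hr, h]

end Relations

/-! ### Numerical data of the classical types -/

section Numbers

variable {T : ClassicalType} {n : ℕ}

/-- The sign `ε_i ε_{i'}`, which is `1` in the orthogonal and `-1` in the symplectic case. -/
def kap : ClassicalType → ℂ
  | .C => -1
  | _ => 1

/-- The number `q^{ε_i ε_{i'}}`. -/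
def qkap (q : ℂ) : ClassicalType → ℂ
  | .C => q⁻¹
  | _ => q

lemma rank_pos (hn : T.minRank ≤ n) : 1 ≤ n := by
  cases T <;> simp only [ClassicalType.minRank] at hn <;> omega

lemma kap_mul_self (T : ClassicalType) : kap T * kap T = 1 := by
  cases T <;> simp [kap]

lemma bar2_rev (i : Idx T n) : bar2 T n i.rev = -bar2 T n i := by
  have hi := i.isLt
  have hr := Fin.val_rev i
  cases T <;> simp only [bar2, dimN] at * <;> split_ifs <;> omega

lemma eps_mul_self (i : Idx T n) : eps T n i * eps T n i = 1 := by
  cases T <;> simp only [eps] <;> (try split_ifs) <;> norm_num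

lemma eps_rev (i : Idx T n) : eps T n i.rev = kap T * eps T n i := by
  have hi := i.isLt
  have hr := Fin.val_rev i
  cases T
  · simp [eps, kap]
  · change (i : ℕ) < 2 * n at hi
    change (i.rev : ℕ) = 2 * n - (i + 1) at hr
    simp only [eps, kap]
    by_cases h : (i : ℕ) < n
    · rw [if_neg (by omega), if_pos h]; norm_num
    · rw [if_pos (by omega), if_neg h]; norm_num
  · simp [eps, kap]

lemma kap_of_rev_eq {i : Idx T n} (h : i.rev = i) : kap T = 1 := by
  have h1 := eps_rev i
  rw [h] at h1
  have h2 : eps T n i ≠ 0 := fun h0 => by simpa [h0] using eps_mul_self i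
  exact mul_right_cancel₀ h2 (by rw [one_mul, ← h1])

lemma bar2_of_rev_eq {i : Idx T n} (h : i.rev = i) : bar2 T n i = 0 := by
  have := bar2_rev i
  rw [h] at this
  omega

lemma xi_ne_zero {q : ℂ} (hq0 : q ≠ 0) : xi T n q ≠ 0 := by
  cases T <;> exact zpow_ne_zero _ hq0

/-- The numbers `q^{2 ī}` sum up to `(q - q⁻¹) ∑_{l < k} q^{2 l̄} =
q^{±1} ξ⁻¹ - q^{2 k̄ + 1} ± [k' < k] (q - q⁻¹) + [k = k'] (q - 1)`. -/
lemma sum_lt_q_bar2 (hn : T.minRank ≤ n) {q : ℂ} (hq0 : q ≠ 0) (k : Idx T n) :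
    ∑ l, (if l < k then (q - q⁻¹) * q ^ bar2 T n l else 0) =
      qkap q T * (xi T n q)⁻¹ - q * q ^ bar2 T n k +
        (if k.rev < k then kap T * (q - q⁻¹) else 0) + (if k.rev = k then q - 1 else 0) := by
  have hn1 := rank_pos hn
  have hNn : dimN T n = 2 * n + 1 ∨ dimN T n = 2 * n := by cases T <;> simp [dimN]
  obtain ⟨k, hk⟩ := k
  induction k with
  | zero =>
    rw [Finset.sum_eq_zero (fun l _ => if_neg (by simp [Fin.lt_def])),
      if_neg (by simp [Fin.lt_def]), if_neg (by simp only [Fin.ext_iff, Fin.val_rev]; omega)]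
    cases T <;> simp only [qkap, xi, bar2, dimN] <;> rw [if_pos (by omega), ← zpow_neg]
    · rw [← zpow_one_add₀ hq0, ← zpow_one_add₀ hq0]; push_cast; ring_nf
    · rw [← zpow_neg_one, ← zpow_add₀ hq0, ← zpow_one_add₀ hq0]; push_cast; ring_nf
    · rw [← zpow_one_add₀ hq0, ← zpow_one_add₀ hq0]; push_cast; ring_nf
  | succ k ih =>
    have hk' : k < dimN T n := by omega
    have hsplit : ∀ l : Idx T n, (if l < ⟨k + 1, hk⟩ then (q - q⁻¹) * q ^ bar2 T n l else 0) =
        (if l < ⟨k, hk'⟩ then (q - q⁻¹) * q ^ bar2 T n l else 0) +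
          (if l = ⟨k, hk'⟩ then (q - q⁻¹) * q ^ bar2 T n l else 0) := by
      intro l
      simp only [Fin.lt_def, Fin.ext_iff]
      split_ifs <;> first | omega | simp
    rw [Finset.sum_congr rfl fun l _ => hsplit l, Finset.sum_add_distrib, ih hk',
      Finset.sum_ite_eq' Finset.univ, if_pos (Finset.mem_univ _)]
    simp only [Fin.lt_def, Fin.ext_iff, Fin.val_rev]
    have hz : ∀ a b : ℤ, a = b + 2 → q * q ^ b = q⁻¹ * q ^ a := by
      intro a b h; rw [h, zpow_add₀ hq0]; field_simp
    have hz1 : ∀ a b : ℤ, a = b + 1 → q ^ b = q⁻¹ * q ^ a := by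
      intro a b h; rw [h, zpow_add₀ hq0]; field_simp
    cases T
    · have hN : dimN .B n = 2 * n + 1 := rfl
      rcases lt_trichotomy (k + 1) n with h | h | h
      · rw [if_neg (by omega), if_neg (by omega), if_neg (by omega), if_neg (by omega)]
        have := hz (bar2 .B n ⟨k, hk'⟩) (bar2 .B n ⟨k + 1, hk⟩) (by
          simp only [bar2]; rw [if_pos (by omega), if_pos (by omega)]; push_cast; ring)
        linear_combination this
      · rw [if_neg (by omega), if_neg (by omega), if_neg (by omega), if_pos (by omega)]
        have h1 : bar2 .B n ⟨k + 1, hk⟩ = 0 := by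
          simp only [bar2]; rw [if_neg (by omega), if_pos (by omega)]
        have h2 : bar2 .B n ⟨k, hk'⟩ = 1 := by
          simp only [bar2]; rw [if_pos (by omega)]; omega
        rw [h1, h2]
        field_simp
        simp
      · rcases eq_or_lt_of_le (Nat.lt_succ_iff.mp h) with h | h
        · rw [if_neg (by omega), if_pos (by omega), if_pos (by omega), if_neg (by omega)]
          have h1 : bar2 .B n ⟨k + 1, hk⟩ = -1 := by
            simp only [bar2]; rw [if_neg (by omega), if_neg (by omega)]; push_cast; omega
          have h2 : bar2 .B n ⟨k, hk'⟩ = 0 := by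
            simp only [bar2]; rw [if_neg (by omega), if_pos (by omega)]
          rw [h1, h2]
          simp [kap]
          field_simp
        · rw [if_pos (by omega), if_neg (by omega), if_pos (by omega), if_neg (by omega)]
          have := hz (bar2 .B n ⟨k, hk'⟩) (bar2 .B n ⟨k + 1, hk⟩) (by
            simp only [bar2]
            rw [if_neg (by omega), if_neg (by omega), if_neg (by omega), if_neg (by omega)]
            push_cast; ring)
          linear_combination this
    · have hN : dimN .C n = 2 * n := rfl
      rcases lt_trichotomy (k + 1) n with h | h | h
      · rw [if_neg (by omega), if_neg (by omega), if_neg (by omega), if_neg (by omega)]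
        have := hz (bar2 .C n ⟨k, hk'⟩) (bar2 .C n ⟨k + 1, hk⟩) (by
          simp only [bar2]; rw [if_pos (by omega), if_pos (by omega)]; push_cast; ring)
        linear_combination this
      · rw [if_neg (by omega), if_neg (by omega), if_pos (by omega), if_neg (by omega)]
        have h1 : bar2 .C n ⟨k + 1, hk⟩ = -2 := by
          simp only [bar2]; rw [if_neg (by omega)]; push_cast; omega
        have h2 : bar2 .C n ⟨k, hk'⟩ = 2 := by
          simp only [bar2]; rw [if_pos (by omega)]; omega
        rw [h1, h2]
        simp only [kap, zpow_neg]
        field_simp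
        ring
      · rw [if_pos (by omega), if_neg (by omega), if_pos (by omega), if_neg (by omega)]
        have := hz (bar2 .C n ⟨k, hk'⟩) (bar2 .C n ⟨k + 1, hk⟩) (by
          simp only [bar2]; rw [if_neg (by omega), if_neg (by omega)]; push_cast; ring)
        linear_combination this
    · have hN : dimN .D n = 2 * n := rfl
      rcases lt_trichotomy (k + 1) n with h | h | h
      · rw [if_neg (by omega), if_neg (by omega), if_neg (by omega), if_neg (by omega)]
        have := hz (bar2 .D n ⟨k, hk'⟩) (bar2 .D n ⟨k + 1, hk⟩) (by
          simp only [bar2]; rw [if_pos (by omega), if_pos (by omega)]; push_cast; ring)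
        linear_combination this
      · rw [if_neg (by omega), if_neg (by omega), if_pos (by omega), if_neg (by omega)]
        have h1 : bar2 .D n ⟨k + 1, hk⟩ = 0 := by
          simp only [bar2]; rw [if_neg (by omega)]; push_cast; omega
        have h2 : bar2 .D n ⟨k, hk'⟩ = 0 := by
          simp only [bar2]; rw [if_pos (by omega)]; omega
        rw [h1, h2]
        simp [kap]
      · rw [if_pos (by omega), if_neg (by omega), if_pos (by omega), if_neg (by omega)]
        have := hz (bar2 .D n ⟨k, hk'⟩) (bar2 .D n ⟨k + 1, hk⟩) (by
          simp only [bar2]; rw [if_neg (by omega), if_neg (by omega)]; push_cast; ring)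
        linear_combination this

/-- `(q - q⁻¹) ∑_l q^{2 l̄} = q^{±1} ξ⁻¹ - q^{∓1} ξ ± (q - q⁻¹)`. -/
lemma sum_q_bar2 (hn : T.minRank ≤ n) {q : ℂ} (hq0 : q ≠ 0) :
    ∑ l, (q - q⁻¹) * q ^ bar2 T n l =
      qkap q T * (xi T n q)⁻¹ - (qkap q T)⁻¹ * xi T n q + kap T * (q - q⁻¹) := by
  have hn1 := rank_pos hn
  have hNn : 2 ≤ dimN T n := by cases T <;> simp only [dimN] <;> omega
  have h0 : (⟨0, by omega⟩ : Idx T n) < (⟨0, by omega⟩ : Idx T n).rev := by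
    simp only [Fin.lt_def, Fin.val_rev]; omega
  set o : Idx T n := ⟨0, by omega⟩ with ho
  have e1 := sum_lt_q_bar2 hn hq0 o
  have e2 := sum_lt_q_bar2 hn hq0 o.rev
  rw [Finset.sum_eq_zero (fun l _ => if_neg (by simp [ho, Fin.lt_def])), if_neg h0.asymm,
    if_neg h0.ne'] at e1
  rw [Fin.rev_rev, if_pos h0, if_neg h0.ne, bar2_rev, zpow_neg] at e2
  have hsplit : ∀ l : Idx T n, (q - q⁻¹) * q ^ bar2 T n l =
      (if l < o.rev then (q - q⁻¹) * q ^ bar2 T n l else 0) +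
        (if l = o.rev then (q - q⁻¹) * q ^ bar2 T n l else 0) := by
    intro l
    have := l.isLt
    simp only [Fin.lt_def, Fin.ext_iff, Fin.val_rev, ho]
    split_ifs <;> first | omega | simp
  rw [Finset.sum_congr rfl fun l _ => hsplit l, Finset.sum_add_distrib, e2,
    Finset.sum_ite_eq' Finset.univ, if_pos (Finset.mem_univ _), bar2_rev, zpow_neg]
  have hx := xi_ne_zero (T := T) (n := n) hq0
  have hy : q ^ bar2 T n o ≠ 0 := zpow_ne_zero _ hq0
  have hk : qkap q T ≠ 0 := by cases T <;> simp [qkap, hq0]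
  have e3 : q ^ bar2 T n o = q⁻¹ * (qkap q T * (xi T n q)⁻¹) := by
    field_simp
    field_simp at e1
    linear_combination e1
  rw [e3]
  field_simp
  ring

lemma sum_gt_q_bar2 (hn : T.minRank ≤ n) {q : ℂ} (hq0 : q ≠ 0) (k : Idx T n) :
    ∑ l, (if k < l then (q - q⁻¹) * q ^ bar2 T n l else 0) =
      q⁻¹ * q ^ bar2 T n k - (qkap q T)⁻¹ * xi T n q +
        (if k.rev < k then 0 else kap T * (q - q⁻¹)) - (if k.rev = k then q - 1 else 0) := by
  have hsplit : ∀ l : Idx T n, (if k < l then (q - q⁻¹) * q ^ bar2 T n l else 0) =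
      (q - q⁻¹) * q ^ bar2 T n l - (if l < k then (q - q⁻¹) * q ^ bar2 T n l else 0) -
        (if l = k then (q - q⁻¹) * q ^ bar2 T n l else 0) := by
    intro l
    rcases lt_trichotomy l k with h | h | h
    · simp [h, h.ne, h.asymm]
    · simp [h]
    · simp [h, h.ne', h.asymm]
  rw [Finset.sum_congr rfl fun l _ => hsplit l, Finset.sum_sub_distrib, Finset.sum_sub_distrib,
    sum_lt_q_bar2 hn hq0, sum_q_bar2 hn hq0, Finset.sum_ite_eq' Finset.univ,
    if_pos (Finset.mem_univ _)]
  split_ifs <;> ring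

end Numbers

/-! ### Crossing symmetry of the R-matrix -/

section Crossing

variable {T : ClassicalType} {n : ℕ}

/-- `U q^{δ_ij} - V q^{-δ_ij}`. -/
def alph {ι : Type*} [LinearOrder ι] (q U V : ℂ) (i j : ι) : ℂ :=
  if i = j then q * U - q⁻¹ * V else U - V

/-- `(q - q⁻¹) (U δ_{i<j} + V δ_{j<i})`. -/
def bet {ι : Type*} [LinearOrder ι] (q U V : ℂ) (i j : ι) : ℂ :=
  (q - q⁻¹) * ((if i < j then U else 0) + (if j < i then V else 0))

/-- The diagonal entry `d_ii(U, V)`. -/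
def dDiag (T : ClassicalType) (n : ℕ) (q U V : ℂ) (i : Idx T n) : ℂ :=
  if i.rev = i then (1 - q⁻¹) * (q * U + xi T n q * V) else (1 - q⁻¹) * (U + q * xi T n q * V)

/-- The entry `d_ij(U, V)` without its factor `q^{ī - j̄} ε_i ε_j`. -/
def dRed (T : ClassicalType) (n : ℕ) (q U V : ℂ) (i j : Idx T n) : ℂ :=
  (if i < j then (q - q⁻¹) * (xi T n q * V) else 0) + (if j < i then (q - q⁻¹) * U else 0) +
    (if i = j then dDiag T n q U V i else 0)

lemma a_eq {ι : Type*} [LinearOrder ι] (q U V : ℂ) (i j k l : ι) :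
    aU q i j k l * U + aV q i j k l * V =
      (if i = k ∧ j = l then alph q U V i j else 0) +
        (if j = k ∧ i = l then bet q U V i j else 0) := by
  unfold aU aV alph bet
  split_ifs <;> ring

lemma d_eq {q p : ℂ} (hp : p ≠ 0) (U V : ℂ) (i j : Idx T n) :
    dU T n q p i j * U + dV T n q p i j * V =
      p ^ bar2 T n i * eps T n i * (p ^ (-bar2 T n j) * eps T n j) * dRed T n q U V i j := by
  unfold dU dV dRed dDiag
  rw [sub_eq_add_neg (bar2 T n i), zpow_add₀ hp]
  rcases lt_trichotomy i j with h | h | h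
  · simp only [h, h.not_gt, h.ne, if_true, if_false]; ring
  · subst h
    have e := eps_mul_self i
    have e' : p ^ bar2 T n i * p ^ (-bar2 T n i) = 1 := by
      rw [← zpow_add₀ hp]; simp
    have : p ^ bar2 T n i * eps T n i * (p ^ (-bar2 T n i) * eps T n i) = 1 := by
      linear_combination e' * eps T n i * eps T n i + e
    rw [this]
    by_cases h : i.rev = i
    · simp [h]; ring
    · simp [h, Ne.symm h]; ring
  · simp only [h, h.not_gt, h.ne', if_true, if_false]; ring

/-- The numbers `η_l = q^{-l̄} ε_l`: the vector `∑_l η_l e_{l'} ⊗ e_l` spans the image of the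
residue of the R-matrix. -/
def eta (T : ClassicalType) (n : ℕ) (p : ℂ) (l : Idx T n) : ℂ := p ^ (-bar2 T n l) * eps T n l

lemma eta_rev (p : ℂ) (l : Idx T n) :
    eta T n p l.rev = kap T * (p ^ bar2 T n l * eps T n l) := by
  rw [eta, bar2_rev, neg_neg, eps_rev]; ring

lemma rho_complex (q p U V : ℂ) (hp : p ≠ 0) (i j k l : Idx T n) :
    rho T n q p U V i j k l =
      (U - xi T n q * V) * ((if i = k ∧ j = l then alph q U V i j else 0) +
        (if j = k ∧ i = l then bet q U V i j else 0)) -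
      (if i = j.rev ∧ k = l.rev then (U - V) *
        (p ^ bar2 T n j * eps T n j * eta T n p l * dRed T n q U V j l) else 0) := by
  rw [rho_eq (Commute.all U V)]
  simp only [smul_eq_mul, a_eq, d_eq hp, eta]

/-- `∑_l q^{2 l̄} (q - q⁻¹) (ξ U δ_{l<c} + V δ_{l>c}) d_lg(U, V)`, the terms of `d_lg` being taken
without the factor `q^{l̄ - ḡ} ε_l ε_g`. -/
lemma sum_bet_dRed (q U V : ℂ) (c g : Idx T n) :
    ∑ l, q ^ bar2 T n l * (bet q (xi T n q * U) V l c * dRed T n q U V l g) =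
      if c < g then
        (xi T n q * U * (xi T n q * V) - V * (xi T n q * V)) * (q - q⁻¹) *
            (∑ l, (if l < c then (q - q⁻¹) * q ^ bar2 T n l else 0)) +
          V * (xi T n q * V) * (q - q⁻¹) *
            ((∑ l, (if l < g then (q - q⁻¹) * q ^ bar2 T n l else 0))
              - (q - q⁻¹) * q ^ bar2 T n c) +
          V * U * (q - q⁻¹) * (∑ l, (if g < l then (q - q⁻¹) * q ^ bar2 T n l else 0)) +
          (q - q⁻¹) * V * q ^ bar2 T n g * dDiag T n q U V g
      else if g < c then
        (xi T n q * U * (xi T n q * V) - xi T n q * U * U) * (q - q⁻¹) *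
            (∑ l, (if l < g then (q - q⁻¹) * q ^ bar2 T n l else 0)) +
          xi T n q * U * U * (q - q⁻¹) *
            ((∑ l, (if l < c then (q - q⁻¹) * q ^ bar2 T n l else 0))
              - (q - q⁻¹) * q ^ bar2 T n g) +
          V * U * (q - q⁻¹) * (∑ l, (if c < l then (q - q⁻¹) * q ^ bar2 T n l else 0)) +
          (q - q⁻¹) * (xi T n q * U) * q ^ bar2 T n g * dDiag T n q U V g
      else
        xi T n q * U * (xi T n q * V) * (q - q⁻¹) *
            (∑ l, (if l < g then (q - q⁻¹) * q ^ bar2 T n l else 0)) +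
          V * U * (q - q⁻¹) * (∑ l, (if g < l then (q - q⁻¹) * q ^ bar2 T n l else 0)) := by
  have hs : ∀ (k : Idx T n) (f : Idx T n → ℂ), f k = ∑ l, if l = k then f l else 0 := by
    intro k f; simp
  rcases lt_trichotomy c g with h | h | h
  · rw [if_pos h, hs c fun l => (q - q⁻¹) * q ^ bar2 T n l,
      mul_assoc ((q - q⁻¹) * V), hs g fun l => q ^ bar2 T n l * dDiag T n q U V l]
    simp only [Finset.mul_sum, ← Finset.sum_add_distrib, ← Finset.sum_sub_distrib]
    refine Finset.sum_congr rfl fun l _ => ?_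
    unfold bet dRed
    rcases lt_trichotomy l c with h1 | h1 | h1
    · have h2 := h1.trans h
      simp [h1, h1.not_gt, h1.ne, h2, h2.not_gt, h2.ne]; ring
    · subst h1
      simp [h, h.not_gt, h.ne]
    · rcases lt_trichotomy l g with h2 | h2 | h2
      · simp [h1, h1.not_gt, h1.ne', h2, h2.not_gt, h2.ne]; ring
      · subst h2
        simp [h1, h1.not_gt, h1.ne']; ring
      · simp [h1, h1.not_gt, h1.ne', h2, h2.not_gt, h2.ne']; ring
  · subst h
    rw [if_neg (lt_irrefl _), if_neg (lt_irrefl _)]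
    simp only [Finset.mul_sum, ← Finset.sum_add_distrib]
    refine Finset.sum_congr rfl fun l _ => ?_
    unfold bet dRed
    rcases lt_trichotomy l c with h1 | h1 | h1
    · simp [h1, h1.not_gt, h1.ne]; ring
    · simp [h1]
    · simp [h1, h1.not_gt, h1.ne']; ring
  · rw [if_neg h.not_gt, if_pos h, hs g fun l => (q - q⁻¹) * q ^ bar2 T n l,
      mul_assoc ((q - q⁻¹) * (xi T n q * U)), hs g fun l => q ^ bar2 T n l * dDiag T n q U V l]
    simp only [Finset.mul_sum, ← Finset.sum_add_distrib, ← Finset.sum_sub_distrib]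
    refine Finset.sum_congr rfl fun l _ => ?_
    unfold bet dRed
    rcases lt_trichotomy l g with h1 | h1 | h1
    · have h2 := h1.trans h
      simp [h1, h1.not_gt, h1.ne, h2, h2.not_gt]; ring
    · subst h1
      simp [h, h.not_gt]; ring
    · rcases lt_trichotomy l c with h2 | h2 | h2
      · simp [h1, h1.not_gt, h1.ne', h2, h2.not_gt]; ring
      · subst h2
        simp [h1, h1.not_gt, h1.ne']
      · simp [h1, h1.not_gt, h1.ne', h2, h2.not_gt]; ring

/-- The scalar in the crossing symmetry relation. -/
def crossF (ξ q U V : ℂ) : ℂ :=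
  ξ * (ξ * U - V) * (U - q ^ 2 * V) * (U - q⁻¹ ^ 2 * V) * (U - ξ * V)

set_option maxHeartbeats 4000000 in
/-- The crossing symmetry relation on the span of the vectors `e_{i'} ⊗ e_i`, the only block on which
the last term of the R-matrix contributes; the sums over the indices are geometric. -/
lemma crossing_scalar (hn : T.minRank ≤ n) {q : ℂ} (hq0 : q ≠ 0) (U V : ℂ) (c g : Idx T n) :
    kap T * q ^ bar2 T n c * (xi T n q * (U - V)) * (q * (xi T n q * U) - q⁻¹ * V) *
        (-(U - V) * dRed T n q U V c g) +
      (if c = g then kap T * q ^ bar2 T n g * (xi T n q * (U - V)) *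
        (q * (xi T n q * U) - q⁻¹ * V) * ((U - xi T n q * V) * alph q U V c.rev c) else 0) +
      (if c = g.rev then xi T n q * (U - V) * (q * (xi T n q * U) - q⁻¹ * V) *
        ((U - xi T n q * V) * bet q U V c.rev c) else 0) +
      xi T n q * (U - V) *
        (kap T * q ^ bar2 T n g * bet q (xi T n q * U) V g c *
            ((U - xi T n q * V) * alph q U V g.rev g) +
          bet q (xi T n q * U) V g.rev c * ((U - xi T n q * V) * bet q U V g g.rev) -
          (U - V) * kap T *
            ∑ l, q ^ bar2 T n l * (bet q (xi T n q * U) V l c * dRed T n q U V l g)) -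
      (xi T n q * U - V) * dRed T n q (xi T n q * U) V c c.rev *
        ((if c = g.rev then (U - xi T n q * V) * alph q U V c c.rev else 0) +
          (if c = g then kap T * q ^ bar2 T n g * ((U - xi T n q * V) * bet q U V c c.rev) else 0) -
          (U - V) * dRed T n q U V c.rev g) =
    if c = g then crossF (xi T n q) q U V * (kap T * q ^ bar2 T n g) else 0 := by
  rw [sum_bet_dRed]
  simp only [sum_lt_q_bar2 hn hq0, sum_gt_q_bar2 hn hq0]
  have hx := xi_ne_zero (T := T) (n := n) hq0
  have hQ : (kap T = 1 ∧ qkap q T = q) ∨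
      (kap T = -1 ∧ qkap q T = q⁻¹ ∧ ∀ i : Idx T n, i.rev ≠ i) := by
    cases T
    · exact Or.inl ⟨rfl, rfl⟩
    · refine Or.inr ⟨rfl, rfl, fun i h => ?_⟩
      have := kap_of_rev_eq h
      norm_num [kap] at this
    · exact Or.inl ⟨rfl, rfl⟩
  have hrev : (c : ℕ) + g + 1 = dimN T n → q ^ bar2 T n c = (q ^ bar2 T n g)⁻¹ := fun h => by
    have : c = g.rev := by simp only [Fin.ext_iff, Fin.val_rev]; omega
    rw [this, bar2_rev, zpow_neg]
  have hone : ∀ i : Idx T n, (i : ℕ) + i + 1 = dimN T n → i.rev = i := fun i h => by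
    simp only [Fin.ext_iff, Fin.val_rev]; omega
  have hyone : ∀ i : Idx T n, (i : ℕ) + i + 1 = dimN T n → q ^ bar2 T n i = 1 := fun i h => by
    rw [bar2_of_rev_eq (hone i h), zpow_zero]
  have hyc : q ^ bar2 T n c ≠ 0 := zpow_ne_zero _ hq0
  have hyg : q ^ bar2 T n g ≠ 0 := zpow_ne_zero _ hq0
  have hcg : (c : ℕ) = g → q ^ bar2 T n c = q ^ bar2 T n g := fun h => by rw [Fin.ext h]
  have hyc1 := hyone c
  have hyg1 := hyone g
  have hNc := c.isLt
  have hNg := g.isLt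
  unfold bet alph dRed dDiag crossF
  simp only [Fin.lt_def, Fin.ext_iff, Fin.val_rev]
  generalize q ^ bar2 T n c = yc at *
  generalize q ^ bar2 T n g = yg at *
  generalize xi T n q = ξ at *
  -- the position of the indices `c`, `g`, `c'`, `g'` relative to each other; in each possible case
  -- the claim is an identity of rational functions
  rcases lt_trichotomy (c : ℕ) g with h1 | h1 | h1 <;>
  rcases lt_trichotomy ((c : ℕ) + c + 1) (dimN T n) with h2 | h2 | h2 <;>
  rcases lt_trichotomy ((g : ℕ) + g + 1) (dimN T n) with h3 | h3 | h3 <;>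
  rcases lt_trichotomy ((c : ℕ) + g + 1) (dimN T n) with h4 | h4 | h4 <;>
  first
  | (exfalso; omega)
  | (simp (disch := omega) only [if_pos, if_neg]
     try rw [hcg h1]
     try rw [hrev h4]
     try rw [hyc1 h2]
     try rw [hyg1 h3]
     rcases hQ with ⟨hk, hQ⟩ | ⟨hk, hQ, hQ'⟩ <;> rw [hk, hQ] <;>
     first
     | (field_simp; ring1)
     | exact absurd (hone c h2) (hQ' c)
     | exact absurd (hone g h3) (hQ' g))

end Crossing

section Crossing

variable {T : ClassicalType} {n : ℕ}

lemma sum_eta_rho_mul {q p : ℂ} (hp : p ≠ 0) (U V : ℂ) (c a : Idx T n)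
    (f : Idx T n → Idx T n → ℂ) :
    ∑ l, ∑ m, eta T n p l * (rho T n q p (xi T n q * U) V l.rev c a m * f l m) =
      eta T n p a.rev * (xi T n q * (U - V) * alph q (xi T n q * U) V a c * f a.rev c) +
      (if c = a then
        ∑ l, eta T n p l * (xi T n q * (U - V) * bet q (xi T n q * U) V l.rev c * f l l.rev)
        else 0) -
      (xi T n q * U - V) * dRed T n q (xi T n q * U) V c a.rev * eta T n p a.rev * f c a.rev := by
  have hterm : ∀ l m, eta T n p l * (rho T n q p (xi T n q * U) V l.rev c a m * f l m) =
      (if m = c then (if l = a.rev then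
        eta T n p l * (xi T n q * (U - V) * alph q (xi T n q * U) V a c * f l m) else 0) else 0) +
      (if m = l.rev then (if c = a then
        eta T n p l * (xi T n q * (U - V) * bet q (xi T n q * U) V l.rev c * f l m) else 0)
        else 0) -
      (if m = a.rev then (if l = c then (xi T n q * U - V) * dRed T n q (xi T n q * U) V c m *
          eta T n p m * f l m else 0) else 0) := by
    intro l m
    rw [rho_complex _ _ _ _ hp]
    have e1 : (l.rev = a ∧ c = m) ↔ (m = c ∧ l = a.rev) := by
      constructor
      · rintro ⟨rfl, rfl⟩; simp
      · rintro ⟨rfl, rfl⟩; simp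
    have e2 : (c = a ∧ l.rev = m) ↔ (m = l.rev ∧ c = a) := by
      constructor
      · rintro ⟨rfl, rfl⟩; simp
      · rintro ⟨rfl, rfl⟩; simp
    have e3 : (l.rev = c.rev ∧ a = m.rev) ↔ (m = a.rev ∧ l = c) := by
      rw [Fin.rev_inj]
      constructor
      · rintro ⟨rfl, rfl⟩; simp
      · rintro ⟨rfl, rfl⟩; simp
    have e4 : p ^ bar2 T n c * eps T n c * eta T n p c = 1 := by
      have h1 := eps_mul_self c
      have h2 : p ^ bar2 T n c * p ^ (-bar2 T n c) = 1 := by rw [← zpow_add₀ hp]; simp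
      unfold eta
      linear_combination eps T n c * eps T n c * h2 + h1
    simp only [e1, e2, e3, ← ite_and]
    have e5 : (if m = c ∧ l = a.rev then alph q (xi T n q * U) V l.rev c else 0) =
        (if m = c ∧ l = a.rev then alph q (xi T n q * U) V a c else 0) := by
      split_ifs with h
      · rw [h.2, Fin.rev_rev]
      · rfl
    have e6 : (if m = a.rev ∧ l = c then (xi T n q * U - V) * (p ^ bar2 T n c * eps T n c *
        eta T n p m * dRed T n q (xi T n q * U) V c m) else 0) * eta T n p l =
        (if m = a.rev ∧ l = c then (xi T n q * U - V) * dRed T n q (xi T n q * U) V c m *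
        eta T n p m else 0) := by
      split_ifs with h
      · rw [h.2]; linear_combination (xi T n q * U - V) *
          eta T n p m * dRed T n q (xi T n q * U) V c m * e4
      · simp
    rw [e5]
    have e7 : ∀ (P : Prop) [Decidable P], ∃ χ : ℂ, ∀ x : ℂ, (if P then x else 0) = χ * x :=
      fun P _ => ⟨if P then 1 else 0, fun x => by split_ifs <;> simp⟩
    obtain ⟨χ₁, h1⟩ := e7 (m = c ∧ l = a.rev)
    obtain ⟨χ₂, h2⟩ := e7 (m = l.rev ∧ c = a)
    obtain ⟨χ₃, h3⟩ := e7 (m = a.rev ∧ l = c)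
    simp only [h1, h2, h3] at e6 ⊢
    linear_combination -f l m * e6
  simp only [hterm, Finset.sum_add_distrib, Finset.sum_sub_distrib, Finset.sum_ite_eq',
    Finset.mem_univ, if_true]
  congr 2
  split_ifs <;> simp

/-- Crossing symmetry at complex parameters. -/
lemma crossing_complex (hn : T.minRank ≤ n) {q p : ℂ} (hq0 : q ≠ 0) (hp : p ^ 2 = q) (U V : ℂ)
    (a b c e : Idx T n) :
    ∑ l, ∑ m, eta T n p l * (rho T n q p (xi T n q * U) V l.rev c a m *
        rho T n q p U V l m b e) =
      if a = b.rev ∧ c = e then crossF (xi T n q) q U V * eta T n p b else 0 := by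
  have hp0 : p ≠ 0 := by rintro rfl; exact hq0 (by rw [← hp]; simp)
  have hww : ∀ i : Idx T n, p ^ bar2 T n i * p ^ bar2 T n i = q ^ bar2 T n i := fun i => by
    rw [← mul_zpow, ← pow_two, hp]
  have hwe : ∀ i : Idx T n, p ^ bar2 T n i * eps T n i * eta T n p i = 1 := fun i => by
    have h1 := eps_mul_self i
    have h2 : p ^ bar2 T n i * p ^ (-bar2 T n i) = 1 := by rw [← zpow_add₀ hp0]; simp
    unfold eta
    linear_combination eps T n i * eps T n i * h2 + h1
  have hrevη : ∀ i : Idx T n, eta T n p i.rev = kap T * q ^ bar2 T n i * eta T n p i := fun i => by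
    rw [eta_rev]
    linear_combination -kap T * (p ^ bar2 T n i * eps T n i) * hwe i + kap T * eta T n p i *
      (p ^ bar2 T n i) ^ 2 * eps_mul_self i + kap T * eta T n p i * hww i
  have hinv : ∀ i : Idx T n, p ^ bar2 T n i.rev * eps T n i.rev = kap T * eta T n p i := fun i => by
    rw [bar2_rev, eps_rev, eta]; ring
  have hkk := kap_mul_self T
  have hηη : ∀ i : Idx T n, eta T n p i.rev * (p ^ bar2 T n i * eps T n i) =
      kap T * q ^ bar2 T n i := fun i => by
    rw [hrevη]; linear_combination kap T * q ^ bar2 T n i * hwe i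
  rw [sum_eta_rho_mul hp0]
  by_cases hca : c = a
  · subst hca
    rw [if_pos rfl]
    -- both R-matrices act on the span of the vectors `e_{i'} ⊗ e_i` if `b = e'`
    by_cases hbe : b = e.rev
    · subst hbe
      have key := crossing_scalar hn hq0 U V c e
      have hsum : ∑ l, eta T n p l * (xi T n q * (U - V) * bet q (xi T n q * U) V l.rev c *
          rho T n q p U V l l.rev e.rev e) = eta T n p e * (xi T n q * (U - V) *
        (kap T * q ^ bar2 T n e * bet q (xi T n q * U) V e c *
            ((U - xi T n q * V) * alph q U V e.rev e) +
          bet q (xi T n q * U) V e.rev c * ((U - xi T n q * V) * bet q U V e e.rev) -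
          (U - V) * kap T *
            ∑ l, q ^ bar2 T n l * (bet q (xi T n q * U) V l c * dRed T n q U V l e))) := by
        have ht : ∀ l : Idx T n, eta T n p l * (xi T n q * (U - V) *
            bet q (xi T n q * U) V l.rev c * rho T n q p U V l l.rev e.rev e) =
            (if l = e.rev then xi T n q * (U - V) * (eta T n p e.rev *
              bet q (xi T n q * U) V e c * ((U - xi T n q * V) * alph q U V e.rev e)) else 0) +
            (if l = e then xi T n q * (U - V) * (eta T n p e *
              bet q (xi T n q * U) V e.rev c * ((U - xi T n q * V) * bet q U V e e.rev)) else 0) -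
            eta T n p e * (xi T n q * (U - V) * (U - V) * kap T) * (q ^ bar2 T n l.rev *
              (bet q (xi T n q * U) V l.rev c * dRed T n q U V l.rev e)) := by
          intro l
          have h1 : (l = e.rev ∧ l.rev = e) ↔ l = e.rev :=
            ⟨fun h => h.1, fun h => ⟨h, by rw [h, Fin.rev_rev]⟩⟩
          have h2 : (l.rev = e.rev ∧ l = e) ↔ l = e := by simp
          have h3 := hηη l.rev
          rw [Fin.rev_rev] at h3
          rw [rho_complex _ _ _ _ hp0]
          simp only [h1, h2, Fin.rev_rev, if_true, and_self]
          by_cases hl : l = e.rev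
          · by_cases hl' : l = e
            · have hee : e.rev = e := by rw [← hl, hl']
              simp only [if_pos hl, if_pos hl']
              rw [hl', hee] at h3 ⊢
              linear_combination -(xi T n q * (U - V) * bet q (xi T n q * U) V e c *
                ((U - V) * (eta T n p e * dRed T n q U V e e))) * h3
            · simp only [if_pos hl, if_neg hl']
              rw [hl, Fin.rev_rev] at h3 ⊢
              linear_combination -(xi T n q * (U - V) * bet q (xi T n q * U) V e c *
                ((U - V) * (eta T n p e * dRed T n q U V e e))) * h3
          · by_cases hl' : l = e
            · simp only [if_neg hl, if_pos hl']
              rw [hl'] at h3 ⊢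
              linear_combination -(xi T n q * (U - V) * bet q (xi T n q * U) V e.rev c *
                ((U - V) * (eta T n p e * dRed T n q U V e.rev e))) * h3
            · simp only [if_neg hl, if_neg hl']
              linear_combination -(xi T n q * (U - V) * bet q (xi T n q * U) V l.rev c *
                ((U - V) * (eta T n p e * dRed T n q U V l.rev e))) * h3
        have hre : ∑ l : Idx T n, (q ^ bar2 T n l.rev *
              (bet q (xi T n q * U) V l.rev c * dRed T n q U V l.rev e)) =
            ∑ l : Idx T n, (q ^ bar2 T n l *
              (bet q (xi T n q * U) V l c * dRed T n q U V l e)) :=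
          Equiv.sum_comp Fin.revPerm (fun l => q ^ bar2 T n l *
              (bet q (xi T n q * U) V l c * dRed T n q U V l e))
        simp only [ht, Finset.sum_add_distrib, Finset.sum_sub_distrib, Finset.sum_ite_eq',
          Finset.mem_univ, if_true]
        rw [← Finset.mul_sum, hre, hrevη e]
        ring
      rw [hsum]
      have hα : alph q (xi T n q * U) V c c = q * (xi T n q * U) - q⁻¹ * V := by simp [alph]
      have i1 : (c.rev = e.rev ∧ c = e) ↔ c = e := by simp
      have i2 : (c = e.rev ∧ c.rev = e) ↔ c = e.rev :=
        ⟨fun h => h.1, fun h => ⟨h, by rw [h, Fin.rev_rev]⟩⟩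
      have f1 : (if c = e then (1 : ℂ) else 0) * eta T n p c.rev =
          (if c = e then (1 : ℂ) else 0) * (kap T * q ^ bar2 T n e * eta T n p e) := by
        split_ifs with h
        · rw [h, hrevη]
        · simp
      have f2 : (if c = e.rev then (1 : ℂ) else 0) * eta T n p c.rev =
          (if c = e.rev then (1 : ℂ) else 0) * eta T n p e := by
        split_ifs with h
        · rw [h, Fin.rev_rev]
        · simp
      have g1 : ∀ x : ℂ, (if c = e then x else 0) = (if c = e then 1 else 0) * x := fun x => by
        split_ifs <;> simp
      have g2 : ∀ x : ℂ, (if c = e.rev then x else 0) = (if c = e.rev then 1 else 0) * x :=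
        fun x => by split_ifs <;> simp
      obtain ⟨χ₁, hχ₁⟩ : ∃ χ : ℂ, χ = if c = e then 1 else 0 := ⟨_, rfl⟩
      obtain ⟨χ₂, hχ₂⟩ : ∃ χ : ℂ, χ = if c = e.rev then 1 else 0 := ⟨_, rfl⟩
      rw [← hχ₁] at g1 f1
      rw [← hχ₂] at g2 f2
      rw [rho_complex _ _ _ _ hp0, rho_complex _ _ _ _ hp0]
      simp only [i1, i2, Fin.rev_rev, and_self, if_true, g1, g2, hα] at key ⊢
      have h3 := hwe c.rev
      linear_combination eta T n p e * key +
        xi T n q * (U - V) * (q * (xi T n q * U) - q⁻¹ * V) *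
          ((U - xi T n q * V) * (alph q U V c.rev c * f1 + bet q U V c.rev c * f2) -
            (U - V) * eta T n p e * dRed T n q U V c e * hηη c) -
        (xi T n q * U - V) * dRed T n q (xi T n q * U) V c c.rev *
          ((U - xi T n q * V) * (alph q U V c c.rev * f2 + bet q U V c c.rev * f1) -
            (U - V) * eta T n p e * dRed T n q U V c.rev e * h3) -
        χ₁ * crossF (xi T n q) q U V * hrevη e
    · have h0 : ∀ l : Idx T n, rho T n q p U V l l.rev b e = 0 := by
        intro l
        rw [rho_complex _ _ _ _ hp0, if_neg, if_neg, if_neg]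
        · ring
        · rintro ⟨-, h⟩; exact hbe h
        · rintro ⟨rfl, rfl⟩; exact hbe rfl
        · rintro ⟨rfl, rfl⟩; exact hbe (by rw [Fin.rev_rev])
      have h0' := h0 c.rev
      rw [Fin.rev_rev] at h0'
      simp only [h0, h0', mul_zero, Finset.sum_const_zero]
      rw [if_neg]
      · ring
      · rintro ⟨h1, h2⟩; exact hbe (by rw [← h2, h1, Fin.rev_rev])
  · rw [if_neg hca, rho_complex _ _ _ _ hp0, rho_complex _ _ _ _ hp0,
      if_neg (fun h : a.rev = c.rev ∧ _ => hca (Fin.rev_inj.mp h.1).symm),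
      if_neg (fun h : c = a.rev.rev ∧ _ => hca (by rw [h.1, Fin.rev_rev]))]
    have iff1 : (a.rev = b ∧ c = e) ↔ (a = b.rev ∧ c = e) := by
      rw [Fin.rev_eq_iff]
    by_cases h1 : a = b.rev ∧ c = e
    · obtain ⟨rfl, rfl⟩ := h1
      simp only [Fin.rev_rev, and_self, if_true]
      by_cases hcb : c = b
      · subst hcb
        simp only [and_self, if_true]
        have e1 : ¬ c.rev = c := fun h => hca h.symm
        simp only [alph, bet, dRed, dDiag, crossF, e1, if_false, if_true, lt_irrefl]
        field_simp
        ring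
      · have e2 : ¬ b = c := fun h => hcb h.symm
        have e1 : ¬ b.rev = c := fun h => hca h.symm
        simp only [hcb, e2, false_and, if_false]
        rcases lt_or_gt_of_ne hcb with h | h
        · simp only [alph, bet, dRed, crossF, e1, e2, hcb, h, h.not_gt, if_false, if_true]
          field_simp
          ring
        · simp only [alph, bet, dRed, crossF, e1, e2, hcb, h, h.not_gt, if_false, if_true]
          field_simp
          ring
    · rw [if_neg h1, if_neg (fun h => h1 (iff1.mp h)), if_neg (fun h => h1 (iff1.mp h))]
      by_cases h2 : c = b ∧ a.rev = e
      · obtain ⟨rfl, rfl⟩ := h2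
        have e1 : ¬ c = a.rev := fun h => h1 ⟨by rw [h, Fin.rev_rev], h⟩
        have e2 : ¬ a = c := fun h => hca h.symm
        simp only [and_self, if_true]
        rcases lt_or_gt_of_ne e1 with h | h
        · simp only [alph, bet, dRed, e1, e2, h, h.not_gt, if_false, if_true]
          ring
        · simp only [alph, bet, dRed, e1, e2, h, h.not_gt, if_false, if_true]
          ring
      · simp only [h2, if_false]
        ring

lemma map_rho {B : Type*} [Ring B] [Algebra ℂ B] {C : Type*} [Ring C] [Algebra ℂ C]
    (φ : B →ₐ[ℂ] C) (q p : ℂ) (U V : B) (i j k l : Idx T n) :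
    φ (rho T n q p U V i j k l) = rho T n q p (φ U) (φ V) i j k l := by
  unfold rho
  simp only [map_sum, map_smul, map_mul, map_pow]

/-- The scalar factor of the crossing relation, at two commuting elements. -/
def crossFac (ξ q : ℂ) {B : Type*} [Ring B] [Algebra ℂ B] (U V : B) : B :=
  ξ • ((ξ • U - V) * ((U - q ^ 2 • V) * ((U - q⁻¹ ^ 2 • V) * (U - ξ • V))))

/-- Crossing symmetry of the R-matrix: contracting two R-matrices with `∑_l η_l e_{l'} ⊗ e_l`
gives a scalar, at any central elements `U`, `V` of an algebra. The argument `ξ U` of the first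
R-matrix is the shift produced by transposition. -/
lemma crossing (hn : T.minRank ≤ n) {q p : ℂ} (hq0 : q ≠ 0) (hp : p ^ 2 = q)
    {B : Type*} [Ring B] [Algebra ℂ B] {U V : B} (hU : ∀ x, Commute U x) (hV : ∀ x, Commute V x)
    (a b c e : Idx T n) :
    ∑ l, ∑ m, eta T n p l • (rho T n q p (xi T n q • U) V l.rev c a m *
        rho T n q p U V l m b e) =
      if a = b.rev ∧ c = e then eta T n p b • crossFac (xi T n q) q U V else 0 := by
  -- an identity of polynomials in `U` and `V`, which may be checked at complex numbers
  have key : ∑ l, ∑ m, eta T n p l • (rho T n q p (xi T n q • (MvPolynomial.X 0 :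
        MvPolynomial (Fin 2) ℂ)) (MvPolynomial.X 1) l.rev c a m *
        rho T n q p (MvPolynomial.X 0 : MvPolynomial (Fin 2) ℂ) (MvPolynomial.X 1) l m b e) =
      if a = b.rev ∧ c = e then eta T n p b • crossFac (xi T n q) q
        (MvPolynomial.X 0 : MvPolynomial (Fin 2) ℂ) (MvPolynomial.X 1) else 0 := by
    refine MvPolynomial.funext fun x => ?_
    have h := crossing_complex hn hq0 hp (x 0) (x 1) a b c e
    rw [← MvPolynomial.coe_aeval_eq_eval]
    simp only [RingHom.coe_coe, map_sum, map_smul, map_mul, map_rho, MvPolynomial.aeval_X,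
      apply_ite (MvPolynomial.aeval x), smul_eq_mul, map_zero, crossFac, map_sub]
    rw [h, crossF]
    split_ifs
    · ring
    · rfl
  -- `U` and `V` are evaluated in the centre, which is commutative
  let x : Fin 2 → Subalgebra.center ℂ B := ![⟨U, Subalgebra.mem_center_iff.mpr fun y => (hU y).symm⟩,
    ⟨V, Subalgebra.mem_center_iff.mpr fun y => (hV y).symm⟩]
  have h2 := congrArg (fun y => (Subalgebra.center ℂ B).val (MvPolynomial.aeval x y)) key
  simp only [map_sum, map_smul, map_mul, map_rho, MvPolynomial.aeval_X,
      apply_ite (MvPolynomial.aeval x), map_zero, crossFac, map_sub,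
      apply_ite (Subalgebra.center ℂ B).val] at h2
  exact h2

end Crossing

/-! ### Centrality from the crossing relation -/

section Central

variable {T : ClassicalType} {n : ℕ} {q p : ℂ}

lemma eta_ne_zero (hp0 : p ≠ 0) (l : Idx T n) : eta T n p l ≠ 0 := by
  unfold eta
  have h := eps_mul_self l
  exact mul_ne_zero (zpow_ne_zero _ hp0) (left_ne_zero_of_mul_eq_one h)

/-- If the contraction of `P̂` and `P` with `∑ η_l e_{l'} ⊗ e_l` is the scalar `z`, then `z`
commutes with `P'`: moving `P'` through the contraction produces on both sides the same scalar
factor, by crossing symmetry. -/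
lemma commute_of_crossing (hn : T.minRank ≤ n) (hq0 : q ≠ 0) (hp : p ^ 2 = q)
    {B : Type*} [Ring B] [Algebra ℂ B] {U V : B} (hU : ∀ x, Commute U x) (hV : ∀ x, Commute V x)
    (hF : ∀ f : B, crossFac (xi T n q) q U V * f = 0 → f = 0)
    {Ph P P' : Matrix (Idx T n) (Idx T n) B} {z : B}
    (h1 : RLL T n q p (xi T n q • U) V Ph P') (h2 : RLL T n q p U V P P')
    (hz : ∀ a b, ∑ l, eta T n p l • (Ph l.rev a * P l b) =
      if a = b.rev then eta T n p b • z else 0) (c d : Idx T n) : Commute z (P' c d) := by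
  have hp0 : p ≠ 0 := by rintro rfl; exact hq0 (by rw [← hp]; simp)
  rw [RLL_iff] at h1 h2
  have hξU : ∀ x, Commute (xi T n q • U) x := fun x => (hU x).smul_left _
  have hR1 : ∀ i j k l x, Commute (rho T n q p (xi T n q • U) V i j k l) x := fun i j k l x =>
    rho_commute (hξU x) (hV x) i j k l
  have hR : ∀ i j k l x, Commute (rho T n q p U V i j k l) x := fun i j k l x =>
    rho_commute (hU x) (hV x) i j k l
  have hcr := crossing hn hq0 hp hU hV
  set r1 := rho T n q p (xi T n q • U) V
  set r := rho T n q p U V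
  set ξ := xi T n q
  set F := crossFac ξ q U V
  have hFc : ∀ x, Commute F x := fun x => by
    have hl : ∀ r : ℂ, Commute (U - r • V) x := fun r => (hU x).sub_left ((hV x).smul_left r)
    exact (((hξU x).sub_left (hV x)).mul_left ((hl _).mul_left
      ((hl _).mul_left (hl _)))).smul_left _
  -- The contraction to be evaluated in two ways, for the column indices `b'`, `b`, `d`.
  have key : ∀ b : Idx T n,
      (∑ l, ∑ k, ∑ m, ∑ g, ∑ e, eta T n p l • (r1 l.rev c k m * r l m g e *
        (Ph k b.rev * (P g b * P' e d)))) = eta T n p b • (F * (z * P' c d)) ∧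
      (∑ l, ∑ k, ∑ m, ∑ g, ∑ e, eta T n p l • (r1 l.rev c k m * r l m g e *
        (Ph k b.rev * (P g b * P' e d)))) = eta T n p b • (F * (P' c d * z)) := by
    intro b
    constructor
    -- crossing symmetry applied at once
    · calc _ = ∑ k, ∑ g, ∑ e, (∑ l, ∑ m, eta T n p l • (r1 l.rev c k m * r l m g e)) *
            (Ph k b.rev * (P g b * P' e d)) := by
            rw [Finset.sum_comm]
            refine Finset.sum_congr rfl fun k _ => ?_
            simp only [Finset.sum_mul, smul_mul_assoc]
            rw [← Finset.sum_product' Finset.univ Finset.univ (fun l m => ∑ g, ∑ e, _)]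
            rw [Finset.sum_comm]
            refine Finset.sum_congr rfl fun g _ => ?_
            rw [Finset.sum_comm]
            refine Finset.sum_congr rfl fun e _ => ?_
            rw [Finset.sum_product]
        _ = ∑ k, ∑ g, if k = g.rev then (eta T n p g • F) * (Ph k b.rev * (P g b * P' c d))
              else 0 := by
            refine Finset.sum_congr rfl fun k _ => Finset.sum_congr rfl fun g _ => ?_
            simp only [hcr, ite_and, ite_mul, zero_mul]
            split_ifs <;> simp
        _ = F * ((∑ g, eta T n p g • (Ph g.rev b.rev * P g b)) * P' c d) := by
            rw [Finset.sum_comm]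
            simp only [Finset.sum_ite_eq', Finset.mem_univ, if_true, Finset.sum_mul,
              Finset.mul_sum, smul_mul_assoc, mul_smul_comm, mul_assoc]
        _ = _ := by
            rw [hz, if_pos rfl, smul_mul_assoc, mul_smul_comm]
    -- crossing symmetry applied after `P'` is moved to the left past `P` and `P̂`
    · calc _ = ∑ l, ∑ k, ∑ m, eta T n p l • (r1 l.rev c k m * (Ph k b.rev *
              ∑ g, ∑ e, r l m g e * (P g b * P' e d))) := by
            simp only [Finset.mul_sum, Finset.smul_sum]
            refine Finset.sum_congr rfl fun l _ => Finset.sum_congr rfl fun k _ =>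
              Finset.sum_congr rfl fun m _ => Finset.sum_congr rfl fun g _ =>
              Finset.sum_congr rfl fun e _ => ?_
            rw [(hR l m g e (Ph k b.rev)).symm.left_comm, mul_assoc]
        _ = ∑ l, ∑ k, ∑ m, ∑ g, ∑ e, eta T n p l • (r1 l.rev c k m * (Ph k b.rev * P' m e) *
              (P l g * r g e b d)) := by
            simp only [h2, Finset.mul_sum, Finset.smul_sum, mul_assoc]
        _ = ∑ l, ∑ g, ∑ e, eta T n p l • ((∑ k, ∑ m, r1 l.rev c k m * (Ph k b.rev * P' m e)) *
              (P l g * r g e b d)) := by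
            refine Finset.sum_congr rfl fun l _ => ?_
            simp only [Finset.sum_mul, Finset.smul_sum]
            rw [← Finset.sum_product' Finset.univ Finset.univ (fun k m => ∑ g, ∑ e, _)]
            rw [Finset.sum_comm]
            refine Finset.sum_congr rfl fun g _ => ?_
            rw [Finset.sum_comm]
            refine Finset.sum_congr rfl fun e _ => ?_
            rw [Finset.sum_product]
        _ = ∑ l, ∑ g, ∑ e, ∑ k, ∑ m, eta T n p l • (P' c m * (Ph l.rev k * P l g) *
              (r1 k m b.rev e * r g e b d)) := by
            simp only [h1, Finset.sum_mul, Finset.smul_sum]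
            refine Finset.sum_congr rfl fun l _ => Finset.sum_congr rfl fun k _ =>
              Finset.sum_congr rfl fun m _ => Finset.sum_congr rfl fun g _ =>
              Finset.sum_congr rfl fun e _ => ?_
            congr 1
            simp only [mul_assoc]
            rw [(hR1 _ _ _ _ (P l k)).left_comm]
        _ = ∑ g, ∑ e, ∑ k, ∑ m, P' c m * (∑ l, eta T n p l • (Ph l.rev k * P l g)) *
              (r1 k m b.rev e * r g e b d) := by
            rw [Finset.sum_comm]
            refine Finset.sum_congr rfl fun g _ => ?_
            rw [Finset.sum_comm]
            refine Finset.sum_congr rfl fun e _ => ?_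
            rw [Finset.sum_comm]
            refine Finset.sum_congr rfl fun k _ => ?_
            rw [Finset.sum_comm]
            refine Finset.sum_congr rfl fun m _ => ?_
            simp only [Finset.mul_sum, Finset.sum_mul, smul_mul_assoc, mul_smul_comm]
        _ = ∑ g, ∑ e, ∑ m, P' c m * z *
              (eta T n p g • (r1 g.rev m b.rev e * r g e b d)) := by
            refine Finset.sum_congr rfl fun g _ => Finset.sum_congr rfl fun e _ => ?_
            rw [Finset.sum_comm]
            refine Finset.sum_congr rfl fun m _ => ?_
            simp only [hz, mul_ite, ite_mul, mul_zero, zero_mul, Finset.sum_ite_eq',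
              Finset.mem_univ, if_true, smul_mul_assoc, mul_smul_comm]
        _ = ∑ m, P' c m * z * (∑ g, ∑ e, eta T n p g • (r1 g.rev m b.rev e * r g e b d)) := by
            simp only [Finset.mul_sum]
            rw [← Finset.sum_product' Finset.univ Finset.univ (fun g e => ∑ m, _)]
            rw [Finset.sum_comm]
            refine Finset.sum_congr rfl fun m _ => ?_
            rw [Finset.sum_product]
        _ = _ := by
            simp only [hcr, true_and, mul_ite, mul_zero, Finset.sum_ite_eq',
              Finset.mem_univ, if_true, mul_smul_comm]
            rw [(hFc _).eq]
  have hb := (key c).1.symm.trans (key c).2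
  rw [← sub_eq_zero, ← smul_sub, ← mul_sub, smul_eq_zero_iff_right (eta_ne_zero hp0 c)] at hb
  exact sub_eq_zero.mp (hF _ hb)

end Central

/-! ### The R-matrix relation at `u = ξ v` -/

section Specialise

variable {T : ClassicalType} {n : ℕ} {q p : ℂ} {A : Type*} [Ring A] [Algebra ℂ A]

lemma xi_ne_one (hn : T.minRank ≤ n) (hq : ∀ m : ℕ, 0 < m → q ^ m ≠ 1) :
    xi T n q ≠ 1 := by
  have hz : ∀ m : ℤ, m < 0 → q ^ m ≠ 1 := by
    intro m hm h
    obtain ⟨k, rfl⟩ : ∃ k : ℕ, m = -(k : ℤ) := ⟨m.natAbs, by omega⟩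
    refine hq k (by omega) ?_
    rw [zpow_neg, inv_eq_one, zpow_natCast] at h
    exact h
  cases T <;> simp only [ClassicalType.minRank, xi, dimN] at * <;> apply hz <;> push_cast <;> omega

lemma q_sub_inv_ne_zero (hq0 : q ≠ 0) (hq : ∀ m : ℕ, 0 < m → q ^ m ≠ 1) : q - q⁻¹ ≠ 0 := by
  intro h
  refine hq 2 two_pos ?_
  have : q * q⁻¹ = 1 := mul_inv_cancel₀ hq0
  linear_combination q * h + this

lemma diag_rho_mul (s : Sgn) {c : ℂ} (hc : c ≠ 0) (i j k l : Idx T n) (f : Biv A) :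
    diag (c ^ s.toInt) (rho T n q p (parU s s) (parV s s) i j k l * f) =
      (diagFactor s c ^ 2 * rho T n q p (1 : ℂ) c i j k l) •
        (PowerSeries.X * (PowerSeries.X * diag (c ^ s.toInt) f)) := by
  have e1 : (parU s s - xi T n q • parV s s : Biv A) =
      (1 : ℂ) • parU s s + (-xi T n q) • parV s s := by module
  have e2 : (parU s s - parV s s : Biv A) = (1 : ℂ) • parU s s + (-1 : ℂ) • parV s s := by module
  rw [rho_eq (parU_commute s s _), rho_eq (Commute.all _ _), sub_mul, map_sub, e1, mul_assoc,
    diag_linear_mul s hc, diag_linear_mul s hc, e2]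
  simp only [smul_eq_mul]
  split_ifs
  · rw [mul_assoc, diag_linear_mul s hc, diag_linear_mul s hc]
    simp only [mul_smul_comm, smul_smul, ← sub_smul]
    congr 1
    ring
  · simp only [mul_smul_comm, smul_smul, zero_mul, map_zero, sub_zero]
    congr 1
    ring

/-- The R-matrix relation between `x(u)` and `y(cu)`. -/
lemma RLL_diag (s : Sgn) {c : ℂ} (hc : c ≠ 0) {x y : Matrix (Idx T n) (Idx T n) (PowerSeries A)}
    (h : RLL T n q p (parU s s) (parV s s) (x.map inU) (y.map inV)) (i j a b : Idx T n) :
    ∑ k, ∑ l, rho T n q p (1 : ℂ) c i j k l • (x k a * dil (c ^ s.toInt) (y l b)) =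
      ∑ k, ∑ l, rho T n q p (1 : ℂ) c k l a b • (dil (c ^ s.toInt) (y j l) * x i k) := by
  have h0 := congrArg (diag (c ^ s.toInt)) (RLL_iff.mp h i j a b)
  have hcomm : ∀ (k l : Idx T n) (f : Biv A),
      f * rho T n q p (parU s s) (parV s s) k l a b =
        rho T n q p (parU s s) (parV s s) k l a b * f := fun k l f =>
    (rho_commute (parU_commute s s f) (parV_commute s s f) k l a b).eq.symm
  simp only [hcomm, map_sum, diag_rho_mul s hc, Matrix.map_apply, diag_inU_mul_inV,
    diag_inV_mul_inU] at h0
  have e : ∀ (r : ℂ) (f : PowerSeries A), (diagFactor s c ^ 2 * r) •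
      (PowerSeries.X * (PowerSeries.X * f)) =
      diagFactor s c ^ 2 • (PowerSeries.X * ((1 : ℂ) • (PowerSeries.X * (r • f)))) := fun r f => by
    simp only [mul_smul_comm, smul_smul, one_mul]
  simp only [e, ← Finset.smul_sum, ← Finset.mul_sum] at h0
  rw [← sub_eq_zero, ← smul_sub, ← mul_sub, ← smul_sub, ← mul_sub] at h0
  exact sub_eq_zero.mp (eq_zero_of_smul_X_mul one_ne_zero
    (eq_zero_of_smul_X_mul (pow_ne_zero 2 (diagFactor_ne_zero s hc)) h0))

/-- At `u = ξ v` the R-matrix has rank one. -/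
lemma rho_residue (hq0 : q ≠ 0) (hp0 : p ≠ 0) (i j k l : Idx T n) :
    rho T n q p (1 : ℂ) (xi T n q)⁻¹ i j k l =
      if i = j.rev ∧ k = l.rev then
        (((xi T n q)⁻¹ - 1) * (q - q⁻¹) * kap T) * (eta T n p j.rev * eta T n p l) else 0 := by
  have hξ := xi_ne_zero (T := T) (n := n) hq0
  have hd : dRed T n q 1 (xi T n q)⁻¹ j l = q - q⁻¹ := by
    unfold dRed dDiag
    rcases lt_trichotomy j l with h | h | h
    · simp [h, h.not_gt, h.ne, hξ]
    · subst h
      split_ifs <;> simp_all <;> field_simp <;> ring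
    · simp [h, h.not_gt, h.ne']
  rw [rho_complex _ _ _ _ hp0, hd, mul_inv_cancel₀ hξ, eta_rev]
  have hk := kap_mul_self T
  by_cases h : i = j.rev ∧ k = l.rev
  · simp only [if_pos h]
    linear_combination ((1 - (xi T n q)⁻¹) * (q - q⁻¹) * (p ^ bar2 T n j * eps T n j) *
      eta T n p l) * hk
  · simp only [if_neg h]
    ring

/-- The relation between `L(u)` and its transpose at `uξ` which defines the series `z(u)`:
`∑_l η_l l_{l'a}(uξ) l_{lb}(u) = δ_{ab'} η_b z(u)` and
`∑_l η_{l'} l_{jl}(u) l_{il'}(uξ) = δ_{ij'} η_{j'} z(u)`. -/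
structure IsContraction (T : ClassicalType) (n : ℕ) (q p : ℂ) (s : Sgn)
    (L : Matrix (Idx T n) (Idx T n) (PowerSeries A)) (z : PowerSeries A) : Prop where
  cols : ∀ a b, ∑ l, eta T n p l • (dil (xi T n q ^ s.toInt) (L l.rev a) * L l b) =
    if a = b.rev then eta T n p b • z else 0
  rows : ∀ i j, ∑ l, eta T n p l.rev • (L j l * dil (xi T n q ^ s.toInt) (L i l.rev)) =
    if i = j.rev then eta T n p j.rev • z else 0

/-- The R-matrix relation at `u = ξ v` defines a series `z(u)`: since the residue has rank one, both
sides of the relation are multiples of a fixed vector, hence equal to a common scalar. -/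
lemma exists_contraction (hn : T.minRank ≤ n) (hq0 : q ≠ 0) (hq : ∀ m : ℕ, 0 < m → q ^ m ≠ 1)
    (hp0 : p ≠ 0) (s : Sgn) {L : Matrix (Idx T n) (Idx T n) (PowerSeries A)}
    (h : RLL T n q p (parU s s) (parV s s) (L.map inU) (L.map inV)) :
    ∃ z : PowerSeries A, IsContraction T n q p s L z := by
  have hξ := xi_ne_zero (T := T) (n := n) hq0
  have hdd : ∀ f : PowerSeries A, dil (xi T n q ^ s.toInt) (dil ((xi T n q)⁻¹ ^ s.toInt) f) = f :=
    fun f => by rw [dil_dil, ← mul_zpow, mul_inv_cancel₀ hξ, one_zpow, dil_one]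
  have hK : ((xi T n q)⁻¹ - 1) * (q - q⁻¹) * kap T ≠ 0 := by
    refine mul_ne_zero (mul_ne_zero ?_ (q_sub_inv_ne_zero hq0 hq))
      (left_ne_zero_of_mul_eq_one (kap_mul_self T))
    rw [sub_ne_zero, ne_eq, inv_eq_one]
    exact xi_ne_one hn hq
  set G : Idx T n → Idx T n → PowerSeries A := fun a b =>
    ∑ l, eta T n p l • (dil (xi T n q ^ s.toInt) (L l.rev a) * L l b) with hG
  set H : Idx T n → Idx T n → PowerSeries A := fun i j =>
    ∑ l, eta T n p l.rev • (L j l * dil (xi T n q ^ s.toInt) (L i l.rev)) with hH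
  have key : ∀ i j a b, (if i = j.rev then eta T n p j.rev • G a b else 0) =
      if a = b.rev then eta T n p b • H i j else 0 := by
    intro i j a b
    have h0 := congrArg (dil (xi T n q ^ s.toInt)) (RLL_diag s (inv_ne_zero hξ) h i j a b)
    simp only [map_sum, dil_smul, map_mul, hdd] at h0
    simp only [rho_residue hq0 hp0, ite_and, ite_smul, zero_smul] at h0
    have l1 : ∀ l : Idx T n, (∑ k, if i = j.rev then if k = l.rev then
        ((((xi T n q)⁻¹ - 1) * (q - q⁻¹) * kap T) * (eta T n p j.rev * eta T n p l)) •
        (dil (xi T n q ^ s.toInt) (L k a) * L l b) else 0 else 0) =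
        if i = j.rev then (((xi T n q)⁻¹ - 1) * (q - q⁻¹) * kap T) • eta T n p j.rev •
          eta T n p l • (dil (xi T n q ^ s.toInt) (L l.rev a) * L l b) else 0 := by
      intro l
      split_ifs
      · simp [smul_smul, mul_assoc]
      · simp
    have l2 : ∀ l : Idx T n, (∑ k, if k = l.rev then if a = b.rev then
        ((((xi T n q)⁻¹ - 1) * (q - q⁻¹) * kap T) * (eta T n p l.rev * eta T n p b)) •
        (L j l * dil (xi T n q ^ s.toInt) (L i k)) else 0 else 0) =
        if a = b.rev then (((xi T n q)⁻¹ - 1) * (q - q⁻¹) * kap T) • eta T n p b •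
          eta T n p l.rev • (L j l * dil (xi T n q ^ s.toInt) (L i l.rev)) else 0 := by
      intro l
      rw [Finset.sum_ite_eq' Finset.univ, if_pos (Finset.mem_univ _)]
      split_ifs
      · rw [mul_comm (eta T n p l.rev)]
        simp only [smul_smul, mul_assoc]
      · rfl
    rw [Finset.sum_comm] at h0
    simp only [l1] at h0
    rw [Finset.sum_comm] at h0
    simp only [l2] at h0
    have p1 : ∀ (P : Prop) [Decidable P] (r r' : ℂ) (f : Idx T n → PowerSeries A),
        (∑ l, if P then r • r' • f l else 0) = r • (if P then r' • ∑ l, f l else 0) := by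
      intro P _ r r' f
      split_ifs
      · simp only [Finset.smul_sum]
      · simp
    rw [p1, p1, ← sub_eq_zero, ← smul_sub, smul_eq_zero_iff_right hK, sub_eq_zero] at h0
    exact h0
  have hpos : 0 < dimN T n := by
    have := rank_pos hn
    cases T <;> simp [dimN] <;> omega
  let o : Idx T n := ⟨0, hpos⟩
  have hη := fun l : Idx T n => eta_ne_zero (T := T) (n := n) hp0 l
  refine ⟨(eta T n p o.rev)⁻¹ • H o.rev o, ⟨fun a b => ?_, fun i j => ?_⟩⟩
  · have h1 := key o.rev o a b
    rw [if_pos rfl] at h1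
    have h2 := congrArg ((eta T n p o.rev)⁻¹ • ·) h1
    simp only [smul_smul, inv_mul_cancel₀ (hη _), one_smul] at h2
    change G a b = _
    rw [h2]
    split_ifs
    · rw [smul_smul, smul_smul, mul_comm]
    · simp
  · have h1 := key i j o.rev o
    have h2 := key o.rev o o.rev o
    simp only [if_true] at h1 h2
    change H i j = _
    have h3 := congrArg ((eta T n p o)⁻¹ • ·) h1
    simp only [smul_smul, inv_mul_cancel₀ (hη _), one_smul] at h3
    have h4 : G o.rev o = (eta T n p o.rev)⁻¹ • eta T n p o • H o.rev o := by
      rw [← h2, smul_smul, inv_mul_cancel₀ (hη _), one_smul]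
    rw [← h3, h4]
    split_ifs
    · simp only [smul_smul]
      congr 1
      field_simp [hη o]
    · simp

end Specialise

/-! ### Symmetries of the R-matrix relation -/

section Transport

variable {T : ClassicalType} {n : ℕ} {q p : ℂ}

/-- The R-matrix is homogeneous. -/
lemma RLL_homogeneous {B : Type*} [Ring B] [Algebra ℂ B] {U V : B}
    {P P' : Matrix (Idx T n) (Idx T n) B} {r : ℂ} (hr : r ≠ 0) :
    RLL T n q p (r • U) (r • V) P P' ↔ RLL T n q p U V P P' := by
  have h : ∀ i j k l, rho T n q p (r • U) (r • V) i j k l = r ^ 2 • rho T n q p U V i j k l := by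
    intro i j k l
    unfold rho
    rw [Finset.smul_sum]
    refine Finset.sum_congr rfl fun t ht => ?_
    have ht' := Finset.mem_range.mp ht
    rw [smul_pow, smul_pow, smul_mul_smul_comm, ← pow_add, show t + (2 - t) = 2 by omega, smul_comm]
  rw [RLL_iff, RLL_iff]
  simp only [h, smul_mul_assoc, mul_smul_comm, ← Finset.smul_sum]
  refine forall_congr' fun i => forall_congr' fun j => forall_congr' fun a => forall_congr' fun b => ?_
  exact (smul_right_injective B (pow_ne_zero 2 hr)).eq_iff

lemma RLL.map {B B' : Type*} [Ring B] [Algebra ℂ B] [Ring B'] [Algebra ℂ B'] {U V : B}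
    {P P' : Matrix (Idx T n) (Idx T n) B} (h : RLL T n q p U V P P') (φ : B →+* B')
    (hφ : ∀ (r : ℂ) x, φ (r • x) = r • φ x) :
    RLL T n q p (φ U) (φ V) (P.map φ) (P'.map φ) := by
  rw [RLL_iff] at h ⊢
  have hr : ∀ i j k l, φ (rho T n q p U V i j k l) = rho T n q p (φ U) (φ V) i j k l := by
    intro i j k l
    simp only [rho, map_sum, hφ, map_mul, map_pow]
  intro i j a b
  have := congrArg φ (h i j a b)
  simpa only [map_sum, map_mul, hr, Matrix.map_apply] using this

lemma rho_rev {B : Type*} [Ring B] [Algebra ℂ B] {U V : B} (hUV : Commute U V) (i j k l : Idx T n) :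
    rho T n q p U V j.rev i.rev l.rev k.rev = rho T n q p U V i j k l := by
  rw [rho_eq hUV, rho_eq hUV]
  have e1 : aU q j.rev i.rev l.rev k.rev = aU q i j k l := by
    unfold aU
    simp only [Fin.rev_inj, Fin.rev_lt_rev]
    congr 1
    · simp only [and_comm, eq_comm]
    · simp only [and_comm]
  have e2 : aV q j.rev i.rev l.rev k.rev = aV q i j k l := by
    unfold aV
    simp only [Fin.rev_inj, Fin.rev_lt_rev]
    congr 1
    · simp only [and_comm, eq_comm]
    · simp only [and_comm]
  rw [e1, e2, Fin.rev_rev, Fin.rev_rev]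
  congr 1
  have e3 : (j.rev = i ∧ l.rev = k) ↔ (i = j.rev ∧ k = l.rev) := by
    simp only [eq_comm]
  by_cases h : i = j.rev ∧ k = l.rev
  · rw [if_pos h, if_pos (e3.mpr h), h.1, h.2, Fin.rev_rev, Fin.rev_rev]
  · rw [if_neg h, if_neg (fun h' => h (e3.mp h'))]

lemma op_sum {B ι : Type*} [AddCommMonoid B] (t : Finset ι) (f : ι → B) :
    MulOpposite.op (∑ i ∈ t, f i) = ∑ i ∈ t, MulOpposite.op (f i) :=
  map_sum (MulOpposite.opAddEquiv (α := B)) f t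

lemma rho_op {B : Type*} [Ring B] [Algebra ℂ B] {U V : B} (hU : ∀ x, Commute U x)
    (i j k l : Idx T n) : rho T n q p (MulOpposite.op U) (MulOpposite.op V) i j k l =
      MulOpposite.op (rho T n q p U V i j k l) := by
  unfold rho
  rw [op_sum]
  refine Finset.sum_congr rfl fun t _ => ?_
  rw [MulOpposite.op_smul, ← MulOpposite.op_pow, ← MulOpposite.op_pow, ← MulOpposite.op_mul,
    ((hU _).pow_left _).eq]

/-- The symmetry `R_{12} ↦ R_{21}` in the opposite ring: it exchanges the two matrices of the
relation and reverses the indices. -/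
lemma RLL.op {B : Type*} [Ring B] [Algebra ℂ B] {U V : B} (hU : ∀ x, Commute U x)
    (hV : ∀ x, Commute V x) {P P' : Matrix (Idx T n) (Idx T n) B} (h : RLL T n q p U V P P') :
    RLL T n q p (MulOpposite.op U) (MulOpposite.op V)
      (Matrix.of fun i j => MulOpposite.op (P' i.rev j.rev))
      (Matrix.of fun i j => MulOpposite.op (P i.rev j.rev)) := by
  rw [RLL_iff] at h ⊢
  have hc : ∀ i j k l x, rho T n q p U V i j k l * x = x * rho T n q p U V i j k l :=
    fun i j k l x => (rho_commute (hU x) (hV x) i j k l).eq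
  intro i j a b
  have := congrArg MulOpposite.op (h j.rev i.rev b.rev a.rev)
  have e : ∀ f : Idx T n → Idx T n → B, ∑ k, ∑ l, f k l = ∑ k : Idx T n, ∑ l : Idx T n, f l.rev k.rev := fun f => by
    rw [Finset.sum_comm, ← Equiv.sum_comp Fin.revPerm]
    refine Finset.sum_congr rfl fun k _ => ?_
    rw [← Equiv.sum_comp Fin.revPerm]
    rfl
  rw [e, e fun k l => P' _ l * P _ k * _] at this
  simp only [rho_rev (hU V)] at this
  simp only [Matrix.of_apply, rho_op hU, ← MulOpposite.op_mul, ← op_sum]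
  convert this using 4
  · rw [hc]
  · rw [hc]

variable {A : Type*} [Ring A] [Algebra ℂ A]

lemma dil_C (c : ℂ) (x : A) : dil c (PowerSeries.C x) = PowerSeries.C x := by
  ext m
  rcases m with _ | m <;> simp [PowerSeries.coeff_C]

lemma dil_X (c : ℂ) : dil c (PowerSeries.X : PowerSeries A) = c • PowerSeries.X := by
  ext m
  simp only [coeff_dil, PowerSeries.coeff_X, PowerSeries.coeff_smul]
  split_ifs with h
  · simp [h]
  · simp

/-- The substitution `u ↦ c u` in the relation. -/
lemma RLL.dil_left {s s' : Sgn} {c : ℂ} (hc : c ≠ 0)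
    {x y : Matrix (Idx T n) (Idx T n) (PowerSeries A)}
    (h : RLL T n q p (parU s s') (parV s s') (x.map inU) (y.map inV)) :
    RLL T n q p (c • parU s s') (parV s s') (x.map fun f => inU (dil (c ^ s.toInt) f))
      (y.map inV) := by
  let φ : Biv A →+* Biv A := PowerSeries.map (dil (c ^ s.toInt))
  have hφ : ∀ (r : ℂ) (f : Biv A), φ (r • f) = r • φ f := fun r f => by
    ext d : 1
    simp [φ, dil_smul]
  have hU : φ varU = c ^ s.toInt • varU := by
    simp only [φ, varU, PowerSeries.map_C, dil_X]
    ext d : 1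
    rw [PowerSeries.coeff_smul, PowerSeries.coeff_C, PowerSeries.coeff_C]
    split_ifs <;> simp
  have hV : φ varV = varV := by simp [φ, varV]
  have hx : (x.map inU).map φ = x.map fun f => inU (dil (c ^ s.toInt) f) := by
    ext i j : 2
    simp [φ, inU]
  have hy : (y.map inV).map φ = y.map inV := by
    ext i j d : 3
    simp [φ, inV, dil_C]
  have h' := h.map φ hφ
  rw [hx, hy] at h'
  cases s
  · have e : φ (parU .plus s') = c • parU .plus s' ∧ φ (parV .plus s') = parV .plus s' := by
      cases s' <;> simp [parU, parV, hU, hV, Sgn.toInt]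
    rwa [e.1, e.2] at h'
  · have e : φ (parU .minus s') = parU .minus s' ∧
        φ (parV .minus s') = c⁻¹ • parV .minus s' := by
      cases s' <;> simp [parU, parV, hU, hV, Sgn.toInt]
    rw [e.1, e.2, ← RLL_homogeneous hc, smul_smul, mul_inv_cancel₀ hc, one_smul] at h'
    exact h'

/-- The substitution `v ↦ c v` in the relation. -/
lemma RLL.dil_right {s s' : Sgn} {c : ℂ} (hc : c ≠ 0)
    {x y : Matrix (Idx T n) (Idx T n) (PowerSeries A)}
    (h : RLL T n q p (parU s s') (parV s s') (x.map inU) (y.map inV)) :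
    RLL T n q p (c⁻¹ • parU s s') (parV s s') (x.map inU)
      (y.map fun f => inV (dil (c ^ s'.toInt) f)) := by
  let φ : Biv A →+* Biv A := dil (c ^ s'.toInt)
  have hφ : ∀ (r : ℂ) (f : Biv A), φ (r • f) = r • φ f := fun r f => dil_smul (A := PowerSeries A) _ _ _
  have hU : φ varU = varU := dil_C (A := PowerSeries A) _ _
  have hV : φ varV = c ^ s'.toInt • varV := dil_X (A := PowerSeries A) _
  have hx : (x.map inU).map φ = x.map inU := by
    refine Matrix.ext fun i j => ?_
    exact dil_C (A := PowerSeries A) _ _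
  have hy : (y.map inV).map φ = y.map fun f => inV (dil (c ^ s'.toInt) f) := by
    ext i j d : 3
    simp only [φ, inV, Matrix.map_apply, coeff_dil, PowerSeries.coeff_map, PowerSeries.coeff_smul,
      PowerSeries.coeff_C]
    split_ifs <;> simp
  have h' := h.map φ hφ
  rw [hx, hy] at h'
  cases s'
  · have e : φ (parU s .plus) = parU s .plus ∧ φ (parV s .plus) = c • parV s .plus := by
      cases s <;> simp [parU, parV, hU, hV, Sgn.toInt]
    rw [e.1, e.2, ← RLL_homogeneous (inv_ne_zero hc), smul_smul, inv_mul_cancel₀ hc, one_smul] at h'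
    exact h'
  · have e : φ (parU s .minus) = c⁻¹ • parU s .minus ∧
        φ (parV s .minus) = parV s .minus := by
      cases s <;> simp [parU, parV, hU, hV, Sgn.toInt]
    rwa [e.1, e.2] at h'

end Transport

/-! ### Commutation of the central series with the generators -/

section Contraction

variable {T : ClassicalType} {n : ℕ} {q p : ℂ} {A : Type*} [Ring A] [Algebra ℂ A]

/-- The factor of the crossing relation is not a zero divisor if the linear forms in `U`, `V`
are not. -/
lemma eq_zero_of_crossFac_mul {B : Type*} [Ring B] [Algebra ℂ B] {U V : B}
    (hUV : ∀ (α β : ℂ) (f : B), α ≠ 0 → β ≠ 0 → (α • U - β • V) * f = 0 → f = 0) (hq0 : q ≠ 0)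
    {r : ℂ} (hr : r ≠ 0) {f : B} (h : crossFac (xi T n q) q (r • U) V * f = 0) : f = 0 := by
  have hξ := xi_ne_zero (T := T) (n := n) hq0
  unfold crossFac at h
  rw [smul_mul_assoc, smul_eq_zero_iff_right hξ, mul_assoc, mul_assoc, mul_assoc] at h
  have e : xi T n q • r • U - V = (xi T n q * r) • U - (1 : ℂ) • V := by module
  rw [e] at h
  have h1 := hUV _ _ _ (mul_ne_zero hξ hr) one_ne_zero h
  have h2 := hUV _ _ _ hr (pow_ne_zero 2 hq0) h1
  have h3 := hUV _ _ _ hr (pow_ne_zero 2 (inv_ne_zero hq0)) h2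
  exact hUV _ _ _ hr hξ h3

omit [Algebra ℂ A] in
lemma commute_coeff {f g : PowerSeries A} (h : Commute (inU f) (inV g : Biv A)) (a b : ℕ) :
    Commute (PowerSeries.coeff a f) (PowerSeries.coeff b g) := by
  have := congrArg (coeff₂ a b) h.eq
  rwa [coeff₂_inU_mul_inV, coeff₂_inV_mul_inU] at this

lemma IsContraction.map_inU {s : Sgn} {L : Matrix (Idx T n) (Idx T n) (PowerSeries A)}
    {z : PowerSeries A} (hz : IsContraction T n q p s L z) (a b : Idx T n) :
    ∑ l, eta T n p l • ((L.map fun f => (inU (dil (xi T n q ^ s.toInt) f) : Biv A)) l.rev a *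
      (L.map inU) l b) = if a = b.rev then eta T n p b • (inU z : Biv A) else 0 := by
  have hs : ∀ (r : ℂ) (f : PowerSeries A), (inU (r • f) : Biv A) = r • inU f := fun r f => by
    ext d : 1
    simp only [inU, PowerSeries.coeff_C, PowerSeries.coeff_smul]
    split_ifs <;> simp
  have h := congrArg (inU : PowerSeries A →+* Biv A) (hz.cols a b)
  simpa only [map_sum, hs, map_mul, apply_ite (inU : PowerSeries A →+* Biv A), map_zero,
    Matrix.map_apply] using h

/-- The coefficients of `z(u)` commute with the matrices in the second place of the relation. -/
lemma IsContraction.commute_right (hn : T.minRank ≤ n) (hq0 : q ≠ 0) (hp : p ^ 2 = q) {s s' : Sgn}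
    {L L' : Matrix (Idx T n) (Idx T n) (PowerSeries A)} {z : PowerSeries A}
    (hz : IsContraction T n q p s L z)
    (h : RLL T n q p (parU s s') (parV s s') (L.map inU) (L'.map inV)) (i j : Idx T n) (a b : ℕ) :
    Commute (PowerSeries.coeff a z) (PowerSeries.coeff b (L' i j)) := by
  have hξ := xi_ne_zero (T := T) (n := n) hq0
  refine commute_coeff ?_ a b
  refine commute_of_crossing hn hq0 hp (parU_commute s s') (parV_commute s s')
    (fun f hf => eq_zero_of_crossFac_mul (fun α β f hα hβ => eq_zero_of_linear_mul s s' hα hβ)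
      hq0 one_ne_zero (by rwa [one_smul]))
    (h.dil_left hξ) h hz.map_inU i j

/-- The coefficients of `z(v)` commute with the matrices in the first place of the relation. -/
lemma IsContraction.commute_left (hn : T.minRank ≤ n) (hq0 : q ≠ 0) (hp : p ^ 2 = q) {s s' : Sgn}
    {L L' : Matrix (Idx T n) (Idx T n) (PowerSeries A)} {z : PowerSeries A}
    (hz : IsContraction T n q p s' L' z)
    (h : RLL T n q p (parU s s') (parV s s') (L.map inU) (L'.map inV)) (i j : Idx T n) (a b : ℕ) :
    Commute (PowerSeries.coeff a (L i j)) (PowerSeries.coeff b z) := by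
  have hξ := xi_ne_zero (T := T) (n := n) hq0
  refine commute_coeff ?_ a b
  have hU : ∀ x : (Biv A)ᵐᵒᵖ, Commute (MulOpposite.op (parU s s')) x := fun x =>
    (parU_commute s s' x.unop).op
  have hV : ∀ x : (Biv A)ᵐᵒᵖ, Commute (MulOpposite.op (parV s s')) x := fun x =>
    (parV_commute s s' x.unop).op
  have h1 := h.op (parU_commute s s') (parV_commute s s')
  have h2 := (h.dil_right hξ).op (fun x => (parU_commute s s' x).smul_left _)
    (parV_commute s s')
  rw [MulOpposite.op_smul] at h2
  rw [show MulOpposite.op (parU s s' : Biv A) = xi T n q • (xi T n q)⁻¹ •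
    MulOpposite.op (parU s s' : Biv A) by rw [smul_smul, mul_inv_cancel₀ hξ, one_smul]] at h1
  have hs : ∀ (r : ℂ) (f : PowerSeries A), (inV (r • f) : Biv A) = r • inV f := fun r f => by
    ext d e
    simp only [inV, PowerSeries.coeff_map, PowerSeries.coeff_C, PowerSeries.coeff_smul]
    split_ifs <;> simp
  have hc : ∀ a b, ∑ l, eta T n p l • ((Matrix.of fun i j : Idx T n =>
      MulOpposite.op ((L'.map (inV : PowerSeries A →+* Biv A)) i.rev j.rev)) l.rev a *
      (Matrix.of fun i j : Idx T n => MulOpposite.op ((L'.map fun f =>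
        (inV (dil (xi T n q ^ s'.toInt) f) : Biv A)) i.rev j.rev)) l b) =
      if a = b.rev then eta T n p b • MulOpposite.op (inV z : Biv A) else 0 := by
    intro a b
    have h0 := congrArg (fun f : PowerSeries A => MulOpposite.op (inV f : Biv A))
      (hz.cols b.rev a.rev)
    simp only [map_sum, hs, map_mul, op_sum, MulOpposite.op_smul, MulOpposite.op_mul] at h0
    simp only [Matrix.of_apply, Matrix.map_apply, Fin.rev_rev]
    rw [h0]
    by_cases hab : a = b.rev
    · simp [hab, hs]
    · have hab' : ¬ b.rev = a := fun h => hab h.symm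
      simp [hab, hab']
  have hF : ∀ f : (Biv A)ᵐᵒᵖ, crossFac (xi T n q) q ((xi T n q)⁻¹ • MulOpposite.op (parU s s'))
      (MulOpposite.op (parV s s')) * f = 0 → f = 0 := by
    intro f
    refine eq_zero_of_crossFac_mul (fun α β f hα hβ hf => ?_) hq0 (inv_ne_zero hξ)
    have hl : Commute (α • parU s s' - β • parV s s' : Biv A) f.unop :=
      ((parU_commute s s' _).smul_left α).sub_left ((parV_commute s s' _).smul_left β)
    have h0 := congrArg MulOpposite.unop hf
    rw [MulOpposite.unop_mul, MulOpposite.unop_sub, MulOpposite.unop_smul, MulOpposite.unop_smul,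
      MulOpposite.unop_op, MulOpposite.unop_op, ← hl.eq, MulOpposite.unop_zero] at h0
    exact (MulOpposite.unop_eq_zero_iff f).mp (eq_zero_of_linear_mul s s' hα hβ h0)
  have := commute_of_crossing hn hq0 hp (fun x => (hU x).smul_left _) hV hF h1 h2 hc i.rev j.rev
  have := this.unop
  simpa using this.symm

end Contraction

/-! ### Type A relations between the entries of a block -/

section TypeA

variable {R : Type*} [Ring R] [Algebra ℂ R] {q c : ℂ} {m : ℕ} {x y B : ℕ → ℕ → R}

/-- The relation `R(u, v) x_1 y_2 = y_2 x_1 R(u, v)` at `v = c u` for the R-matrix of type `A`, in the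
rows `i`, `j` and the columns `a`, `b`. -/
def TypeARel (q c : ℂ) (x y : ℕ → ℕ → R) (i j a b : ℕ) : Prop :=
  alph q 1 c i j • (x i a * y j b) + bet q 1 c i j • (x j a * y i b) =
    alph q 1 c a b • (y j b * x i a) + bet q 1 c b a • (y j a * x i b)

/-- `B` is the inverse of the leading `m × m` block of `y`. -/
structure IsBlockInv (m : ℕ) (y B : ℕ → ℕ → R) : Prop where
  left : ∀ g < m, ∀ l < m, ∑ j ∈ Finset.range m, B g j * y j l = if g = l then 1 else 0
  right : ∀ g < m, ∀ l < m, ∑ j ∈ Finset.range m, y g j * B j l = if g = l then 1 else 0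

/-- Multiplication of the relations by the inverse of a block of `y` from both sides. -/
lemma IsBlockInv.sandwich (hB : IsBlockInv m y B) {i a g l : ℕ} (hg : g < m) (hl : l < m)
    (h : ∀ j < m, ∀ b < m, TypeARel q c x y i j a b) :
    alph q 1 c i l • (B g l * x i a) +
        (∑ j ∈ Finset.range m, bet q 1 c i j • (B g j * x j a)) *
          (∑ b ∈ Finset.range m, y i b * B b l) =
      alph q 1 c a g • (x i a * B g l) +
        (∑ j ∈ Finset.range m, B g j * y j a) *
          (∑ b ∈ Finset.range m, bet q 1 c b a • (x i b * B b l)) := by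
  have h0 : ∑ j ∈ Finset.range m, ∑ b ∈ Finset.range m,
      B g j * (alph q 1 c i j • (x i a * y j b) + bet q 1 c i j • (x j a * y i b)) * B b l =
      ∑ j ∈ Finset.range m, ∑ b ∈ Finset.range m,
      B g j * (alph q 1 c a b • (y j b * x i a) + bet q 1 c b a • (y j a * x i b)) * B b l :=
    Finset.sum_congr rfl fun j hj => Finset.sum_congr rfl fun b hb => by
      rw [h j (Finset.mem_range.mp hj) b (Finset.mem_range.mp hb)]
  simp only [mul_add, add_mul, Finset.sum_add_distrib] at h0
  have s1 : ∑ j ∈ Finset.range m, ∑ b ∈ Finset.range m,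
      B g j * (alph q 1 c i j • (x i a * y j b)) * B b l = alph q 1 c i l • (B g l * x i a) := by
    have : ∀ j ∈ Finset.range m, ∑ b ∈ Finset.range m,
        B g j * (alph q 1 c i j • (x i a * y j b)) * B b l =
        if j = l then alph q 1 c i j • (B g j * x i a) else 0 := by
      intro j hj
      have e : ∀ b, B g j * (alph q 1 c i j • (x i a * y j b)) * B b l =
          alph q 1 c i j • (B g j * x i a * (y j b * B b l)) := fun b => by
        simp only [mul_smul_comm, smul_mul_assoc, mul_assoc]
      simp only [e, ← Finset.smul_sum, ← Finset.mul_sum, hB.right j (Finset.mem_range.mp hj) l hl]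
      split_ifs <;> simp
    rw [Finset.sum_congr rfl this, Finset.sum_ite_eq', if_pos (Finset.mem_range.mpr hl)]
  have s2 : ∑ j ∈ Finset.range m, ∑ b ∈ Finset.range m,
      B g j * (bet q 1 c i j • (x j a * y i b)) * B b l =
      (∑ j ∈ Finset.range m, bet q 1 c i j • (B g j * x j a)) *
          (∑ b ∈ Finset.range m, y i b * B b l) := by
    simp only [Finset.sum_mul_sum, mul_smul_comm, smul_mul_assoc, mul_assoc]
  have s3 : ∑ j ∈ Finset.range m, ∑ b ∈ Finset.range m,
      B g j * (alph q 1 c a b • (y j b * x i a)) * B b l = alph q 1 c a g • (x i a * B g l) := by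
    rw [Finset.sum_comm]
    have : ∀ b ∈ Finset.range m, ∑ j ∈ Finset.range m,
        B g j * (alph q 1 c a b • (y j b * x i a)) * B b l =
        if g = b then alph q 1 c a b • (x i a * B b l) else 0 := by
      intro b hb
      have e : ∀ j, B g j * (alph q 1 c a b • (y j b * x i a)) * B b l =
          alph q 1 c a b • ((B g j * y j b) * (x i a * B b l)) := fun j => by
        simp only [mul_smul_comm, smul_mul_assoc, mul_assoc]
      simp only [e, ← Finset.smul_sum, ← Finset.sum_mul, hB.left g hg b (Finset.mem_range.mp hb)]
      split_ifs <;> simp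
    rw [Finset.sum_congr rfl this, Finset.sum_ite_eq, if_pos (Finset.mem_range.mpr hg)]
  have s4 : ∑ j ∈ Finset.range m, ∑ b ∈ Finset.range m,
      B g j * (bet q 1 c b a • (y j a * x i b)) * B b l =
      (∑ j ∈ Finset.range m, B g j * y j a) *
          (∑ b ∈ Finset.range m, bet q 1 c b a • (x i b * B b l)) := by
    simp only [Finset.sum_mul_sum, mul_smul_comm, smul_mul_assoc, mul_assoc]
  rwa [s1, s2, s3, s4] at h0

/-! #### The weights -/

lemma sum_inv_weight (hq0 : q ≠ 0) (m : ℕ) :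
    ∑ i ∈ Finset.range m, q⁻¹ ^ (2 * i) * (q - q⁻¹) = q * (1 - q⁻¹ ^ (2 * m)) := by
  induction m with
  | zero => simp
  | succ m ih =>
    rw [Finset.sum_range_succ, ih]
    simp only [inv_pow]
    field_simp
    ring

lemma sum_weight (hq0 : q ≠ 0) (m : ℕ) :
    ∑ i ∈ Finset.range m, q ^ (2 * i) * (q - q⁻¹) = q⁻¹ * (q ^ (2 * m) - 1) := by
  induction m with
  | zero => simp
  | succ m ih =>
    rw [Finset.sum_range_succ, ih]
    field_simp
    ring

lemma sum_range_bet (f : ℕ → ℂ) (c : ℂ) {m j : ℕ} (hj : j < m) :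
    ∑ i ∈ Finset.range m, f i * bet q 1 c i j =
      (∑ i ∈ Finset.range j, f i * (q - q⁻¹)) +
        c * ((∑ i ∈ Finset.range m, f i * (q - q⁻¹)) -
          ∑ i ∈ Finset.range (j + 1), f i * (q - q⁻¹)) := by
  induction m, hj using Nat.le_induction with
  | base =>
    rw [sub_self, mul_zero, add_zero, Finset.sum_range_succ]
    have : bet q 1 c j j = 0 := by simp [bet]
    rw [this, mul_zero, add_zero]
    refine Finset.sum_congr rfl fun i hi => ?_
    have := Finset.mem_range.mp hi
    simp [bet, this, this.not_gt]
  | succ m hm ih =>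
    rw [Finset.sum_range_succ, ih, Finset.sum_range_succ _ m]
    have h1 : j < m := hm
    have : bet q 1 c m j = (q - q⁻¹) * c := by simp [bet, h1, h1.not_gt]
    rw [this]
    ring

lemma sum_range_bet' (f : ℕ → ℂ) (c : ℂ) {m j : ℕ} (hj : j < m) :
    ∑ i ∈ Finset.range m, f i * bet q 1 c j i =
      c * (∑ i ∈ Finset.range j, f i * (q - q⁻¹)) +
        ((∑ i ∈ Finset.range m, f i * (q - q⁻¹)) -
          ∑ i ∈ Finset.range (j + 1), f i * (q - q⁻¹)) := by
  induction m, hj using Nat.le_induction with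
  | base =>
    rw [sub_self, add_zero, Finset.sum_range_succ]
    have : bet q 1 c j j = 0 := by simp [bet]
    rw [this, mul_zero, add_zero, Finset.mul_sum]
    refine Finset.sum_congr rfl fun i hi => ?_
    have := Finset.mem_range.mp hi
    simp [bet, this, this.not_gt]
    ring
  | succ m hm ih =>
    rw [Finset.sum_range_succ, ih, Finset.sum_range_succ _ m]
    have h1 : j < m := hm
    have : bet q 1 c j m = q - q⁻¹ := by simp [bet, h1, h1.not_gt]
    rw [this]
    ring

/-- The vector `(q^{-2i})` is annihilated at `v = u q^{2m}`. -/
lemma inv_weight_eq (hq0 : q ≠ 0) {m j : ℕ} (hj : j < m) :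
    q⁻¹ ^ (2 * j) * alph q 1 (q ^ (2 * m)) j j +
      ∑ i ∈ Finset.range m, q⁻¹ ^ (2 * i) * bet q 1 (q ^ (2 * m)) i j = 0 := by
  rw [sum_range_bet _ _ hj, sum_inv_weight hq0, sum_inv_weight hq0, sum_inv_weight hq0]
  simp only [alph, if_true, inv_pow]
  field_simp
  ring

/-- The vector `(q^{2i})` is annihilated at `v = u q^{2m}`. -/
lemma weight_eq (hq0 : q ≠ 0) {m j : ℕ} (hj : j < m) :
    q ^ (2 * j) * alph q 1 (q ^ (2 * m)) j j +
      ∑ i ∈ Finset.range m, q ^ (2 * i) * bet q 1 (q ^ (2 * m)) j i = 0 := by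
  rw [sum_range_bet' _ _ hj, sum_weight hq0, sum_weight hq0, sum_weight hq0]
  simp only [alph, if_true]
  field_simp
  ring

lemma bet_succ (c : ℂ) (k a : ℕ) : bet q 1 c k (a + 1) =
    bet q 1 c k a + (q - q⁻¹) * ((if k = a then 1 else 0) - c * (if k = a + 1 then 1 else 0)) := by
  unfold bet
  rcases lt_trichotomy k a with h | h | h
  · simp [h, h.not_gt, h.ne, show k < a + 1 by omega, show ¬ a + 1 < k by omega,
      show ¬ k = a + 1 by omega]
  · subst h
    simp
  · rcases eq_or_lt_of_le (Nat.succ_le_of_lt h) with h' | h'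
    · subst h'
      simp
    · simp [h, h.not_gt, h.ne', show ¬ k < a + 1 by omega, show a + 1 < k by omega,
      show ¬ k = a + 1 by omega]

lemma bet_succ' (c : ℂ) (k a : ℕ) : bet q 1 c (a + 1) k =
    bet q 1 c a k + (q - q⁻¹) * (c * (if k = a then 1 else 0) - (if k = a + 1 then 1 else 0)) := by
  unfold bet
  rcases lt_trichotomy k a with h | h | h
  · simp [h, h.not_gt, h.ne, show k < a + 1 by omega, show ¬ a + 1 < k by omega,
      show ¬ k = a + 1 by omega]
  · subst h
    simp
  · rcases eq_or_lt_of_le (Nat.succ_le_of_lt h) with h' | h'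
    · subst h'
      simp
    · simp [h, h.not_gt, h.ne', show ¬ k < a + 1 by omega, show a + 1 < k by omega,
      show ¬ k = a + 1 by omega]

/-- The solutions of the homogeneous linear system of the R-matrix are multiples of `(q^{-2a})`. -/
lemma eq_inv_weight_smul (hq0 : q ≠ 0) (hc : c ≠ 1) {t : ℕ → R}
    (h : ∀ a < m, alph q 1 c a a • t a + ∑ k ∈ Finset.range m, bet q 1 c k a • t k = 0)
    {a : ℕ} (ha : a < m) : t a = q⁻¹ ^ (2 * a) • t 0 := by
  induction a with
  | zero => simp
  | succ a ih =>
    have ha' : a < m := by omega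
    have h1 := h a ha'
    have h2 := h (a + 1) ha
    simp only [bet_succ, add_smul, mul_smul, sub_smul, Finset.sum_add_distrib, ← Finset.smul_sum,
      Finset.sum_sub_distrib, ite_smul, one_smul, zero_smul, Finset.sum_ite_eq',
      Finset.mem_range, ha, ha', if_true] at h2
    simp only [alph, if_true] at h1 h2
    have h3 : (q * (1 - c)) • t (a + 1) = (q⁻¹ * (1 - c)) • t a := by
      rw [← sub_eq_zero] at h1 h2 ⊢
      rw [← sub_eq_zero.mpr (h2.trans h1.symm)]
      module
    have h4 := congrArg ((q * (1 - c))⁻¹ • ·) h3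
    have hc' : 1 - c ≠ 0 := sub_ne_zero.mpr hc.symm
    simp only [smul_smul] at h4
    rw [inv_mul_cancel₀ (mul_ne_zero hq0 hc'), one_smul, ih ha', smul_smul] at h4
    rw [h4]
    congr 1
    simp only [inv_pow]
    field_simp
    ring

/-- The solutions of the transposed linear system are multiples of `(q^{2a})`. -/
lemma eq_weight_smul (hq0 : q ≠ 0) (hc : c ≠ 1) {t : ℕ → R}
    (h : ∀ a < m, alph q 1 c a a • t a + ∑ k ∈ Finset.range m, bet q 1 c a k • t k = 0)
    {a : ℕ} (ha : a < m) : t a = q ^ (2 * a) • t 0 := by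
  induction a with
  | zero => simp
  | succ a ih =>
    have ha' : a < m := by omega
    have h1 := h a ha'
    have h2 := h (a + 1) ha
    simp only [bet_succ', add_smul, mul_smul, sub_smul, Finset.sum_add_distrib, ← Finset.smul_sum,
      Finset.sum_sub_distrib, ite_smul, one_smul, zero_smul, Finset.sum_ite_eq',
      Finset.mem_range, ha, ha', if_true] at h2
    simp only [alph, if_true] at h1 h2
    have h3 : (q⁻¹ * (1 - c)) • t (a + 1) = (q * (1 - c)) • t a := by
      rw [← sub_eq_zero] at h1 h2 ⊢
      rw [← sub_eq_zero.mpr (h2.trans h1.symm)]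
      module
    have h4 := congrArg ((q⁻¹ * (1 - c))⁻¹ • ·) h3
    have hc' : 1 - c ≠ 0 := sub_ne_zero.mpr hc.symm
    simp only [smul_smul] at h4
    rw [inv_mul_cancel₀ (mul_ne_zero (inv_ne_zero hq0) hc'), one_smul, ih ha', smul_smul] at h4
    rw [h4]
    congr 1
    field_simp
    ring

end TypeA

/-! ### Transposes and quasideterminants in type `A` -/

section Contractions

variable {R : Type*} [Ring R] [Algebra ℂ R] {q : ℂ} {m : ℕ} {x y B : ℕ → ℕ → R}

lemma sum_smul_mul_left {ι : Type*} (t : Finset ι) (f : ι → ℂ) (s : R) (g : ι → R) :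
    ∑ i ∈ t, f i • (s * g i) = s * ∑ i ∈ t, f i • g i := by
  rw [Finset.mul_sum]
  exact Finset.sum_congr rfl fun _ _ => (mul_smul_comm _ _ _).symm

lemma sum_smul_mul_right {ι : Type*} (t : Finset ι) (f : ι → ℂ) (s : R) (g : ι → R) :
    ∑ i ∈ t, f i • (g i * s) = (∑ i ∈ t, f i • g i) * s := by
  rw [Finset.sum_mul]
  exact Finset.sum_congr rfl fun _ _ => (smul_mul_assoc _ _ _).symm

lemma sum_inv_weight_smul_eq_zero (hq0 : q ≠ 0) (P : ℕ → R) :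
    ∑ i ∈ Finset.range m, q⁻¹ ^ (2 * i) • (alph q 1 (q ^ (2 * m)) i i • P i +
      ∑ j ∈ Finset.range m, bet q 1 (q ^ (2 * m)) i j • P j) = 0 := by
  simp only [smul_add, Finset.smul_sum, Finset.sum_add_distrib, smul_smul]
  rw [Finset.sum_comm (f := fun i j => (q⁻¹ ^ (2 * i) * bet q 1 (q ^ (2 * m)) i j) • P j),
    ← Finset.sum_add_distrib]
  refine Finset.sum_eq_zero fun j hj => ?_
  rw [← Finset.sum_smul, ← add_smul, inv_weight_eq hq0 (Finset.mem_range.mp hj), zero_smul]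

lemma sum_weight_smul_eq_zero (hq0 : q ≠ 0) (P : ℕ → R) :
    ∑ i ∈ Finset.range m, q ^ (2 * i) • (alph q 1 (q ^ (2 * m)) i i • P i +
      ∑ j ∈ Finset.range m, bet q 1 (q ^ (2 * m)) j i • P j) = 0 := by
  simp only [smul_add, Finset.smul_sum, Finset.sum_add_distrib, smul_smul]
  rw [Finset.sum_comm (f := fun i j => (q ^ (2 * i) * bet q 1 (q ^ (2 * m)) j i) • P j),
    ← Finset.sum_add_distrib]
  refine Finset.sum_eq_zero fun j hj => ?_
  rw [← Finset.sum_smul, ← add_smul, weight_eq hq0 (Finset.mem_range.mp hj), zero_smul]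

/-- The contraction of the sandwiched relation with the vector `(q^{-2i})`. -/
lemma IsBlockInv.contract_rows (hq0 : q ≠ 0) (hB : IsBlockInv m y B) {a g : ℕ} (hg : g < m)
    (h : ∀ i < m, ∀ j < m, ∀ b < m, TypeARel q (q ^ (2 * m)) x y i j a b) :
    alph q 1 (q ^ (2 * m)) a g • (∑ i ∈ Finset.range m, q⁻¹ ^ (2 * i) • (x i a * B g i)) +
      (∑ j ∈ Finset.range m, B g j * y j a) * (∑ b ∈ Finset.range m, bet q 1 (q ^ (2 * m)) b a •
        (∑ i ∈ Finset.range m, q⁻¹ ^ (2 * i) • (x i b * B b i))) = 0 := by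
  rw [← sum_inv_weight_smul_eq_zero (m := m) hq0 fun j => B g j * x j a]
  have h1 : ∀ i ∈ Finset.range m, q⁻¹ ^ (2 * i) • (alph q 1 (q ^ (2 * m)) i i • (B g i * x i a) +
      ∑ j ∈ Finset.range m, bet q 1 (q ^ (2 * m)) i j • (B g j * x j a)) =
      q⁻¹ ^ (2 * i) • (alph q 1 (q ^ (2 * m)) a g • (x i a * B g i) +
        (∑ j ∈ Finset.range m, B g j * y j a) *
          (∑ b ∈ Finset.range m, bet q 1 (q ^ (2 * m)) b a • (x i b * B b i))) := by
    intro i hi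
    have hi' := Finset.mem_range.mp hi
    have := hB.sandwich hg hi' (h i hi')
    rw [hB.right i hi' i hi', if_pos rfl, mul_one] at this
    rw [this]
  rw [Finset.sum_congr rfl h1]
  simp only [smul_add, Finset.sum_add_distrib]
  congr 1
  · rw [Finset.smul_sum]
    exact Finset.sum_congr rfl fun i _ => smul_comm _ _ _
  · rw [sum_smul_mul_left]
    congr 1
    simp only [Finset.smul_sum]
    rw [Finset.sum_comm]
    exact Finset.sum_congr rfl fun _ _ => Finset.sum_congr rfl fun _ _ => smul_comm _ _ _

/-- The contraction of the sandwiched relation with the vector `(q^{2a})`. -/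
lemma IsBlockInv.contract_cols (hq0 : q ≠ 0) (hB : IsBlockInv m y B) {i l : ℕ} (hl : l < m)
    (h : ∀ a < m, ∀ j < m, ∀ b < m, TypeARel q (q ^ (2 * m)) x y i j a b) :
    alph q 1 (q ^ (2 * m)) i l • (∑ a ∈ Finset.range m, q ^ (2 * a) • (B a l * x i a)) +
      (∑ j ∈ Finset.range m, bet q 1 (q ^ (2 * m)) i j •
        (∑ a ∈ Finset.range m, q ^ (2 * a) • (B a j * x j a))) *
        (∑ b ∈ Finset.range m, y i b * B b l) = 0 := by
  rw [← sum_weight_smul_eq_zero (m := m) hq0 fun b => x i b * B b l]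
  have h1 : ∀ a ∈ Finset.range m, q ^ (2 * a) • (alph q 1 (q ^ (2 * m)) a a • (x i a * B a l) +
      ∑ j ∈ Finset.range m, bet q 1 (q ^ (2 * m)) j a • (x i j * B j l)) =
      q ^ (2 * a) • (alph q 1 (q ^ (2 * m)) i l • (B a l * x i a) +
        (∑ j ∈ Finset.range m, bet q 1 (q ^ (2 * m)) i j • (B a j * x j a)) *
          (∑ b ∈ Finset.range m, y i b * B b l)) := by
    intro a ha
    have ha' := Finset.mem_range.mp ha
    have := hB.sandwich ha' hl (h a ha')
    rw [hB.left a ha' a ha', if_pos rfl, one_mul] at this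
    rw [this]
  rw [Finset.sum_congr rfl h1]
  simp only [smul_add, Finset.sum_add_distrib]
  congr 1
  · rw [Finset.smul_sum]
    exact Finset.sum_congr rfl fun i _ => smul_comm _ _ _
  · rw [sum_smul_mul_right]
    congr 1
    simp only [Finset.smul_sum]
    rw [Finset.sum_comm]
    exact Finset.sum_congr rfl fun _ _ => Finset.sum_congr rfl fun _ _ => smul_comm _ _ _

/-- The scalar `Z` of the relation `Aᵗ(u) D B(v)ᵗ = D Z` with `D = diag (q^{-2i})`. -/
def rowScalar (q : ℂ) (m : ℕ) (x B : ℕ → ℕ → R) : R :=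
  ∑ i ∈ Finset.range m, q⁻¹ ^ (2 * i) • (x i 0 * B 0 i)

/-- The scalar `Z` of the relation `B(v)ᵗ D Aᵗ(u) = D Z` with `D = diag (q^{2i})`. -/
def colScalar (q : ℂ) (m : ℕ) (x B : ℕ → ℕ → R) : R :=
  ∑ a ∈ Finset.range m, q ^ (2 * a) • (B a 0 * x 0 a)

lemma alph_of_ne (c : ℂ) {i j : ℕ} (h : i ≠ j) : alph q 1 c i j = 1 - c := by simp [alph, h]

/-- At `v = u q^{2m}` the transposes of a block and of its inverse are, up to a conjugation,
inverse to each other up to a scalar. -/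
lemma IsBlockInv.row_relation (hq0 : q ≠ 0) (hc : q ^ (2 * m) ≠ 1) (hB : IsBlockInv m y B)
    (h : ∀ i < m, ∀ j < m, ∀ a < m, ∀ b < m, TypeARel q (q ^ (2 * m)) x y i j a b)
    {a g : ℕ} (ha : a < m) (hg : g < m) :
    ∑ i ∈ Finset.range m, q⁻¹ ^ (2 * i) • (x i a * B g i) =
      if a = g then q⁻¹ ^ (2 * a) • rowScalar q m x B else 0 := by
  have key := fun a ha g hg => hB.contract_rows (a := a) (g := g) hq0 hg
    (fun i hi j hj b hb => h i hi j hj a ha b hb)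
  split_ifs with hag
  · subst hag
    refine eq_inv_weight_smul hq0 hc (t := fun a => ∑ i ∈ Finset.range m,
      q⁻¹ ^ (2 * i) • (x i a * B a i)) (fun a ha => ?_) ha
    have := key a ha a ha
    rwa [hB.left a ha a ha, if_pos rfl, one_mul] at this
  · have := key a ha g hg
    rw [hB.left g hg a ha, if_neg (Ne.symm hag), zero_mul, add_zero, alph_of_ne _ hag,
      smul_eq_zero_iff_right (sub_ne_zero.mpr hc.symm)] at this
    exact this

lemma IsBlockInv.col_relation (hq0 : q ≠ 0) (hc : q ^ (2 * m) ≠ 1) (hB : IsBlockInv m y B)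
    (h : ∀ i < m, ∀ j < m, ∀ a < m, ∀ b < m, TypeARel q (q ^ (2 * m)) x y i j a b)
    {i l : ℕ} (hi : i < m) (hl : l < m) :
    ∑ a ∈ Finset.range m, q ^ (2 * a) • (B a l * x i a) =
      if i = l then q ^ (2 * i) • colScalar q m x B else 0 := by
  have key := fun i hi l hl => hB.contract_cols (i := i) (l := l) hq0 hl
    (fun a ha j hj b hb => h i hi j hj a ha b hb)
  split_ifs with hil
  · subst hil
    refine eq_weight_smul hq0 hc (t := fun i => ∑ a ∈ Finset.range m,
      q ^ (2 * a) • (B a i * x i a)) (fun i hi => ?_) hi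
    have := key i hi i hi
    rwa [hB.right i hi i hi, if_pos rfl, mul_one] at this
  · have := key i hi l hl
    rw [hB.right i hi l hl, if_neg hil, mul_zero, add_zero, alph_of_ne _ hil,
      smul_eq_zero_iff_right (sub_ne_zero.mpr hc.symm)] at this
    exact this

/-- The contraction of the next column with the inverse of the block. -/
lemma IsBlockInv.next_col (hq0 : q ≠ 0) (hc : q ^ (2 * m) ≠ 1) (hB : IsBlockInv m y B)
    (h : ∀ i < m, ∀ j < m, ∀ a < m + 1, ∀ b < m, TypeARel q (q ^ (2 * m)) x y i j a b)
    {g : ℕ} (hg : g < m) :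
    ∑ i ∈ Finset.range m, q⁻¹ ^ (2 * i) • (x i m * B g i) =
      (q * q⁻¹ ^ (2 * m)) • ((∑ j ∈ Finset.range m, B g j * y j m) * rowScalar q m x B) := by
  have key := hB.contract_rows (a := m) (g := g) hq0 hg
    (fun i hi j hj b hb => h i hi j hj m (by omega) b hb)
  have hs : ∑ b ∈ Finset.range m, bet q 1 (q ^ (2 * m)) b m •
      (∑ i ∈ Finset.range m, q⁻¹ ^ (2 * i) • (x i b * B b i)) =
      (q * (1 - q⁻¹ ^ (2 * m))) • rowScalar q m x B := by
    rw [← sum_inv_weight hq0, Finset.sum_smul]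
    refine Finset.sum_congr rfl fun b hb => ?_
    have hb' := Finset.mem_range.mp hb
    rw [hB.row_relation hq0 hc (fun i hi j hj a ha b hb => h i hi j hj a (by omega) b hb) hb' hb',
      if_pos rfl, smul_smul]
    simp [bet, hb', hb'.not_gt, mul_comm]
  rw [hs, alph_of_ne _ hg.ne', mul_smul_comm] at key
  have hc' : 1 - q ^ (2 * m) ≠ 0 := sub_ne_zero.mpr hc.symm
  have h2 := congrArg ((1 - q ^ (2 * m))⁻¹ • ·) key
  simp only [smul_add, smul_smul, inv_mul_cancel₀ hc', one_smul, smul_zero] at h2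
  rw [eq_neg_of_add_eq_zero_left h2, ← neg_smul]
  congr 1
  simp only [inv_pow]
  field_simp
  ring

/-- The contraction of the next row with the inverse of the block. -/
lemma IsBlockInv.next_row (hq0 : q ≠ 0) (hc : q ^ (2 * m) ≠ 1) (hB : IsBlockInv m y B)
    (h : ∀ i < m + 1, ∀ j < m, ∀ a < m, ∀ b < m, TypeARel q (q ^ (2 * m)) x y i j a b)
    {l : ℕ} (hl : l < m) :
    ∑ a ∈ Finset.range m, q ^ (2 * a) • (B a l * x m a) =
      (q⁻¹ * q ^ (2 * m)) • (colScalar q m x B * (∑ b ∈ Finset.range m, y m b * B b l)) := by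
  have key := hB.contract_cols (i := m) (l := l) hq0 hl
    (fun a ha j hj b hb => h m (by omega) j hj a ha b hb)
  have hs : ∑ j ∈ Finset.range m, bet q 1 (q ^ (2 * m)) m j •
      (∑ a ∈ Finset.range m, q ^ (2 * a) • (B a j * x j a)) =
      (q ^ (2 * m) * (q⁻¹ * (q ^ (2 * m) - 1))) • colScalar q m x B := by
    rw [← sum_weight hq0, Finset.mul_sum, Finset.sum_smul]
    refine Finset.sum_congr rfl fun b hb => ?_
    have hb' := Finset.mem_range.mp hb
    rw [hB.col_relation hq0 hc (fun i hi j hj a ha b hb => h i (by omega) j hj a ha b hb) hb' hb',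
      if_pos rfl, smul_smul]
    congr 1
    simp only [bet, hb', hb'.not_gt, if_true, if_false]
    ring
  rw [hs, alph_of_ne _ hl.ne', smul_mul_assoc] at key
  have hc' : 1 - q ^ (2 * m) ≠ 0 := sub_ne_zero.mpr hc.symm
  have h2 := congrArg ((1 - q ^ (2 * m))⁻¹ • ·) key
  simp only [smul_add, smul_smul, inv_mul_cancel₀ hc', one_smul, smul_zero] at h2
  rw [eq_neg_of_add_eq_zero_left h2, ← neg_smul]
  congr 1
  field_simp
  ring

/-- The quasideterminant with the box at `(m, m)`, in terms of the inverse `B` of the block. -/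
def schur (m : ℕ) (y B : ℕ → ℕ → R) : R :=
  y m m - ∑ a ∈ Finset.range m, ∑ b ∈ Finset.range m, y m a * B a b * y b m

/-- If the row vector `s` annihilates the columns of the transpose of `x` before the last one, then
its product with the last column is given by the Schur complement of `y`. -/
lemma IsBlockInv.row_mul_last (hq0 : q ≠ 0) (hc : q ^ (2 * m) ≠ 1)
    (hB : IsBlockInv m y B)
    (h : ∀ i < m + 1, ∀ j < m + 1, ∀ a < m + 1, ∀ b < m + 1, i + j < 2 * m → a + b < 2 * m →
      TypeARel q (q ^ (2 * m)) x y i j a b)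
    (hZ : IsUnit (rowScalar q m x B)) {s : ℕ → R}
    (hs : ∀ i < m, ∑ a ∈ Finset.range (m + 1), s a * x i a = 0) :
    ∑ a ∈ Finset.range (m + 1), s a * x m a = s m * (colScalar q m x B * schur m y B) := by
  have hc' : 1 - q ^ (2 * m) ≠ 0 := sub_ne_zero.mpr hc.symm
  set E : ℕ → R := fun g => ∑ j ∈ Finset.range m, B g j * y j m with hE
  set F : ℕ → R := fun l => ∑ b ∈ Finset.range m, y m b * B b l with hF
  have hrow := fun a ha g hg => hB.row_relation hq0 hc (fun i hi j hj a ha b hb => h i (by omega) j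
    (by omega) a (by omega) b (by omega) (by omega) (by omega)) (a := a) (g := g) ha hg
  have hcol := fun i hi l hl => hB.col_relation hq0 hc (fun i hi j hj a ha b hb => h i (by omega) j
    (by omega) a (by omega) b (by omega) (by omega) (by omega)) (i := i) (l := l) hi hl
  have hnc : ∀ g < m, ∑ i ∈ Finset.range m, q⁻¹ ^ (2 * i) • (x i m * B g i) =
      (q * q⁻¹ ^ (2 * m)) • (E g * rowScalar q m x B) := fun g hg => hB.next_col hq0 hc
      (fun i hi j hj a ha b hb => h i (by omega) j
      (by omega) a (by omega) b (by omega) (by omega) (by omega)) hg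
  have hnr : ∀ l < m, ∑ a ∈ Finset.range m, q ^ (2 * a) • (B a l * x m a) =
      (q⁻¹ * q ^ (2 * m)) • (colScalar q m x B * F l) := fun l hl => hB.next_row hq0 hc
      (fun i hi j hj a ha b hb => h i (by omega) j
    (by omega) a (by omega) b (by omega) (by omega) (by omega)) hl
  set Z := rowScalar q m x B
  set Z' := colScalar q m x B
  -- The components of `s` in terms of its last one.
  have hsg : ∀ g < m, s g = -(q * q⁻¹ ^ (2 * m) * q ^ (2 * g)) • (s m * E g) := by
    intro g hg
    have h0 : ∑ i ∈ Finset.range m, q⁻¹ ^ (2 * i) •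
        ((∑ a ∈ Finset.range (m + 1), s a * x i a) * B g i) = 0 :=
      Finset.sum_eq_zero fun i hi => by rw [hs i (Finset.mem_range.mp hi), zero_mul, smul_zero]
    simp only [Finset.sum_range_succ, add_mul, smul_add, Finset.sum_add_distrib] at h0
    have e1 : ∑ i ∈ Finset.range m, q⁻¹ ^ (2 * i) •
        ((∑ a ∈ Finset.range m, s a * x i a) * B g i) = q⁻¹ ^ (2 * g) • (s g * Z) := by
      simp only [Finset.sum_mul, Finset.smul_sum]
      rw [Finset.sum_comm]
      have : ∀ a ∈ Finset.range m, ∑ i ∈ Finset.range m, q⁻¹ ^ (2 * i) • (s a * x i a * B g i) =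
          if a = g then q⁻¹ ^ (2 * a) • (s a * Z) else 0 := by
        intro a ha
        simp only [mul_assoc]
        rw [sum_smul_mul_left, hrow a (Finset.mem_range.mp ha) g hg]
        split_ifs <;> simp
      rw [Finset.sum_congr rfl this, Finset.sum_ite_eq', if_pos (Finset.mem_range.mpr hg)]
    have e2 : ∑ i ∈ Finset.range m, q⁻¹ ^ (2 * i) • (s m * x i m * B g i) =
        (q * q⁻¹ ^ (2 * m)) • (s m * E g * Z) := by
      simp only [mul_assoc]
      rw [sum_smul_mul_left, hnc g hg, mul_smul_comm]
    rw [e1, e2, ← smul_mul_assoc, ← smul_mul_assoc, ← add_mul] at h0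
    have h1 := (hZ.mul_left_eq_zero).mp h0
    have h2 := congrArg (q ^ (2 * g) • ·) h1
    simp only [smul_add, smul_smul, smul_zero] at h2
    rw [← mul_pow, mul_inv_cancel₀ hq0, one_pow, one_smul] at h2
    rw [eq_neg_of_add_eq_zero_left h2, neg_smul]
    congr 2
    ring
  -- The exchange of the next row at `u` and the next column at `v`.
  have hex : ∀ a < m, ∀ j < m, x m a * y j m = y j m * x m a +
      ((1 - q ^ (2 * m))⁻¹ * ((q - q⁻¹) * q ^ (2 * m))) • (y j a * x m m - x j a * y m m) := by
    intro a ha j hj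
    have h0 := h m (by omega) j (by omega) a (by omega) m (by omega) (by omega) (by omega)
    unfold TypeARel at h0
    rw [alph_of_ne _ hj.ne', alph_of_ne _ ha.ne] at h0
    have b1 : bet q 1 (q ^ (2 * m)) m j = (q - q⁻¹) * q ^ (2 * m) := by simp [bet, hj, hj.not_gt]
    have b2 : bet q 1 (q ^ (2 * m)) m a = (q - q⁻¹) * q ^ (2 * m) := by simp [bet, ha, ha.not_gt]
    rw [b1, b2] at h0
    have h1 := congrArg ((1 - q ^ (2 * m))⁻¹ • ·) (eq_sub_of_add_eq h0)
    simp only [smul_add, smul_sub, smul_smul, inv_mul_cancel₀ hc', one_smul] at h1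
    rw [h1]
    module
  -- Both products below differ from `∑ F E` by multiples of the corner entries.
  have hwt : ((q - q⁻¹) * (∑ a ∈ Finset.range m, q ^ (2 * a))) = q⁻¹ * (q ^ (2 * m) - 1) := by
    rw [← sum_weight hq0, Finset.mul_sum]
    exact Finset.sum_congr rfl fun _ _ => mul_comm _ _
  have hsum1 : ∑ a ∈ Finset.range m, ∑ j ∈ Finset.range m, q ^ (2 * a) • (B a j * x j a) =
      (∑ a ∈ Finset.range m, q ^ (2 * a)) • Z' := by
    rw [Finset.sum_comm, Finset.sum_smul]
    refine Finset.sum_congr rfl fun j hj => ?_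
    have hj' := Finset.mem_range.mp hj
    rw [hcol j hj' j hj', if_pos rfl]
  have hsum2 : ∑ a ∈ Finset.range m, ∑ j ∈ Finset.range m, q ^ (2 * a) • (B a j * y j a) =
      (∑ a ∈ Finset.range m, q ^ (2 * a)) • (1 : R) := by
    rw [Finset.sum_smul]
    refine Finset.sum_congr rfl fun j hj => ?_
    have hj' := Finset.mem_range.mp hj
    rw [← Finset.smul_sum, hB.left j hj' j hj', if_pos rfl]
  have hZF : ∑ a ∈ Finset.range m, ∑ j ∈ Finset.range m, q ^ (2 * a) • (B a j * (x m a * y j m)) =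
      (q⁻¹ * q ^ (2 * m)) • (Z' * ∑ j ∈ Finset.range m, F j * y j m) := by
    rw [Finset.sum_comm, Finset.mul_sum, Finset.smul_sum]
    refine Finset.sum_congr rfl fun j hj => ?_
    have hj' := Finset.mem_range.mp hj
    simp only [← mul_assoc]
    rw [sum_smul_mul_right, hnr j hj', smul_mul_assoc, mul_assoc]
  have hEγ : ∑ a ∈ Finset.range m, q ^ (2 * a) • (E a * x m a) =
      ∑ a ∈ Finset.range m, ∑ j ∈ Finset.range m, q ^ (2 * a) • (B a j * (y j m * x m a)) := by
    refine Finset.sum_congr rfl fun a _ => ?_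
    simp only [hE, Finset.sum_mul, Finset.smul_sum, mul_assoc]
  have hmain : ∑ a ∈ Finset.range m, ∑ j ∈ Finset.range m,
      q ^ (2 * a) • (B a j * (x m a * y j m)) =
      ∑ a ∈ Finset.range m, q ^ (2 * a) • (E a * x m a) +
      ((1 - q ^ (2 * m))⁻¹ * ((q - q⁻¹) * q ^ (2 * m)) * (∑ a ∈ Finset.range m, q ^ (2 * a))) •
        (x m m - Z' * y m m) := by
    rw [hEγ]
    have e : ∀ a ∈ Finset.range m, ∀ j ∈ Finset.range m,
        q ^ (2 * a) • (B a j * (x m a * y j m)) = q ^ (2 * a) • (B a j * (y j m * x m a)) +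
        ((1 - q ^ (2 * m))⁻¹ * ((q - q⁻¹) * q ^ (2 * m))) •
          ((q ^ (2 * a) • (B a j * y j a)) * x m m - (q ^ (2 * a) • (B a j * x j a)) * y m m) := by
      intro a ha j hj
      rw [hex a (Finset.mem_range.mp ha) j (Finset.mem_range.mp hj), mul_add, smul_add,
        mul_smul_comm, smul_comm, mul_sub, smul_sub]
      simp only [smul_mul_assoc, mul_assoc]
    rw [Finset.sum_congr rfl fun a ha => Finset.sum_congr rfl fun j hj => e a ha j hj]
    simp only [Finset.sum_add_distrib]
    congr 1
    have hk : ∀ (k : ℂ) (f : ℕ → ℕ → R), ∑ a ∈ Finset.range m, ∑ j ∈ Finset.range m, k • f a j =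
        k • ∑ a ∈ Finset.range m, ∑ j ∈ Finset.range m, f a j := fun k f => by
      simp only [Finset.smul_sum]
    rw [hk]
    simp only [Finset.sum_sub_distrib, ← Finset.sum_mul]
    rw [hsum1, hsum2]
    simp only [smul_mul_assoc, one_mul, ← smul_sub, smul_smul]
  rw [hZF] at hmain
  have hcoef : (1 - q ^ (2 * m))⁻¹ * ((q - q⁻¹) * q ^ (2 * m)) *
      (∑ a ∈ Finset.range m, q ^ (2 * a)) = -(q⁻¹ * q ^ (2 * m)) := by
    rw [show (1 - q ^ (2 * m))⁻¹ * ((q - q⁻¹) * q ^ (2 * m)) * (∑ a ∈ Finset.range m, q ^ (2 * a)) =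
      (1 - q ^ (2 * m))⁻¹ * q ^ (2 * m) * ((q - q⁻¹) * (∑ a ∈ Finset.range m, q ^ (2 * a))) by ring,
      hwt]
    field_simp
    ring
  rw [hcoef] at hmain
  have hfin : ∑ a ∈ Finset.range m, q ^ (2 * a) • (E a * x m a) = (q⁻¹ * q ^ (2 * m)) •
      (Z' * (∑ j ∈ Finset.range m, F j * y j m) + x m m - Z' * y m m) := by
    rw [eq_sub_of_add_eq hmain.symm]
    module
  have hschur : schur m y B = y m m - ∑ j ∈ Finset.range m, F j * y j m := by
    simp only [schur, hF, Finset.sum_mul]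
    rw [Finset.sum_comm]
  rw [Finset.sum_range_succ, hschur]
  have e : ∑ a ∈ Finset.range m, s a * x m a =
      -(q * q⁻¹ ^ (2 * m)) • (s m * ∑ a ∈ Finset.range m, q ^ (2 * a) • (E a * x m a)) := by
    rw [Finset.mul_sum, Finset.smul_sum]
    refine Finset.sum_congr rfl fun a ha => ?_
    rw [hsg a (Finset.mem_range.mp ha), smul_mul_assoc, mul_smul_comm, smul_smul, mul_assoc (s m)]
    congr 1
    ring
  have hone : -(q * q⁻¹ ^ (2 * m)) * (q⁻¹ * q ^ (2 * m)) = -1 := by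
    simp only [inv_pow]
    field_simp
  rw [e, hfin, mul_smul_comm, smul_smul, hone]
  rw [mul_sub, mul_sub, mul_sub, mul_add]
  module

end Contractions

section SchurComplement

variable {R : Type*} [Ring R] [Algebra ℂ R] {q c : ℂ} {m : ℕ} {x y B : ℕ → ℕ → R}

/-- The Schur complement at `v = c u` commutes with the entries of the block at `u`. -/
lemma IsBlockInv.schur_commute (hB : IsBlockInv m y B) (hc : c ≠ 1)
    (h : ∀ i < m, ∀ j < m + 1, ∀ a < m, ∀ b < m + 1, TypeARel q c x y i j a b)
    {i a : ℕ} (hi : i < m) (ha : a < m) : Commute (schur m y B) (x i a) := by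
  have hc' : 1 - c ≠ 0 := sub_ne_zero.mpr hc.symm
  obtain ⟨F, hF⟩ : ∃ F : ℕ → R, ∀ l, F l = ∑ b ∈ Finset.range m, y m b * B b l := ⟨_, fun _ => rfl⟩
  have hschur : schur m y B = y m m - ∑ j ∈ Finset.range m, F j * y j m := by
    simp only [schur, hF, Finset.sum_mul]
    rw [Finset.sum_comm]
  have hFy : ∀ b < m, ∑ j ∈ Finset.range m, F j * y j b = y m b := by
    intro b hb
    simp only [hF, Finset.sum_mul, mul_assoc]
    rw [Finset.sum_comm]
    have : ∀ k ∈ Finset.range m, ∑ j ∈ Finset.range m, y m k * (B k j * y j b) =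
        if k = b then y m k else 0 := by
      intro k hk
      rw [← Finset.mul_sum, hB.left k (Finset.mem_range.mp hk) b hb, mul_ite, mul_one, mul_zero]
    rw [Finset.sum_congr rfl this, Finset.sum_ite_eq', if_pos (Finset.mem_range.mpr hb)]
  have hbm : bet q 1 c i m = q - q⁻¹ := by simp [bet, hi, hi.not_gt]
  obtain ⟨K, hK⟩ : ∃ K : R, K = ∑ j ∈ Finset.range m, bet q 1 c i j • (F j * x j a) -
    (q - q⁻¹) • x m a := ⟨_, rfl⟩
  -- The relations multiplied by the row vector `F`, for an arbitrary column `b ≤ m`.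
  have hmul : ∀ b < m + 1, ∑ j ∈ Finset.range m, alph q 1 c i j • (F j * x i a * y j b) +
      K * y i b = (1 - c) • (x i a * y m b) +
        alph q 1 c a b • ((∑ j ∈ Finset.range m, F j * y j b - y m b) * x i a) := by
    intro b hb
    have h1 : ∑ j ∈ Finset.range m, F j * (alph q 1 c i j • (x i a * y j b) +
        bet q 1 c i j • (x j a * y i b)) = ∑ j ∈ Finset.range m,
        F j * (alph q 1 c a b • (y j b * x i a) + bet q 1 c b a • (y j a * x i b)) :=
      Finset.sum_congr rfl fun j hj => by
        rw [h i hi j (by have := Finset.mem_range.mp hj; omega) a ha b hb]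
    have h2 := h i hi m (by omega) a ha b hb
    unfold TypeARel at h2
    simp only [mul_add, Finset.sum_add_distrib, mul_smul_comm, ← mul_assoc,
      sum_smul_mul_right, ← Finset.smul_sum, hFy a ha] at h1
    simp only [smul_mul_assoc] at h1
    rw [alph_of_ne _ hi.ne, hbm] at h2
    rw [hK, sub_mul, smul_mul_assoc, sub_mul, smul_sub, add_sub, h1]
    rw [eq_sub_of_add_eq h2]
    module
  have hl : ∀ l < m, alph q 1 c i l • (F l * x i a) + K * (if i = l then 1 else 0) =
      (1 - c) • (x i a * F l) := by
    intro l hl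
    have h1 : ∑ b ∈ Finset.range m, (∑ j ∈ Finset.range m, alph q 1 c i j • (F j * x i a * y j b) +
        K * y i b) * B b l = ∑ b ∈ Finset.range m, ((1 - c) • (x i a * y m b)) * B b l :=
      Finset.sum_congr rfl fun b hb => by
        have hb' := Finset.mem_range.mp hb
        rw [hmul b (by omega), hFy b hb', sub_self, zero_mul, smul_zero, add_zero]
    simp only [add_mul, Finset.sum_add_distrib, smul_mul_assoc, mul_assoc, ← Finset.mul_sum,
      ← Finset.smul_sum] at h1
    rw [hB.right i hi l hl, ← hF] at h1
    rw [← h1]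
    congr 1
    simp only [Finset.sum_mul]
    rw [Finset.sum_comm]
    have : ∀ j ∈ Finset.range m, ∑ b ∈ Finset.range m,
        alph q 1 c i j • (F j * (x i a * y j b)) * B b l =
        if j = l then alph q 1 c i j • (F j * x i a) else 0 := by
      intro j hj
      have e : ∀ b, alph q 1 c i j • (F j * (x i a * y j b)) * B b l =
          (alph q 1 c i j • (F j * x i a)) * (y j b * B b l) := fun b => by
        simp only [smul_mul_assoc, mul_assoc]
      simp only [e, ← Finset.mul_sum]
      rw [hB.right j (Finset.mem_range.mp hj) l hl, mul_ite, mul_one, mul_zero]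
    rw [Finset.sum_congr rfl this, Finset.sum_ite_eq', if_pos (Finset.mem_range.mpr hl)]
  have h3 : ∑ j ∈ Finset.range m, alph q 1 c i j • (F j * x i a * y j m) + K * y i m =
      (1 - c) • (x i a * ∑ j ∈ Finset.range m, F j * y j m) := by
    rw [Finset.mul_sum, Finset.smul_sum]
    have : ∀ l ∈ Finset.range m, (1 - c) • (x i a * (F l * y l m)) =
        alph q 1 c i l • (F l * x i a * y l m) + if i = l then K * y l m else 0 := by
      intro l hl'
      rw [← mul_assoc, ← smul_mul_assoc, ← hl l (Finset.mem_range.mp hl'), add_mul, smul_mul_assoc]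
      congr 1
      split_ifs <;> simp
    rw [Finset.sum_congr rfl this, Finset.sum_add_distrib, Finset.sum_ite_eq,
      if_pos (Finset.mem_range.mpr hi)]
  have h4 := hmul m (by omega)
  rw [h3, alph_of_ne _ ha.ne, ← smul_add] at h4
  have h5 := smul_right_injective R hc' h4
  rw [Commute, SemiconjBy, hschur, sub_mul, mul_sub, h5]
  noncomm_ring

omit [Algebra ℂ R] in
/-- The Schur complement as the result of a row operation. -/
lemma exists_schur_row (m : ℕ) (y B : ℕ → ℕ → R) : ∃ w : ℕ → R, w m = 1 ∧
    ∀ b, ∑ j ∈ Finset.range (m + 1), w j * y j b =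
      y m b - ∑ a ∈ Finset.range m, ∑ j ∈ Finset.range m, y m a * B a j * y j b := by
  refine ⟨fun j => if j < m then -∑ b ∈ Finset.range m, y m b * B b j else 1, by simp, fun b => ?_⟩
  simp only [Finset.sum_range_succ, lt_irrefl, if_false, one_mul]
  rw [sub_eq_add_neg, add_comm]
  congr 1
  rw [Finset.sum_comm, ← Finset.sum_neg_distrib]
  refine Finset.sum_congr rfl fun j hj => ?_
  rw [if_pos (Finset.mem_range.mp hj), neg_mul, Finset.sum_mul]

omit [Algebra ℂ R] in
lemma IsBlockInv.sum_mul_block (hB : IsBlockInv m y B) {b : ℕ} (hb : b < m) :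
    ∑ a ∈ Finset.range m, ∑ j ∈ Finset.range m, y m a * B a j * y j b = y m b := by
  have : ∀ a ∈ Finset.range m, ∑ j ∈ Finset.range m, y m a * B a j * y j b =
      if a = b then y m a else 0 := by
    intro a ha
    simp only [mul_assoc, ← Finset.mul_sum]
    rw [hB.left a (Finset.mem_range.mp ha) b hb, mul_ite, mul_one, mul_zero]
  rw [Finset.sum_congr rfl this, Finset.sum_ite_eq', if_pos (Finset.mem_range.mpr hb)]

omit [Algebra ℂ R] in
lemma IsBlockInv.sum_block_mul (hB : IsBlockInv m y B) {i : ℕ} (hi : i < m) :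
    ∑ a ∈ Finset.range m, ∑ j ∈ Finset.range m, y i a * B a j * y j m = y i m := by
  rw [Finset.sum_comm]
  have : ∀ j ∈ Finset.range m, ∑ a ∈ Finset.range m, y i a * B a j * y j m =
      if i = j then y j m else 0 := by
    intro j hj
    rw [← Finset.sum_mul, hB.right i hi j (Finset.mem_range.mp hj), ite_mul, one_mul, zero_mul]
  rw [Finset.sum_congr rfl this, Finset.sum_ite_eq, if_pos (Finset.mem_range.mpr hi)]

omit [Algebra ℂ R] in
/-- The Schur complement is the inverse of the corner entry of the inverse of the next block. -/
lemma IsBlockInv.schur_mul_corner {B' : ℕ → ℕ → R} (hB : IsBlockInv m y B)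
    (hB' : IsBlockInv (m + 1) y B') : schur m y B * B' m m = 1 := by
  obtain ⟨w, hw, hwy⟩ := exists_schur_row m y B
  have h1 : ∑ b ∈ Finset.range (m + 1), (∑ j ∈ Finset.range (m + 1), w j * y j b) * B' b m =
      schur m y B * B' m m := by
    rw [Finset.sum_range_succ, Finset.sum_eq_zero, zero_add, hwy]
    · rfl
    · intro b hb
      rw [hwy, hB.sum_mul_block (Finset.mem_range.mp hb), sub_self, zero_mul]
  rw [← h1]
  simp only [Finset.sum_mul, mul_assoc]
  rw [Finset.sum_comm]
  have : ∀ j ∈ Finset.range (m + 1), ∑ b ∈ Finset.range (m + 1), w j * (y j b * B' b m) =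
      if j = m then w j else 0 := by
    intro j hj
    rw [← Finset.mul_sum, hB'.right j (Finset.mem_range.mp hj) m (by omega), mul_ite, mul_one,
      mul_zero]
  rw [Finset.sum_congr rfl this, Finset.sum_ite_eq', if_pos (Finset.mem_range.mpr (by omega)), hw]

omit [Algebra ℂ R] in
lemma IsBlockInv.corner_mul_schur {B' : ℕ → ℕ → R} (hB : IsBlockInv m y B)
    (hB' : IsBlockInv (m + 1) y B') : B' m m * schur m y B = 1 := by
  set w : ℕ → R := fun j => if j < m then -∑ b ∈ Finset.range m, B j b * y b m else 1 with hw
  have hwy : ∀ i, ∑ j ∈ Finset.range (m + 1), y i j * w j =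
      y i m - ∑ a ∈ Finset.range m, ∑ j ∈ Finset.range m, y i a * B a j * y j m := by
    intro i
    simp only [Finset.sum_range_succ _ m, hw, if_neg (lt_irrefl m), mul_one]
    rw [sub_eq_add_neg, add_comm]
    congr 1
    rw [← Finset.sum_neg_distrib]
    refine Finset.sum_congr rfl fun j hj => ?_
    rw [if_pos (Finset.mem_range.mp hj), mul_neg, Finset.mul_sum]
    simp only [mul_assoc]
  have h1 : ∑ i ∈ Finset.range (m + 1), B' m i * (∑ j ∈ Finset.range (m + 1), y i j * w j) =
      B' m m * schur m y B := by
    rw [Finset.sum_range_succ, Finset.sum_eq_zero, zero_add, hwy]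
    · rfl
    · intro i hi
      rw [hwy, hB.sum_block_mul (Finset.mem_range.mp hi), sub_self, mul_zero]
  rw [← h1]
  simp only [Finset.mul_sum]
  rw [Finset.sum_comm]
  have : ∀ j ∈ Finset.range (m + 1), ∑ i ∈ Finset.range (m + 1), B' m i * (y i j * w j) =
      if m = j then w j else 0 := by
    intro j hj
    simp only [← mul_assoc]
    rw [← Finset.sum_mul, hB'.left m (by omega) j (Finset.mem_range.mp hj), ite_mul, one_mul,
      zero_mul]
  rw [Finset.sum_congr rfl this, Finset.sum_ite_eq, if_pos (Finset.mem_range.mpr (by omega)), hw]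
  simp

end SchurComplement

/-! ### The Gauss decomposition and the central series -/

section Scale

variable {A : Type*} [Ring A] [Algebra ℂ A]

/-- The substitution `u ↦ u c` as a ring homomorphism. -/
def scl (s : Sgn) (c : ℂ) : PowerSeries A →+* PowerSeries A := dil (c ^ s.toInt)

lemma scaleArg_eq_scl (s : Sgn) (c : ℂ) (f : PowerSeries A) : scaleArg s c f = scl s c f :=
  scaleArg_eq_dil s c f

lemma scl_scl (s : Sgn) (c c' : ℂ) (f : PowerSeries A) : scl s c (scl s c' f) = scl s (c * c') f := by
  rw [scl, scl, scl, dil_dil, mul_zpow]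

lemma scl_one (s : Sgn) (f : PowerSeries A) : scl s 1 f = f := by
  rw [scl, one_zpow, dil_one]

end Scale

section Gauss

variable {A : Type*} [Ring A] [Algebra ℂ A]

/-- A matrix of series with the R-matrix relations of type `A` between the entries `(i, j)` and
`(a, b)` with `i + j` and `a + b` below the antidiagonal, together with the inverses `B k` of its
leading `k × k` blocks. -/
structure GaussData (s : Sgn) (q : ℂ) (N M : ℕ) (x : ℕ → ℕ → PowerSeries A)
    (B : ℕ → ℕ → ℕ → PowerSeries A) : Prop where
  inv : ∀ k ≤ M, IsBlockInv k x (B k)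
  rel : ∀ c : ℂ, c ≠ 0 → ∀ i j a b, i + j + 1 < N → a + b + 1 < N →
    TypeARel q c x (fun i j => scl s c (x i j)) i j a b
  unit : ∀ k ≤ M, 0 < k → IsUnit (rowScalar q k x fun i j => scl s (q ^ (2 * k)) (B k i j))

lemma IsBlockInv.scl {k : ℕ} {x B : ℕ → ℕ → PowerSeries A} (h : IsBlockInv k x B) (s : Sgn)
    (c : ℂ) : IsBlockInv k (fun i j => scl s c (x i j)) (fun i j => QAff.scl s c (B i j)) where
  left g hg l hl := by
    simp only [← map_mul, ← map_sum]
    rw [h.left g hg l hl, apply_ite (QAff.scl s c), map_one, map_zero]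
  right g hg l hl := by
    simp only [← map_mul, ← map_sum]
    rw [h.right g hg l hl, apply_ite (QAff.scl s c), map_one, map_zero]

lemma schur_scl (s : Sgn) (c : ℂ) (k : ℕ) (x B : ℕ → ℕ → PowerSeries A) :
    schur k (fun i j => scl s c (x i j)) (fun i j => scl s c (B i j)) = scl s c (schur k x B) := by
  simp only [schur, map_sub, map_sum, map_mul]

/-- The product
`h_k(uq^{2k})⁻¹ ⋯ h_1(uq²)⁻¹ h_1(u) ⋯ h_k(uq^{2k-2})`. -/
def gaussProd (s : Sgn) (q : ℂ) (x : ℕ → ℕ → PowerSeries A) (B : ℕ → ℕ → ℕ → PowerSeries A) :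
    ℕ → PowerSeries A
  | 0 => 1
  | k + 1 => scl s (q ^ (2 * (k + 1))) (B (k + 1) k k) * gaussProd s q x B k *
      scl s (q ^ (2 * k)) (schur k x (B k))

variable {s : Sgn} {q : ℂ} {N M : ℕ} {x : ℕ → ℕ → PowerSeries A} {B : ℕ → ℕ → ℕ → PowerSeries A}

/-- The quasideterminant of the transposed block, in terms of the quasideterminants of the
original one. -/
lemma GaussData.row_mul_last (hG : GaussData s q N M x B) (hq0 : q ≠ 0)
    (hq : ∀ m : ℕ, 0 < m → q ^ m ≠ 1) {k : ℕ} (hN : 2 * k + 1 ≤ N) (hM : k ≤ M)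
    {t : ℕ → PowerSeries A}
    (ht : ∀ i < k, ∑ a ∈ Finset.range (k + 1), t a * x i a = 0) :
    ∑ a ∈ Finset.range (k + 1), t a * x k a =
      t k * (gaussProd s q x B k * scl s (q ^ (2 * k)) (schur k x (B k))) := by
  induction k generalizing t with
  | zero => simp [gaussProd, schur, scl_one]
  | succ k ih =>
    have hc := hq (2 * (k + 1)) (by omega)
    have hB := (hG.inv (k + 1) hM).scl s (q ^ (2 * (k + 1)))
    have hrel := hG.rel (q ^ (2 * (k + 1))) (pow_ne_zero _ hq0)
    have hcol := fun i hi => hB.col_relation hq0 hc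
      (fun i hi j hj a ha b hb => hrel i j a b (by omega) (by omega)) (i := i) (l := k) hi (by omega)
    have hp : colScalar q (k + 1) x (fun i j => QAff.scl s (q ^ (2 * (k + 1))) (B (k + 1) i j)) =
        gaussProd s q x B (k + 1) := by
      have h1 := ih (by omega) (by omega)
        (t := fun a => q ^ (2 * a) • QAff.scl s (q ^ (2 * (k + 1))) (B (k + 1) a k))
        (fun i hi => by
          simp only [smul_mul_assoc]
          rw [hcol i (by omega), if_neg hi.ne])
      simp only [smul_mul_assoc] at h1
      rw [hcol k (by omega), if_pos rfl] at h1
      rw [smul_right_injective _ (pow_ne_zero (2 * k) hq0) h1, gaussProd, mul_assoc]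
    have h2 := hB.row_mul_last hq0 hc (fun i hi j hj a ha b hb hij hab =>
      hrel i j a b (by omega) (by omega)) (hG.unit (k + 1) hM (by omega)) ht
    rw [h2, hp, schur_scl]

/-- The formula for a series `z` defined by the relation
`∑_l η_l l_{jl'}(u) l_{il}(uξ) = δ_{ij'} η_i z`: a row operation which clears the row `n` of `L(u)` to
the left of the diagonal reduces the left-hand side to the indices `l ≤ m`, and `row_mul_last`
evaluates what remains. -/
lemma GaussData.contraction (hG : GaussData s q N M x B) (hq0 : q ≠ 0)
    (hq : ∀ m : ℕ, 0 < m → q ^ m ≠ 1) {n m : ℕ} (hnm : n + m + 1 = N) (hmn : m ≤ n) (hM : n ≤ M)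
    {ξ : ℂ} (hξ : ξ ≠ 0) {e : ℕ → ℂ} (he : ∀ i < N, e i ≠ 0) {z : PowerSeries A}
    (hz : ∀ i < N, ∀ j < N, ∑ a ∈ Finset.range N, e a • (x j (N - 1 - a) * scl s ξ (x i a)) =
      if i + j + 1 = N then e i • z else 0) :
    z = schur n x (B n) * (scl s ξ (gaussProd s q x B m) *
      scl s (ξ * q ^ (2 * m)) (schur m x (B m))) := by
  obtain ⟨w, hw, hwx⟩ := exists_schur_row n x (B n)
  have hwn : ∑ j ∈ Finset.range (n + 1), w j * x j n = schur n x (B n) := hwx n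
  have hwl : ∀ l < n, ∑ j ∈ Finset.range (n + 1), w j * x j l = 0 := fun l hl => by
    rw [hwx, (hG.inv n hM).sum_mul_block hl, sub_self]
  have key : ∀ i ≤ m, ∑ a ∈ Finset.range (m + 1),
      (e a • ∑ j ∈ Finset.range (n + 1), w j * x j (N - 1 - a)) * scl s ξ (x i a) =
      if i = m then e m • z else 0 := by
    intro i hi
    have h1 : ∑ j ∈ Finset.range (n + 1), w j * ∑ a ∈ Finset.range N,
        e a • (x j (N - 1 - a) * scl s ξ (x i a)) = if i = m then e m • z else 0 := by
      have : ∀ j ∈ Finset.range (n + 1), w j * ∑ a ∈ Finset.range N,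
          e a • (x j (N - 1 - a) * scl s ξ (x i a)) =
          if i = m then (if j = n then e m • (w j * z) else 0) else 0 := by
        intro j hj
        have hj' := Finset.mem_range.mp hj
        rw [hz i (by omega) j (by omega)]
        by_cases him : i = m
        · subst him
          by_cases hjn : j = n
          · rw [if_pos (by omega), if_pos rfl, if_pos hjn, mul_smul_comm]
          · rw [if_neg (by omega), if_pos rfl, if_neg hjn, mul_zero]
        · rw [if_neg (by omega), if_neg him, mul_zero]
      rw [Finset.sum_congr rfl this]
      by_cases him : i = m
      · simp only [if_pos him, Finset.sum_ite_eq', Finset.mem_range, Nat.lt_succ_self, if_true, hw,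
          one_mul]
      · simp only [if_neg him, Finset.sum_const_zero]
    rw [← h1]
    simp only [Finset.mul_sum, mul_smul_comm]
    rw [Finset.sum_comm]
    have h2 : ∀ a, ∑ j ∈ Finset.range (n + 1),
        e a • (w j * (x j (N - 1 - a) * scl s ξ (x i a))) =
        (e a • ∑ j ∈ Finset.range (n + 1), w j * x j (N - 1 - a)) * scl s ξ (x i a) := fun a => by
      rw [smul_mul_assoc, Finset.sum_mul, Finset.smul_sum]
      simp only [mul_assoc]
    simp only [h2]
    refine Finset.sum_subset (fun a ha => ?_) fun a ha ha' => ?_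
    · have := Finset.mem_range.mp ha
      exact Finset.mem_range.mpr (by omega)
    · have h3 := Finset.mem_range.mp ha
      have h4 : ¬ a < m + 1 := fun h => ha' (Finset.mem_range.mpr h)
      rw [hwl _ (by omega), smul_zero, zero_mul]
  have hinv : ∀ f : PowerSeries A, scl s ξ (scl s ξ⁻¹ f) = f := fun f => by
    rw [scl_scl, mul_inv_cancel₀ hξ, scl_one]
  have hinv' : ∀ f : PowerSeries A, scl s ξ⁻¹ (scl s ξ f) = f := fun f => by
    rw [scl_scl, inv_mul_cancel₀ hξ, scl_one]
  have h5 := hG.row_mul_last hq0 hq (k := m) (by omega) (by omega)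
    (t := fun a => scl s ξ⁻¹ (e a • ∑ j ∈ Finset.range (n + 1), w j * x j (N - 1 - a)))
    (fun i hi => by
      have := congrArg (scl s ξ⁻¹) (key i hi.le)
      rw [if_neg hi.ne, map_zero, map_sum] at this
      simpa only [map_mul, hinv'] using this)
  have h6 := congrArg (scl s ξ) h5
  simp only [map_sum, map_mul, hinv, scl_scl] at h6
  rw [key m le_rfl, if_pos rfl, show N - 1 - m = n by omega, hwn, smul_mul_assoc] at h6
  exact smul_right_injective _ (he m (by omega)) h6

/-! #### Commutation of the Gaussian generators -/

lemma IsBlockInv.commute {R : Type*} [Ring R] {k : ℕ} {y C : ℕ → ℕ → R} (h : IsBlockInv k y C)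
    {g : R} (hg : ∀ i < k, ∀ j < k, Commute g (y i j)) {i j : ℕ} (hi : i < k) (hj : j < k) :
    Commute g (C i j) := by
  have h1 : ∑ l ∈ Finset.range k, (∑ r ∈ Finset.range k, C i r * y r l) * (g * C l j) = g * C i j := by
    have : ∀ l ∈ Finset.range k, (∑ r ∈ Finset.range k, C i r * y r l) * (g * C l j) =
        if i = l then g * C l j else 0 := fun l hl => by
      rw [h.left i hi l (Finset.mem_range.mp hl), ite_mul, one_mul, zero_mul]
    rw [Finset.sum_congr rfl this, Finset.sum_ite_eq, if_pos (Finset.mem_range.mpr hi)]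
  have h2 : ∑ r ∈ Finset.range k, C i r * g * (∑ l ∈ Finset.range k, y r l * C l j) = C i j * g := by
    have : ∀ r ∈ Finset.range k, C i r * g * (∑ l ∈ Finset.range k, y r l * C l j) =
        if r = j then C i r * g else 0 := fun r hr => by
      rw [h.right r (Finset.mem_range.mp hr) j hj, mul_ite, mul_one, mul_zero]
    rw [Finset.sum_congr rfl this, Finset.sum_ite_eq', if_pos (Finset.mem_range.mpr hj)]
  rw [Commute, SemiconjBy, ← h1, ← h2]
  simp only [Finset.sum_mul, Finset.mul_sum]
  rw [Finset.sum_comm]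
  refine Finset.sum_congr rfl fun r hr => Finset.sum_congr rfl fun l hl => ?_
  have := (hg r (Finset.mem_range.mp hr) l (Finset.mem_range.mp hl)).eq
  simp only [mul_assoc]
  rw [← mul_assoc g, this, mul_assoc]

lemma GaussData.schur_commute_schur (hG : GaussData s q N M x B) {c c' : ℂ} (hc : c ≠ 0)
    (hc' : c' ≠ 0) (hcc' : c ≠ c') {k j : ℕ} (hN : 2 * k + 1 ≤ N) (hM : k ≤ M) (hjk : j < k) :
    Commute (scl s c (schur k x (B k))) (scl s c' (schur j x (B j))) := by
  have hd : c'⁻¹ * c ≠ 1 := fun h => hcc' (by field_simp at h; exact h)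
  have h1 : ∀ i < k, ∀ a < k, Commute (scl s (c'⁻¹ * c) (schur k x (B k))) (x i a) := by
    intro i hi a ha
    have := ((hG.inv k hM).scl s (c'⁻¹ * c)).schur_commute hd (fun i hi j hj a ha b hb =>
      hG.rel _ (mul_ne_zero (inv_ne_zero hc') hc) i j a b (by omega) (by omega)) hi ha
    rwa [schur_scl] at this
  have h2 : Commute (scl s (c'⁻¹ * c) (schur k x (B k))) (schur j x (B j)) := by
    unfold schur at h1 ⊢
    refine (h1 j hjk j hjk).sub_right (Commute.sum_right _ _ _ fun a ha => Commute.sum_right _ _ _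
      fun b hb => ?_)
    have ha' := Finset.mem_range.mp ha
    have hb' := Finset.mem_range.mp hb
    exact ((h1 j hjk a (by omega)).mul_right ((hG.inv j (by omega)).commute
      (fun i hi a ha => h1 i (by omega) a (by omega)) ha' hb')).mul_right (h1 b (by omega) j hjk)
  have h3 := h2.map (scl s c')
  rwa [scl_scl, mul_inv_cancel_left₀ hc'] at h3

lemma commute_of_mul_eq_one {R : Type*} [Monoid R] {g a b : R} (h : a * b = 1) (h' : b * a = 1)
    (hg : Commute g a) : Commute g b := by
  have : g * b = b * g := by
    calc g * b = b * a * (g * b) := by rw [h', one_mul]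
      _ = b * (g * a) * b := by rw [hg.eq]; simp only [mul_assoc]
      _ = b * g := by simp only [mul_assoc]; rw [h, mul_one]
  exact this

lemma GaussData.schur_mul_corner (hG : GaussData s q N M x B) (c : ℂ) {k : ℕ} (hM : k + 1 ≤ M) :
    scl s c (schur k x (B k)) * scl s c (B (k + 1) k k) = 1 ∧
      scl s c (B (k + 1) k k) * scl s c (schur k x (B k)) = 1 := by
  have hB := hG.inv k (by omega)
  have hB' := hG.inv (k + 1) hM
  rw [← map_mul, ← map_mul, hB.schur_mul_corner hB', hB.corner_mul_schur hB', map_one]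
  exact ⟨rfl, rfl⟩

lemma GaussData.ringInverse (hG : GaussData s q N M x B) (c : ℂ) {k : ℕ} (hM : k + 1 ≤ M) :
    Ring.inverse (scl s c (schur k x (B k))) = scl s c (B (k + 1) k k) := by
  obtain ⟨h1, h2⟩ := hG.schur_mul_corner c hM
  exact Ring.inverse_unit (⟨_, _, h1, h2⟩ : (PowerSeries A)ˣ)

/-- The commutation of the Gaussian generators allows to rearrange the product. -/
lemma GaussData.scl_gaussProd (hG : GaussData s q N M x B) (hq0 : q ≠ 0)
    (hq : ∀ m : ℕ, 0 < m → q ^ m ≠ 1) {ξ : ℂ} (hξ : ξ ≠ 0) {k : ℕ} (hN : 2 * k ≤ N + 1)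
    (hM : k ≤ M) :
    scl s ξ (gaussProd s q x B k) =
      ((List.range k).map fun i => scl s (ξ * q ^ (2 * (i + 1))) (B (i + 1) i i)).prod *
        ((List.range k).map fun i => scl s (ξ * q ^ (2 * i)) (schur i x (B i))).prod := by
  induction k with
  | zero => simp [gaussProd]
  | succ k ih =>
    rw [gaussProd, map_mul, map_mul, ih (by omega) (by omega), scl_scl, scl_scl, List.range_succ]
    simp only [List.map_append, List.prod_append, List.map_cons, List.map_nil, List.prod_cons,
      List.prod_nil, mul_one]
    have : Commute (scl s (ξ * q ^ (2 * (k + 1))) (B (k + 1) k k))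
        ((List.range k).map fun i => scl s (ξ * q ^ (2 * (i + 1))) (B (i + 1) i i)).prod := by
      refine Commute.list_prod_right _ _ fun f hf => ?_
      obtain ⟨i, hi, rfl⟩ := List.mem_map.mp hf
      have hi' := List.mem_range.mp hi
      have hne : ξ * q ^ (2 * (k + 1)) ≠ ξ * q ^ (2 * (i + 1)) := by
        intro h
        have h1 := mul_left_cancel₀ hξ h
        refine hq (2 * (k - i)) (by omega) ?_
        rw [show 2 * (k + 1) = 2 * (k - i) + 2 * (i + 1) by omega, pow_add] at h1
        exact mul_eq_right₀ (pow_ne_zero _ hq0) |>.mp h1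
      have h1 := hG.schur_commute_schur (mul_ne_zero hξ (pow_ne_zero _ hq0))
        (mul_ne_zero hξ (pow_ne_zero _ hq0)) hne (k := k) (j := i) (by omega) (by omega) hi'
      obtain ⟨a1, a2⟩ := hG.schur_mul_corner (ξ * q ^ (2 * (k + 1))) hM
      obtain ⟨b1, b2⟩ := hG.schur_mul_corner (ξ * q ^ (2 * (i + 1))) (k := i) (by omega)
      exact (commute_of_mul_eq_one a1 a2 (commute_of_mul_eq_one b1 b2 h1).symm).symm
    rw [← mul_assoc, this.eq]
    simp only [mul_assoc]

/-- The last Gaussian generator commutes with the product at points where the arguments differ. -/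
lemma GaussData.schur_commute_gaussProd (hG : GaussData s q N M x B) (hq0 : q ≠ 0)
    {ξ : ℂ} (hξ : ξ ≠ 0) {n k : ℕ} (hkn : k ≤ n) (hN : 2 * n + 1 ≤ N) (hM : n ≤ M)
    (hne : ∀ i ≤ k, ξ * q ^ (2 * i) ≠ 1) :
    Commute (schur n x (B n)) (scl s ξ (gaussProd s q x B k)) := by
  induction k with
  | zero => simp [gaussProd]
  | succ k ih =>
    have h : ∀ i ≤ k + 1, Commute (schur n x (B n)) (scl s (ξ * q ^ (2 * i)) (schur k x (B k))) := by
      intro i hi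
      have := hG.schur_commute_schur one_ne_zero (mul_ne_zero hξ (pow_ne_zero _ hq0))
        (hne i hi).symm (k := n) (j := k) hN hM (by omega)
      rwa [scl_one] at this
    rw [gaussProd, map_mul, map_mul, scl_scl, scl_scl]
    obtain ⟨a1, a2⟩ := hG.schur_mul_corner (ξ * q ^ (2 * (k + 1))) (k := k) (by omega)
    exact ((commute_of_mul_eq_one a1 a2 (h (k + 1) le_rfl)).mul_right
      (ih (by omega) fun i hi => hne i (by omega))).mul_right (h k (by omega))

end Gauss

/-! ### The product formula for the central series -/

section Blocks

variable {R : Type*} [Ring R]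

/-- A finite matrix as a function on pairs of natural numbers. -/
def natExt {N : ℕ} (L : Matrix (Fin N) (Fin N) R) (i j : ℕ) : R :=
  if h : i < N ∧ j < N then L ⟨i, h.1⟩ ⟨j, h.2⟩ else 0

lemma natExt_val {N : ℕ} (L : Matrix (Fin N) (Fin N) R) (i j : Fin N) :
    natExt L i.val j.val = L i j := by simp [natExt]

/-- The inverse of the leading `k × k` block. -/
def blockInv (x : ℕ → ℕ → R) (k : ℕ) (i j : ℕ) : R :=
  if h : i < k ∧ j < k then
    Ring.inverse (Matrix.of fun a b : Fin k => x a b) ⟨i, h.1⟩ ⟨j, h.2⟩ else 0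

lemma isBlockInv_iff {k : ℕ} {x B : ℕ → ℕ → R} : IsBlockInv k x B ↔
    (Matrix.of fun a b : Fin k => B a b) * (Matrix.of fun a b : Fin k => x a b) = 1 ∧
    (Matrix.of fun a b : Fin k => x a b) * (Matrix.of fun a b : Fin k => B a b) = 1 := by
  constructor
  · intro h
    constructor
    · ext a b
      rw [Matrix.mul_apply, Matrix.one_apply]
      simpa [Fin.ext_iff, Fin.sum_univ_eq_sum_range (fun j => B a j * x j b)] using
        h.left a a.2 b b.2
    · ext a b
      rw [Matrix.mul_apply, Matrix.one_apply]
      simpa [Fin.ext_iff, Fin.sum_univ_eq_sum_range (fun j => x a j * B j b)] using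
        h.right a a.2 b b.2
  · rintro ⟨h1, h2⟩
    constructor
    · intro g hg l hl
      have := congrFun (congrFun h1 ⟨g, hg⟩) ⟨l, hl⟩
      rw [Matrix.mul_apply, Matrix.one_apply] at this
      simpa [Fin.ext_iff, Fin.sum_univ_eq_sum_range (fun j => B g j * x j l)] using this
    · intro g hg l hl
      have := congrFun (congrFun h2 ⟨g, hg⟩) ⟨l, hl⟩
      rw [Matrix.mul_apply, Matrix.one_apply] at this
      simpa [Fin.ext_iff, Fin.sum_univ_eq_sum_range (fun j => x g j * B j l)] using this

lemma isBlockInv_blockInv {k : ℕ} {x : ℕ → ℕ → R}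
    (h : IsUnit (Matrix.of fun a b : Fin k => x a b)) : IsBlockInv k x (blockInv x k) := by
  have e : (Matrix.of fun a b : Fin k => blockInv x k a b) =
      Ring.inverse (Matrix.of fun a b : Fin k => x a b) := by
    ext a b
    simp [blockInv]
  rw [isBlockInv_iff, e]
  exact ⟨Ring.inverse_mul_cancel _ h, Ring.mul_inverse_cancel _ h⟩

lemma sum_subtype_lt {N : ℕ} (i : Fin N) (f : ℕ → R) :
    ∑ a : {a : Fin N // a < i}, f a.val.val = ∑ a ∈ Finset.range i.val, f a := by
  refine Finset.sum_bij (fun a _ => a.val.val) (fun a _ => Finset.mem_range.mpr a.2) ?_ ?_ ?_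
  · intro a _ b _ h
    exact Subtype.ext (Fin.ext h)
  · intro b hb
    have := Finset.mem_range.mp hb
    exact ⟨⟨⟨b, by omega⟩, this⟩, Finset.mem_univ _, rfl⟩
  · intro a _
    rfl

lemma quasiDet_eq_schur {N : ℕ} (L : Matrix (Fin N) (Fin N) R) (i : Fin N) {B : ℕ → ℕ → R}
    (hB : IsBlockInv i.val (natExt L) B) : quasiDet L i = schur i.val (natExt L) B := by
  have hinv : Ring.inverse (L.submatrix (fun x : {a : Fin N // a < i} => x.val)
      (fun x : {a : Fin N // a < i} => x.val)) =
      Matrix.of fun a b : {a : Fin N // a < i} => B a.val.val b.val.val := by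
    have h1 : (L.submatrix (fun x : {a : Fin N // a < i} => x.val)
      (fun x : {a : Fin N // a < i} => x.val)) *
      (Matrix.of fun a b : {a : Fin N // a < i} => B a.val.val b.val.val) = 1 := by
      ext a b
      rw [Matrix.mul_apply, Matrix.one_apply]
      have := hB.right a.val.val a.2 b.val.val b.2
      rw [← sum_subtype_lt i] at this
      simpa [natExt_val, Subtype.ext_iff, Fin.ext_iff] using this
    have h2 : (Matrix.of fun a b : {a : Fin N // a < i} => B a.val.val b.val.val) *
        (L.submatrix (fun x : {a : Fin N // a < i} => x.val)
      (fun x : {a : Fin N // a < i} => x.val)) = 1 := by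
      ext a b
      rw [Matrix.mul_apply, Matrix.one_apply]
      have := hB.left a.val.val a.2 b.val.val b.2
      rw [← sum_subtype_lt i] at this
      simpa [natExt_val, Subtype.ext_iff, Fin.ext_iff] using this
    exact Ring.inverse_unit (⟨_, _, h1, h2⟩ : (Matrix _ _ R)ˣ)
  unfold quasiDet schur
  rw [hinv, natExt_val, ← sum_subtype_lt i]
  congr 1
  refine Finset.sum_congr rfl fun a _ => ?_
  rw [← sum_subtype_lt i (fun b => natExt L i.val a.val.val * B a.val.val b * natExt L b i.val)]
  simp only [natExt_val, Matrix.of_apply]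

end Blocks

section Triangular

variable {A : Type*} [Ring A] [Algebra ℂ A] {N : ℕ}

/-- The positions of the zeros of the constant term of `L^±(u)`. -/
def Sgn.isZeroAt (s : Sgn) (i j : ℕ) : Prop :=
  match s with
  | .plus => i < j
  | .minus => j < i

/-- A rank function on the indices below `k` for which the constant term is triangular. -/
def Sgn.rank (s : Sgn) (k i : ℕ) : ℕ :=
  match s with
  | .plus => i
  | .minus => k - i

lemma Sgn.rank_injective (s : Sgn) (k : ℕ) :
    Function.Injective fun i : Fin k => s.rank k i.val := by
  intro i j h
  cases s <;> simp only [Sgn.rank] at h <;> omega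

lemma Sgn.rank_lt (s : Sgn) {k i j : ℕ} (h : s.rank k i < s.rank k j) : s.isZeroAt i j := by
  cases s <;> simp only [Sgn.rank, Sgn.isZeroAt] at h ⊢ <;> omega

/-- The constant term is triangular with invertible diagonal entries. -/
structure IsTriangularAtZero (s : Sgn) (L : Matrix (Fin N) (Fin N) (PowerSeries A)) : Prop where
  zero : ∀ i j : Fin N, s.isZeroAt i.val j.val → PowerSeries.coeff 0 (L i j) = 0
  unit : ∀ i, IsUnit (PowerSeries.coeff 0 (L i i))

variable {s : Sgn} {L : Matrix (Fin N) (Fin N) (PowerSeries A)}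

omit [Algebra ℂ A] in
lemma IsTriangularAtZero.constant (h : IsTriangularAtZero s L) {k : ℕ} (hk : k ≤ N) :
    let M := (Matrix.of fun a b : Fin k => natExt L a b).map (PowerSeries.coeff 0)
    (∀ i j : Fin k, s.rank k i.val < s.rank k j.val → M i j = 0) ∧ ∀ i, IsUnit (M i i) := by
  have e : ∀ i j : Fin k, natExt L i j = L ⟨i, by omega⟩ ⟨j, by omega⟩ := fun i j => by
    rw [natExt, dif_pos ⟨by omega, by omega⟩]
  refine ⟨fun i j hij => ?_, fun i => ?_⟩
  · simp only [Matrix.map_apply, Matrix.of_apply, e]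
    exact h.zero _ _ (s.rank_lt hij)
  · simp only [Matrix.map_apply, Matrix.of_apply, e]
    exact h.unit _

omit [Algebra ℂ A] in
lemma IsTriangularAtZero.isUnit_block (h : IsTriangularAtZero s L) {k : ℕ} (hk : k ≤ N) :
    IsUnit (Matrix.of fun a b : Fin k => natExt L a b) :=
  isUnit_of_isUnit_constantCoeff
    (isUnit_of_triangular (s.rank_injective k) (h.constant hk).1 (h.constant hk).2)

lemma constantCoeff_scl (s : Sgn) (c : ℂ) (f : PowerSeries A) :
    PowerSeries.constantCoeff (scl s c f) = PowerSeries.constantCoeff f := by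
  rw [← PowerSeries.coeff_zero_eq_constantCoeff_apply, scl, coeff_dil, pow_zero, one_smul,
    PowerSeries.coeff_zero_eq_constantCoeff_apply]

lemma IsTriangularAtZero.isUnit_rowScalar (h : IsTriangularAtZero s L) {k : ℕ} (hk : k ≤ N)
    (hpos : 0 < k) (q c : ℂ) :
    IsUnit (rowScalar q k (natExt L) fun i j => scl s c (blockInv (natExt L) k i j)) := by
  have hB := isBlockInv_iff.mp (isBlockInv_blockInv (h.isUnit_block hk))
  set M := Matrix.of fun a b : Fin k => natExt L a b
  set B := Matrix.of fun a b : Fin k => blockInv (natExt L) k a b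
  obtain ⟨t1, t2⟩ := h.constant hk
  change (∀ i j : Fin k, s.rank k i.val < s.rank k j.val → M.map (PowerSeries.coeff 0) i j = 0) at t1
  have hNM : B.map (PowerSeries.coeff 0) * M.map (PowerSeries.coeff 0) = 1 := by
    have := congrArg (fun X => X.map (PowerSeries.constantCoeff (R := A))) hB.1
    rw [← RingHom.mapMatrix_apply, ← RingHom.mapMatrix_apply, map_mul, map_one] at this
    simpa [← PowerSeries.coeff_zero_eq_constantCoeff] using this
  obtain ⟨t3, t4⟩ := left_inverse_triangular (s.rank_injective k) t1 t2 hNM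
  let o : Fin k := ⟨0, hpos⟩
  have hprod : ∀ i : Fin k, i ≠ o → PowerSeries.coeff 0 (M i o) * PowerSeries.coeff 0 (B o i) = 0 := by
    intro i hi
    have hi0 : 0 < i.val := Nat.pos_of_ne_zero fun h => hi (Fin.ext h)
    rcases Nat.lt_or_ge (s.rank k i.val) (s.rank k o.val) with hlt | hge
    · rw [show PowerSeries.coeff 0 (M i o) = 0 from t1 i o hlt, zero_mul]
    · have hne : s.rank k o.val ≠ s.rank k i.val := fun h => hi (s.rank_injective k h.symm)
      rw [show PowerSeries.coeff 0 (B o i) = 0 from t3 o i (lt_of_le_of_ne hge hne), mul_zero]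
  have h0 : PowerSeries.coeff 0 (rowScalar q k (natExt L)
      fun i j => scl s c (blockInv (natExt L) k i j)) =
      PowerSeries.coeff 0 (M o o) * PowerSeries.coeff 0 (B o o) := by
    rw [rowScalar, ← Fin.sum_univ_eq_sum_range
      (fun i => q⁻¹ ^ (2 * i) • (natExt L i 0 * scl s c (blockInv (natExt L) k 0 i))), map_sum,
      Finset.sum_eq_single o]
    · simp [M, B, o, constantCoeff_scl]
    · intro i _ hi
      have := hprod i hi
      simp only [M, B, o, Matrix.of_apply, PowerSeries.coeff_zero_eq_constantCoeff] at this
      simp [constantCoeff_scl, this]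
    · simp
  rw [PowerSeries.isUnit_iff_constantCoeff, ← PowerSeries.coeff_zero_eq_constantCoeff_apply, h0]
  obtain ⟨u, hu⟩ : IsUnit (PowerSeries.coeff 0 (M o o)) := t2 o
  have h4 : PowerSeries.coeff 0 (B o o) * u = 1 := by rw [hu]; exact t4 o
  have h5 : PowerSeries.coeff 0 (B o o) = ((u⁻¹ : Aˣ) : A) := (Units.mul_eq_one_iff_eq_inv).mp h4
  rw [← hu, h5]
  simp

end Triangular

section Relations

variable {T : ClassicalType} {n : ℕ} {q p : ℂ} {A : Type*} [Ring A] [Algebra ℂ A] {s : Sgn}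
  {L : Matrix (Idx T n) (Idx T n) (PowerSeries A)}

/-- Away from the antidiagonal the R-matrix relations are those of type `A`; the factor `u - ξ v`
has to be cancelled before the second variable is specialised. -/
lemma typeARel_of_RLL (hq0 : q ≠ 0)
    (h : RLL T n q p (parU s s) (parV s s) (L.map inU) (L.map inV)) {c : ℂ} (hc : c ≠ 0)
    {i j a b : ℕ} (hij : i + j + 1 < dimN T n) (hab : a + b + 1 < dimN T n) :
    TypeARel q c (natExt L) (fun i j => scl s c (natExt L i j)) i j a b := by
  obtain ⟨i', rfl⟩ : ∃ i' : Idx T n, i'.val = i := ⟨⟨i, by omega⟩, rfl⟩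
  obtain ⟨j', rfl⟩ : ∃ i' : Idx T n, i'.val = j := ⟨⟨j, by omega⟩, rfl⟩
  obtain ⟨a', rfl⟩ : ∃ i' : Idx T n, i'.val = a := ⟨⟨a, by omega⟩, rfl⟩
  obtain ⟨b', rfl⟩ : ∃ i' : Idx T n, i'.val = b := ⟨⟨b, by omega⟩, rfl⟩
  have hij' : ∀ k l : Idx T n, ¬ (i' = j'.rev ∧ k = l.rev) := fun k l h => by
    have := congrArg Fin.val h.1
    rw [Fin.val_rev] at this
    omega
  have hab' : ∀ k l : Idx T n, ¬ (k = l.rev ∧ a' = b'.rev) := fun k l h => by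
    have := congrArg Fin.val h.2
    rw [Fin.val_rev] at this
    omega
  have h0 := RLL_iff.mp h i' j' a' b'
  have hcomm : ∀ (k l : Idx T n) (f : Biv A),
      f * rho T n q p (parU s s) (parV s s) k l a' b' =
        rho T n q p (parU s s) (parV s s) k l a' b' * f := fun k l f =>
    (rho_commute (parU_commute s s f) (parV_commute s s f) k l a' b').eq.symm
  simp only [hcomm] at h0
  simp only [rho_eq (parU_commute s s (parV s s : Biv A)), hij', hab', if_false, sub_zero,
    mul_assoc, ← Finset.mul_sum] at h0
  rw [← sub_eq_zero, ← mul_sub] at h0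
  have h1 := eq_zero_of_linear_mul s s one_ne_zero (xi_ne_zero (T := T) (n := n) hq0)
    (by rwa [one_smul])
  have h2 := congrArg (diag (c ^ s.toInt)) h1
  have e : ∀ r : ℂ, ∀ f : PowerSeries A, (diagFactor s c * r) • (PowerSeries.X * f) =
      diagFactor s c • (PowerSeries.X * (r • f)) := fun r f => by
    rw [mul_smul, mul_smul_comm]
  simp only [map_sub, map_sum, map_zero, diag_linear_mul s hc, Matrix.map_apply, diag_inU_mul_inV,
    diag_inV_mul_inU, e, ← Finset.smul_sum, ← Finset.mul_sum] at h2
  rw [← smul_sub, ← mul_sub] at h2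
  have h3 := sub_eq_zero.mp (eq_zero_of_smul_X_mul (diagFactor_ne_zero s hc) h2)
  have ha : ∀ i j k l : Idx T n, aU q i j k l + aV q i j k l * c =
      (if i = k ∧ j = l then alph q 1 c i j else 0) +
        (if j = k ∧ i = l then bet q 1 c i j else 0) := fun i j k l => by
    rw [← a_eq, mul_one]
  simp only [ha, add_smul, Finset.sum_add_distrib, ite_smul, zero_smul, ite_and] at h3
  simp only [Finset.sum_ite_eq, Finset.sum_ite_eq', Finset.mem_univ, if_true,
    Finset.sum_ite_irrel, Finset.sum_const_zero] at h3
  have e1 : ∀ k l : Idx T n, alph q 1 c k.val l.val = alph q 1 c k l := fun k l => by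
    simp only [alph, Fin.ext_iff]
  have e2 : ∀ k l : Idx T n, bet q 1 c k.val l.val = bet q 1 c k l := fun k l => by
    simp only [bet, Fin.lt_def]
  unfold TypeARel
  simp only [natExt_val, e1, e2]
  exact h3

/-- The product of Gaussian generators in the definition of `z(u)` equals the series defined by the
R-matrix relation at `u = ξ v`. -/
lemma IsContraction.eq_zFormula (hn : T.minRank ≤ n) (hq0 : q ≠ 0)
    (hq : ∀ m : ℕ, 0 < m → q ^ m ≠ 1) (hp0 : p ≠ 0)
    (h : RLL T n q p (parU s s) (parV s s) (L.map inU) (L.map inV)) (ht : IsTriangularAtZero s L)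
    {z : PowerSeries A} (hz : IsContraction T n q p s L z) (hzc : ∀ f, Commute z f) :
    z = zFormula T n q s
      (fun i => if hi : i - 1 < dimN T n then quasiDet L ⟨i - 1, hi⟩ else 1) := by
  have hn1 := rank_pos hn
  have hξ := xi_ne_zero (T := T) (n := n) hq0
  have hdim : n + 1 ≤ dimN T n := by
    cases T <;> simp only [dimN] <;> omega
  set x := natExt L with hx
  set B := blockInv x with hB
  have hG : GaussData s q (dimN T n) (n + 1) x B :=
    { inv := fun k hk => isBlockInv_blockInv (ht.isUnit_block (by omega))
      rel := fun c hc i j a b hij hab => typeARel_of_RLL hq0 h hc hij hab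
      unit := fun k hk hpos => ht.isUnit_rowScalar (by omega) hpos q _ }
  have hH : ∀ k < n + 1, (if hi : k + 1 - 1 < dimN T n then quasiDet L ⟨k + 1 - 1, hi⟩ else 1) =
      schur k x (B k) := by
    intro k hk
    rw [dif_pos (by omega)]
    exact quasiDet_eq_schur L ⟨k, by omega⟩ (hG.inv k (by omega))
  have hdir : ∀ m ≤ n + 1, ((List.range m).map fun i => scaleArg s (xi T n q * q ^ (2 * i))
      (if hi : i + 1 - 1 < dimN T n then quasiDet L ⟨i + 1 - 1, hi⟩ else 1)) =
      (List.range m).map fun i => scl s (xi T n q * q ^ (2 * i)) (schur i x (B i)) := by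
    intro m hm
    refine List.map_congr_left fun i hi => ?_
    have := List.mem_range.mp hi
    rw [hH i (by omega), scaleArg_eq_scl]
  have hinv : ∀ m ≤ n, ((List.range m).map fun i => Ring.inverse (scaleArg s
      (xi T n q * q ^ (2 * (i + 1)))
      (if hi : i + 1 - 1 < dimN T n then quasiDet L ⟨i + 1 - 1, hi⟩ else 1))) =
      (List.range m).map fun i => scl s (xi T n q * q ^ (2 * (i + 1))) (B (i + 1) i i) := by
    intro m hm
    refine List.map_congr_left fun i hi => ?_
    have := List.mem_range.mp hi
    rw [hH i (by omega), scaleArg_eq_scl, hG.ringInverse _ (by omega)]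
  obtain ⟨e, he⟩ : ∃ e : ℕ → ℂ, ∀ a : Idx T n, e a.val = eta T n p a :=
    ⟨fun a => if h : a < dimN T n then eta T n p ⟨a, h⟩ else 1, fun a => by simp⟩
  have he0 : ∀ i < dimN T n, e i ≠ 0 := fun i hi => by
    rw [show i = (⟨i, hi⟩ : Idx T n).val from rfl, he]
    exact eta_ne_zero hp0 _
  have hcon : ∀ i < dimN T n, ∀ j < dimN T n, ∑ a ∈ Finset.range (dimN T n),
      e a • (x j (dimN T n - 1 - a) * scl s (xi T n q) (x i a)) =
      if i + j + 1 = dimN T n then e i • z else 0 := by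
    intro i hi j hj
    have h1 := hz.rows ⟨i, hi⟩ ⟨j, hj⟩
    rw [← Equiv.sum_comp Fin.revPerm] at h1
    rw [← Fin.sum_univ_eq_sum_range
      (fun a => e a • (x j (dimN T n - 1 - a) * scl s (xi T n q) (x i a)))]
    simp only [Fin.revPerm_apply, Fin.rev_rev] at h1
    convert h1 using 1
    · refine Finset.sum_congr rfl fun a _ => ?_
      have e1 : x j (dimN T n - 1 - a.val) = L ⟨j, hj⟩ a.rev := by
        rw [hx, ← natExt_val L ⟨j, hj⟩ a.rev, Fin.val_rev]
        exact congrArg (natExt L j) (by omega)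
      rw [he, e1, show x i a.val = L ⟨i, hi⟩ a from natExt_val L ⟨i, hi⟩ a]
      rfl
    · have e2 : (⟨i, hi⟩ : Idx T n) = Fin.rev ⟨j, hj⟩ ↔ i + j + 1 = dimN T n := by
        rw [Fin.ext_iff, Fin.val_rev]
        simp only
        omega
      simp only [e2]
      split_ifs with hij
      · rw [← e2.mpr hij, ← he]
      · rfl
  have hcm : ∀ k ≤ n, schur k x (B k) * B (k + 1) k k = 1 ∧ B (k + 1) k k * schur k x (B k) = 1 :=
    fun k hk => by simpa only [scl_one] using hG.schur_mul_corner 1 (k := k) (by omega)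
  have hCD : dimN T n = 2 * n → z =
      ((List.range (n - 1)).map fun i =>
        scl s (xi T n q * q ^ (2 * (i + 1))) (B (i + 1) i i)).prod *
      ((List.range n).map fun i => scl s (xi T n q * q ^ (2 * i)) (schur i x (B i))).prod *
      schur n x (B n) := by
    intro hd
    obtain ⟨m, rfl⟩ : ∃ m, n = m + 1 := ⟨n - 1, by omega⟩
    have h1 := hG.contraction hq0 hq (n := m + 1) (m := m) (by omega) (by omega)
      (by omega) hξ he0 hcon
    rw [hG.scl_gaussProd hq0 hq hξ (by omega) (by omega)] at h1
    obtain ⟨h3, h4⟩ := hcm (m + 1) le_rfl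
    rw [Nat.add_sub_cancel, List.range_succ, List.map_append, List.prod_append, List.map_singleton,
      List.prod_singleton, ← mul_assoc]
    -- `z` is central, so the factor `h_{n+1}` may be moved from the left to the right
    have h5 := congrArg (fun f => B (m + 1 + 1) (m + 1) (m + 1) * f) h1
    simp only [← mul_assoc, h4, one_mul] at h5
    rw [← h5, ← (hzc _).eq, mul_assoc, h4, mul_one]
  cases T with
  | B =>
    have hx1 : xi .B n q * q ^ (2 * n) = q := by
      simp only [xi, dimN]
      rw [← zpow_natCast, ← zpow_add₀ hq0, ← zpow_one q, ← zpow_mul]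
      congr 1
      push_cast
      ring
    have h1 := hG.contraction hq0 hq (n := n) (m := n) (by simp only [dimN]; omega) le_rfl (by omega)
      hξ he0 hcon
    -- so `h_{n+1}(u)` can be moved to the right, past the product at the points `ξ q^{2i} ≠ 1`
    have hne : ∀ i ≤ n, xi .B n q * q ^ (2 * i) ≠ 1 := by
      intro i hi h2
      simp only [xi, dimN] at h2
      rw [← zpow_natCast, ← zpow_add₀ hq0] at h2
      rcases lt_or_ge i n with hin | hin
      · refine hq (2 * n - 1 - 2 * i) (by omega) ?_
        have h3 : (2 : ℤ) - ((2 * n + 1 : ℕ) : ℤ) + ((2 * i : ℕ) : ℤ) =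
            -((2 * n - 1 - 2 * i : ℕ) : ℤ) := by omega
        rw [h3, zpow_neg, inv_eq_one, zpow_natCast] at h2
        exact h2
      · refine hq 1 one_pos ?_
        have h3 : (2 : ℤ) - ((2 * n + 1 : ℕ) : ℤ) + ((2 * i : ℕ) : ℤ) = ((1 : ℕ) : ℤ) := by omega
        rw [h3, zpow_natCast] at h2
        exact h2
    have h2 := hG.schur_commute_gaussProd hq0 hξ (n := n) (k := n) le_rfl
      (by simp only [dimN]; omega) (by omega) hne
    rw [hx1, ← mul_assoc, h2.eq, hG.scl_gaussProd hq0 hq hξ (by simp only [dimN]; omega)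
      (by omega)] at h1
    simp only [zFormula]
    rw [hdir n (by omega), hinv n le_rfl, hH n (by omega), scaleArg_eq_scl, ← mul_assoc]
    exact h1
  | C =>
    simp only [zFormula]
    rw [hdir n (by omega), hinv (n - 1) (by omega), hH n (by omega)]
    exact hCD rfl
  | D =>
    simp only [zFormula]
    rw [hdir n (by omega), hinv (n - 1) (by omega), hH n (by omega)]
    exact hCD rfl

end Relations

/-! ### Homomorphisms from the extended quantum affine algebra -/

section Opposite

variable {T : ClassicalType} {n : ℕ} {q p : ℂ}

/-- The relation satisfied by the inverse matrices is the R-matrix relation in the opposite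
algebra. -/
lemma RLL.inv_op {B : Type*} [Ring B] [Algebra ℂ B] {U V : B} (hU : ∀ x, Commute U x)
    (hV : ∀ x, Commute V x) {P P' N N' : Matrix (Idx T n) (Idx T n) B}
    (h : RLL T n q p U V P P') (hP : P * N = 1) (hP' : P' * N' = 1) (hN : N * P = 1)
    (hN' : N' * P' = 1) :
    RLL T n q p (MulOpposite.op U) (MulOpposite.op V) (N.map MulOpposite.op)
      (N'.map MulOpposite.op) := by
  have hi := h.inv hP hP' hN hN'
  have hc : ∀ i j k l x, rho T n q p U V i j k l * x = x * rho T n q p U V i j k l :=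
    fun i j k l x => (rho_commute (hU x) (hV x) i j k l).eq
  rw [RLL_iff]
  intro i j a b
  have hl : (leg1 N * leg2 N' * RMat T n q p U V) i a j b =
      ∑ k, ∑ l, N i k * (N' j l * rho T n q p U V k l a b) := by
    rw [mul_assoc]
    simp only [leg1_mul_apply, leg2_mul_apply, Finset.mul_sum]
    rfl
  have hr : (RMat T n q p U V * leg2 N' * leg1 N) i a j b =
      ∑ k, ∑ l, rho T n q p U V i j k l * N' l b * N k a := by
    simp only [mul_leg1_apply, mul_leg2_apply, Finset.sum_mul]
    rfl
  have h1 := congrArg MulOpposite.op (congrFun (congrFun (congrFun (congrFun hi i) a) j) b)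
  rw [hl, hr] at h1
  simp only [Matrix.map_apply, rho_op hU, ← MulOpposite.op_mul, ← op_sum]
  simp only [hc, mul_assoc] at h1 ⊢
  exact h1.symm

/-- A series over an algebra as a series over the opposite algebra. -/
def opSeries {A : Type*} [Ring A] : (PowerSeries A)ᵐᵒᵖ →+* PowerSeries Aᵐᵒᵖ where
  toFun f := PowerSeries.mk fun m => MulOpposite.op (PowerSeries.coeff m f.unop)
  map_one' := by
    ext m
    simp only [PowerSeries.coeff_mk, MulOpposite.unop_one, PowerSeries.coeff_one]
    split_ifs <;> rfl
  map_zero' := by ext m; simp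
  map_add' f g := by ext m; simp
  map_mul' f g := by
    ext m
    simp only [PowerSeries.coeff_mk, MulOpposite.unop_mul, PowerSeries.coeff_mul, op_sum,
      MulOpposite.op_mul]
    rw [← Finset.Nat.sum_antidiagonal_swap]
    rfl

lemma coeff_opSeries {A : Type*} [Ring A] (m : ℕ) (f : (PowerSeries A)ᵐᵒᵖ) :
    PowerSeries.coeff m (opSeries f) = MulOpposite.op (PowerSeries.coeff m f.unop) := by
  simp [opSeries]

/-- The relation for the inverse matrices, as a relation over the series in two variables. -/
lemma RLL.inv_opSeries {A : Type*} [Ring A] [Algebra ℂ A] {s s' : Sgn}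
    {L L' N N' : Matrix (Idx T n) (Idx T n) (PowerSeries A)}
    (h : RLL T n q p (parU s s') (parV s s') (L.map inU) (L'.map inV)) (hP : L * N = 1)
    (hP' : L' * N' = 1) (hN : N * L = 1) (hN' : N' * L' = 1) :
    RLL T n q p (parU s s') (parV s s')
      ((N.map fun f => opSeries (MulOpposite.op f)).map inU)
      ((N'.map fun f => opSeries (MulOpposite.op f)).map inV) := by
  let φ : (Biv A)ᵐᵒᵖ →+* Biv Aᵐᵒᵖ := (PowerSeries.map opSeries).comp opSeries
  have hφ : ∀ f d c, coeff₂ c d (φ f) = MulOpposite.op (coeff₂ c d f.unop) := fun f c d => by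
    simp [φ, coeff₂, coeff_opSeries]
  have e1 : ∀ f : PowerSeries A, φ (MulOpposite.op (inU f)) = inU (opSeries (MulOpposite.op f)) :=
    fun f => biv_ext fun c d => by
      rw [hφ]
      simp only [coeff₂, inU, PowerSeries.coeff_C, MulOpposite.unop_op]
      split_ifs <;> simp [coeff_opSeries]
  have e2 : ∀ f : PowerSeries A, φ (MulOpposite.op (inV f)) = inV (opSeries (MulOpposite.op f)) :=
    fun f => biv_ext fun c d => by
      rw [hφ]
      simp only [coeff₂, inV, PowerSeries.coeff_map, PowerSeries.coeff_C, MulOpposite.unop_op,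
        coeff_opSeries]
      split_ifs <;> simp
  have eU : φ (MulOpposite.op varU) = varU := by
    rw [show (varU : Biv A) = inU PowerSeries.X from rfl, e1]
    refine congrArg inU (PowerSeries.ext fun m => ?_)
    simp only [coeff_opSeries, MulOpposite.unop_op, PowerSeries.coeff_X]
    split_ifs <;> simp
  have eV : φ (MulOpposite.op varV) = varV := by
    refine biv_ext fun c d => ?_
    rw [hφ]
    simp only [coeff₂, varV, MulOpposite.unop_op, PowerSeries.coeff_X]
    split_ifs <;> simp [PowerSeries.coeff_one]
    split_ifs <;> simp
  have e3 : φ (MulOpposite.op (parU s s')) = parU s s' := by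
    cases s <;> cases s' <;> simp [parU, eU, eV, (varV_commute _).eq]
  have e4 : φ (MulOpposite.op (parV s s')) = parV s s' := by
    cases s <;> cases s' <;> simp [parV, eU, eV, (varV_commute _).eq]
  have m1 : ∀ {X Y : Matrix (Idx T n) (Idx T n) (PowerSeries A)}, X * Y = 1 →
      X.map inU * Y.map inU = (1 : Matrix _ _ (Biv A)) := fun {X Y} h => by
    rw [← RingHom.mapMatrix_apply, ← RingHom.mapMatrix_apply, ← map_mul, h, map_one]
  have m2 : ∀ {X Y : Matrix (Idx T n) (Idx T n) (PowerSeries A)}, X * Y = 1 →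
      X.map inV * Y.map inV = (1 : Matrix _ _ (Biv A)) := fun {X Y} h => by
    rw [← RingHom.mapMatrix_apply, ← RingHom.mapMatrix_apply, ← map_mul, h, map_one]
  have h1 := (h.inv_op (parU_commute s s') (parV_commute s s') (m1 hP) (m2 hP') (m1 hN)
    (m2 hN')).map φ fun r f => by
      refine biv_ext fun c d => ?_
      simp [hφ]
  rw [e3, e4] at h1
  convert h1 using 1
  · ext i j : 2
    simp [e1]
  · ext i j : 2
    simp [e2]

end Opposite

section Lift

variable {T : ClassicalType} {n : ℕ} {q p : ℂ} {A : Type*} [Ring A] [Algebra ℂ A]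

lemma RLL_iff_coeff (s s' : Sgn) (L L' : Matrix (Idx T n) (Idx T n) (PowerSeries A)) :
    RLL T n q p (parU s s') (parV s s') (L.map inU) (L'.map inV) ↔
    ∀ (i j a b : Idx T n) (c d : ℤ),
      ∑ k, ∑ l, ∑ t ∈ Finset.range 3, rCoeff T n q p i j k l t •
        (laurentCoeff s (fun m => PowerSeries.coeff m (L k a)) (c - t) *
          laurentCoeff s' (fun m => PowerSeries.coeff m (L' l b)) (d - (2 - t))) =
      ∑ k, ∑ l, ∑ t ∈ Finset.range 3, rCoeff T n q p k l a b t •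
        (laurentCoeff s' (fun m => PowerSeries.coeff m (L' j l)) (d - (2 - t)) *
          laurentCoeff s (fun m => PowerSeries.coeff m (L i k)) (c - t)) := by
  rw [← RLL_biv_iff s s' (fun i j m => PowerSeries.coeff m (L i j))
    (fun i j m => PowerSeries.coeff m (L' i j))]
  have e : ∀ f : PowerSeries A, (PowerSeries.mk fun m => PowerSeries.coeff m f) = f := fun f =>
    PowerSeries.ext fun m => PowerSeries.coeff_mk _ _
  simp only [e]
  rfl

/-- A realization of the generators `L^±(u)`, `z^±[0]^{1/2}` and the defining relations in an
algebra. -/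
structure IsRealization (T : ClassicalType) (n : ℕ) (q p : ℂ)
    (L : Sgn → Matrix (Idx T n) (Idx T n) (PowerSeries A)) (w : T ≠ .B → Sgn → A) : Prop where
  zero : ∀ s i j, s.isZeroAt i.val j.val → PowerSeries.coeff 0 (L s i j) = 0
  mul_neg : ∀ s i, PowerSeries.coeff 0 (L s i i) * PowerSeries.coeff 0 (L s.neg i i) = 1
  same : ∀ s, RLL T n q p (parU s s) (parV s s) ((L s).map inU) ((L s).map inV)
  mixed : RLL T n q p (parU .plus .minus) (parV .plus .minus) ((L .plus).map inU)
    ((L .minus).map inV)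
  root_commute : ∀ hT s s', Commute (w hT s) (w hT s')
  root_commute_coeff : ∀ hT s s' i j m, Commute (w hT s) (PowerSeries.coeff m (L s' i j))
  root_sq : ∀ hT s i, i.val + 1 = n → w hT s * w hT s =
    PowerSeries.coeff 0 (L s i i) * PowerSeries.coeff 0 (L s i.rev i.rev)
  root_inv : ∀ hT, w hT .plus * w hT .minus = 1

omit [Algebra ℂ A] in
lemma map_laurentCoeff {B F : Type*} [Ring B] [FunLike F A B] [ZeroHomClass F A B] (φ : F)
    (s : Sgn) (x : ℕ → A) (k : ℤ) :
    φ (laurentCoeff s x k) = laurentCoeff s (fun m => φ (x m)) k := by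
  unfold laurentCoeff
  split_ifs
  · rfl
  · exact map_zero φ

variable {L : Sgn → Matrix (Idx T n) (Idx T n) (PowerSeries A)} {w : T ≠ .B → Sgn → A}

/-- The values of a realization on the generators. -/
def genVal (L : Sgn → Matrix (Idx T n) (Idx T n) (PowerSeries A)) (w : T ≠ .B → Sgn → A) :
    Gen T n → A
  | .l s i j m => PowerSeries.coeff m (L s i j)
  | .root hT s => w hT s

lemma lift_fl (s : Sgn) (i j : Idx T n) (m : ℕ) :
    FreeAlgebra.lift ℂ (genVal L w) (fl s i j m) = PowerSeries.coeff m (L s i j) :=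
  FreeAlgebra.lift_ι_apply _ _

lemma lift_froot (hT : T ≠ .B) (s : Sgn) :
    FreeAlgebra.lift ℂ (genVal L w) (froot hT s) = w hT s :=
  FreeAlgebra.lift_ι_apply _ _

lemma IsRealization.rel (h : IsRealization T n q p L w) {x y : Free T n} (hxy : Rel T n q p x y) :
    FreeAlgebra.lift ℂ (genVal L w) x = FreeAlgebra.lift ℂ (genVal L w) y := by
  cases hxy with
  | zero_plus i j hij => rw [lift_fl, map_zero]; exact h.zero .plus i j hij
  | zero_minus i j hij => rw [lift_fl, map_zero]; exact h.zero .minus j i hij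
  | plus_minus i => rw [map_mul, lift_fl, lift_fl, map_one]; exact h.mul_neg .plus i
  | minus_plus i => rw [map_mul, lift_fl, lift_fl, map_one]; exact h.mul_neg .minus i
  | rll_same s i j a b c d =>
    simp only [rllLeft, rllRight, map_sum, map_smul, map_mul, map_laurentCoeff, lift_fl]
    exact (RLL_iff_coeff _ _ _ _).mp (h.same s) i j a b c d
  | rll_mixed i j a b c d =>
    simp only [rllLeft, rllRight, map_sum, map_smul, map_mul, map_laurentCoeff, lift_fl]
    exact (RLL_iff_coeff _ _ _ _).mp h.mixed i j a b c d
  | root_comm hT s g =>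
    cases g with
    | l s' i j m =>
      rw [map_mul, map_mul, lift_froot, FreeAlgebra.lift_ι_apply]
      exact h.root_commute_coeff hT s s' i j m
    | root hT' s' =>
      rw [map_mul, map_mul, lift_froot, FreeAlgebra.lift_ι_apply]
      exact h.root_commute hT s s'
  | root_sq hT s i hi =>
    rw [map_mul, map_mul, lift_froot, lift_fl, lift_fl]
    exact h.root_sq hT s i hi
  | root_inv hT =>
    rw [map_mul, lift_froot, lift_froot, map_one]
    exact h.root_inv hT

/-- The homomorphism from the extended quantum affine algebra defined by a realization. -/
def IsRealization.lift (h : IsRealization T n q p L w) : Uext T n q p →ₐ[ℂ] A :=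
  RingQuot.liftAlgHom ℂ ⟨FreeAlgebra.lift ℂ (genVal L w), fun _ _ hxy => h.rel hxy⟩

lemma IsRealization.lift_lgen (h : IsRealization T n q p L w) (s : Sgn) (i j : Idx T n) (m : ℕ) :
    h.lift (lgen T n q p s i j m) = PowerSeries.coeff m (L s i j) := by
  rw [lgen, proj, IsRealization.lift]
  erw [RingQuot.liftAlgHom_mkAlgHom_apply]
  exact lift_fl s i j m

lemma IsRealization.lift_rootgen (h : IsRealization T n q p L w) (hT : T ≠ .B) (s : Sgn) :
    h.lift (rootgen T n q p hT s) = w hT s := by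
  rw [rootgen, proj, IsRealization.lift]
  erw [RingQuot.liftAlgHom_mkAlgHom_apply]
  exact lift_froot hT s

lemma Uext.algHom_ext {φ ψ : Uext T n q p →ₐ[ℂ] A}
    (hl : ∀ s i j m, φ (lgen T n q p s i j m) = ψ (lgen T n q p s i j m))
    (hr : ∀ hT s, φ (rootgen T n q p hT s) = ψ (rootgen T n q p hT s)) : φ = ψ := by
  refine RingQuot.ringQuot_ext' ℂ _ _ (FreeAlgebra.hom_ext (funext fun g => ?_))
  cases g with
  | l s i j m => exact hl s i j m
  | root hT s => exact hr hT s

lemma proj_surjective : Function.Surjective (proj T n q p) :=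
  RingQuot.mkAlgHom_surjective ℂ _

lemma Uext.induction {P : Uext T n q p → Prop} (hc : ∀ r, P (algebraMap ℂ _ r))
    (hl : ∀ s i j m, P (lgen T n q p s i j m)) (hr : ∀ hT s, P (rootgen T n q p hT s))
    (hadd : ∀ x y, P x → P y → P (x + y)) (hmul : ∀ x y, P x → P y → P (x * y))
    (x : Uext T n q p) : P x := by
  obtain ⟨x, rfl⟩ := proj_surjective x
  induction x using FreeAlgebra.induction with
  | grade0 r => rw [AlgHom.commutes]; exact hc r
  | grade1 g =>
    cases g with
    | l s i j m => exact hl s i j m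
    | root hT s => exact hr hT s
  | mul a b ha hb => rw [map_mul]; exact hmul _ _ ha hb
  | add a b ha hb => rw [map_add]; exact hadd _ _ ha hb

lemma coeff_Lmat (s : Sgn) (i j : Idx T n) (m : ℕ) :
    PowerSeries.coeff m (Lmat T n q p s i j) = lgen T n q p s i j m := by
  rw [Lmat, Matrix.of_apply, PowerSeries.coeff_mk]

lemma proj_rel {x y : Free T n} (h : Rel T n q p x y) : proj T n q p x = proj T n q p y :=
  RingQuot.mkAlgHom_rel ℂ h

variable (T n q p) in
lemma isRealization_Lmat : IsRealization T n q p (Lmat T n q p) (rootgen T n q p) where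
  zero s i j h := by
    rw [coeff_Lmat]
    cases s
    · exact (proj_rel (.zero_plus i j h)).trans (map_zero _)
    · exact (proj_rel (.zero_minus j i h)).trans (map_zero _)
  mul_neg s i := by
    rw [coeff_Lmat, coeff_Lmat, lgen, lgen, ← map_mul]
    cases s
    · exact (proj_rel (.plus_minus i)).trans (map_one _)
    · exact (proj_rel (.minus_plus i)).trans (map_one _)
  same s := by
    rw [RLL_iff_coeff]
    intro i j a b c d
    have := proj_rel (.rll_same (T := T) (n := n) (q := q) (p := p) s i j a b c d)
    simpa only [rllLeft, rllRight, map_sum, map_smul, map_mul, map_laurentCoeff, coeff_Lmat, lgen]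
      using this
  mixed := by
    rw [RLL_iff_coeff]
    intro i j a b c d
    have := proj_rel (.rll_mixed (T := T) (n := n) (q := q) (p := p) i j a b c d)
    simpa only [rllLeft, rllRight, map_sum, map_smul, map_mul, map_laurentCoeff, coeff_Lmat, lgen]
      using this
  root_commute hT s s' := by
    have := proj_rel (.root_comm (T := T) (n := n) (q := q) (p := p) hT s (.root hT s'))
    rwa [map_mul, map_mul] at this
  root_commute_coeff hT s s' i j m := by
    have := proj_rel (.root_comm (T := T) (n := n) (q := q) (p := p) hT s (.l s' i j m))
    rw [coeff_Lmat]
    rwa [map_mul, map_mul] at this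
  root_sq hT s i hi := by
    have := proj_rel (.root_sq (T := T) (n := n) (q := q) (p := p) hT s i hi)
    rw [coeff_Lmat, coeff_Lmat]
    rwa [map_mul, map_mul] at this
  root_inv hT := by
    have := proj_rel (.root_inv (T := T) (n := n) (q := q) (p := p) hT)
    rwa [map_mul, map_one] at this

end Lift

/-! ### Products and inverses of realizations -/

section Realizations

variable {T : ClassicalType} {n : ℕ} {q p : ℂ} {A : Type*} [Ring A] [Algebra ℂ A]

section Constructions

lemma Sgn.neg_neg (s : Sgn) : s.neg.neg = s := by cases s <;> rfl

lemma Sgn.isZeroAt_trans (s : Sgn) {i j : ℕ} (k : ℕ) (h : s.isZeroAt i j) :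
    s.isZeroAt i k ∨ s.isZeroAt k j := by
  cases s <;> simp only [Sgn.isZeroAt] at h ⊢ <;> omega

lemma Sgn.isZeroAt_or (s : Sgn) {i j : ℕ} (h : i ≠ j) : s.isZeroAt i j ∨ s.isZeroAt j i := by
  cases s <;> simp only [Sgn.isZeroAt] <;> omega

omit [Algebra ℂ A] in
lemma commute_inU_inV {f g : PowerSeries A}
    (h : ∀ a b, Commute (PowerSeries.coeff a f) (PowerSeries.coeff b g)) :
    Commute (inU f) (inV g : Biv A) :=
  biv_ext fun c d => by rw [coeff₂_inU_mul_inV, coeff₂_inV_mul_inU, (h c d).eq]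

omit [Algebra ℂ A] in
lemma commute_of_coeff {f g : PowerSeries A}
    (h : ∀ a b, Commute (PowerSeries.coeff a f) (PowerSeries.coeff b g)) : Commute f g := by
  refine PowerSeries.ext fun m => ?_
  rw [PowerSeries.coeff_mul, PowerSeries.coeff_mul, ← Finset.Nat.sum_antidiagonal_swap]
  exact Finset.sum_congr rfl fun r _ => (h _ _).eq

/-- Entrywise and coefficientwise application of an algebra homomorphism to a matrix of series. -/
def serMap {B : Type*} [Ring B] [Algebra ℂ B] (φ : A →ₐ[ℂ] B) {N : ℕ} :
    Matrix (Fin N) (Fin N) (PowerSeries A) →+* Matrix (Fin N) (Fin N) (PowerSeries B) :=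
  (PowerSeries.map (φ : A →+* B)).mapMatrix

lemma coeff_serMap {B : Type*} [Ring B] [Algebra ℂ B] (φ : A →ₐ[ℂ] B) {N : ℕ}
    (M : Matrix (Fin N) (Fin N) (PowerSeries A)) (i j : Fin N) (m : ℕ) :
    PowerSeries.coeff m (serMap φ M i j) = φ (PowerSeries.coeff m (M i j)) := by
  simp [serMap]

lemma serMap_comp {B C : Type*} [Ring B] [Algebra ℂ B] [Ring C] [Algebra ℂ C] (ψ : B →ₐ[ℂ] C)
    (φ : A →ₐ[ℂ] B) {N : ℕ} (M : Matrix (Fin N) (Fin N) (PowerSeries A)) :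
    serMap (ψ.comp φ) M = serMap ψ (serMap φ M) := by
  ext i j m
  simp only [coeff_serMap, AlgHom.comp_apply]

variable {L L' : Sgn → Matrix (Idx T n) (Idx T n) (PowerSeries A)} {w w' : T ≠ .B → Sgn → A}

lemma IsRealization.map {B : Type*} [Ring B] [Algebra ℂ B] (φ : A →ₐ[ℂ] B)
    (h : IsRealization T n q p L w) :
    IsRealization T n q p (fun s => serMap φ (L s)) (fun hT s => φ (w hT s)) where
  zero s i j hij := by rw [coeff_serMap, h.zero s i j hij, map_zero]
  mul_neg s i := by rw [coeff_serMap, coeff_serMap, ← map_mul, h.mul_neg, map_one]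
  same s := by
    have h0 := h.same s
    rw [RLL_iff_coeff] at h0 ⊢
    intro i j a b c d
    have := congrArg φ (h0 i j a b c d)
    simpa only [map_sum, map_smul, map_mul, map_laurentCoeff, coeff_serMap] using this
  mixed := by
    have h0 := h.mixed
    rw [RLL_iff_coeff] at h0 ⊢
    intro i j a b c d
    have := congrArg φ (h0 i j a b c d)
    simpa only [map_sum, map_smul, map_mul, map_laurentCoeff, coeff_serMap] using this
  root_commute hT s s' := (h.root_commute hT s s').map φ
  root_commute_coeff hT s s' i j m := by
    rw [coeff_serMap]
    exact (h.root_commute_coeff hT s s' i j m).map φ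
  root_sq hT s i hi := by rw [coeff_serMap, coeff_serMap, ← map_mul, h.root_sq hT s i hi, map_mul]
  root_inv hT := by rw [← map_mul, h.root_inv, map_one]

variable (T n q p) in
/-- The trivial realization, which defines the counit. -/
lemma isRealization_one : IsRealization T n q p
    (fun _ => (1 : Matrix (Idx T n) (Idx T n) (PowerSeries A))) (fun _ _ => 1) := by
  have h1 : ∀ U V : Biv A, RLL T n q p U V 1 1 := fun U V => by
    unfold RLL
    simp only [map_one, mul_one, one_mul]
  have hU : (1 : Matrix (Idx T n) (Idx T n) (PowerSeries A)).map inU = (1 : Matrix _ _ (Biv A)) :=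
    Matrix.map_one _ (map_zero _) (map_one _)
  have hV : (1 : Matrix (Idx T n) (Idx T n) (PowerSeries A)).map inV = (1 : Matrix _ _ (Biv A)) :=
    Matrix.map_one _ (map_zero _) (map_one _)
  refine ⟨fun s i j hij => ?_, fun s i => by simp, fun s => ?_, ?_, fun _ _ _ => Commute.refl _,
    fun _ _ _ _ _ _ => Commute.one_left _, fun _ _ _ _ => by simp, fun _ => by simp⟩
  · rw [Matrix.one_apply_ne, map_zero]
    rintro rfl
    cases s <;> exact lt_irrefl _ hij
  · rw [hU, hV]
    exact h1 _ _
  · rw [hU, hV]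
    exact h1 _ _

lemma coeff_zero_mul_diag (h : IsRealization T n q p L w) (h' : IsRealization T n q p L' w')
    (s : Sgn) (i : Idx T n) : PowerSeries.coeff 0 ((L s * L' s) i i) =
      PowerSeries.coeff 0 (L s i i) * PowerSeries.coeff 0 (L' s i i) := by
  rw [Matrix.mul_apply, map_sum, Finset.sum_eq_single i]
  · simp
  · intro k _ hk
    rw [PowerSeries.coeff_mul]
    simp only [Finset.HasAntidiagonal.antidiagonal_zero, Finset.sum_singleton]
    rcases s.isZeroAt_or (fun e => hk (Fin.ext e)) with h1 | h1
    · rw [h'.zero s k i h1, mul_zero]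
    · rw [h.zero s i k h1, zero_mul]
  · simp

/-- The product of two realizations with commuting entries is again a realization. For the two
embeddings of an algebra into its tensor square this defines the coproduct. -/
lemma IsRealization.mul (h : IsRealization T n q p L w) (h' : IsRealization T n q p L' w')
    (hLL : ∀ s s' i j k l a b, Commute (PowerSeries.coeff a (L s i j))
      (PowerSeries.coeff b (L' s' k l)))
    (hwL : ∀ hT s s' i j a, Commute (w hT s) (PowerSeries.coeff a (L' s' i j)))
    (hLw : ∀ hT s s' i j a, Commute (w' hT s) (PowerSeries.coeff a (L s' i j)))
    (hww : ∀ hT s s', Commute (w hT s) (w' hT s')) :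
    IsRealization T n q p (fun s => L s * L' s) (fun hT s => w hT s * w' hT s) := by
  have hcoeff : ∀ s i j m, PowerSeries.coeff m ((L s * L' s) i j) = ∑ k,
      ∑ r ∈ Finset.HasAntidiagonal.antidiagonal m,
        PowerSeries.coeff r.1 (L s i k) * PowerSeries.coeff r.2 (L' s k j) := fun s i j m => by
    simp only [Matrix.mul_apply, map_sum, PowerSeries.coeff_mul]
  have hU : ∀ s, (L s * L' s).map inU = (L s).map inU * ((L' s).map inU : Matrix _ _ (Biv A)) :=
    fun s => Matrix.map_mul
  have hV : ∀ s, (L s * L' s).map inV = (L s).map inV * ((L' s).map inV : Matrix _ _ (Biv A)) :=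
    fun s => Matrix.map_mul
  have hRLL : ∀ s s', RLL T n q p (parU s s') (parV s s') ((L s).map inU) ((L s').map inV) →
      RLL T n q p (parU s s') (parV s s') ((L' s).map inU) ((L' s').map inV) →
      RLL T n q p (parU s s') (parV s s') ((L s * L' s).map inU) ((L s' * L' s').map inV) := by
    intro s s' h1 h2
    rw [hU, hV]
    exact h1.mul h2 (fun i j k l => commute_inU_inV fun a b => (hLL s' s k l i j b a).symm)
      (fun i j k l => commute_inU_inV fun a b => hLL s s' i j k l a b)
  refine ⟨fun s i j hij => ?_, fun s i => ?_, fun s => hRLL s s (h.same s) (h'.same s),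
    hRLL _ _ h.mixed h'.mixed, fun hT s s' => ?_, fun hT s s' i j m => ?_, fun hT s i hi => ?_,
    fun hT => ?_⟩
  · rw [hcoeff]
    refine Finset.sum_eq_zero fun k _ => ?_
    simp only [Finset.HasAntidiagonal.antidiagonal_zero, Finset.sum_singleton]
    rcases s.isZeroAt_trans k.val hij with h1 | h1
    · rw [h.zero s i k h1, zero_mul]
    · rw [h'.zero s k j h1, mul_zero]
  · rw [coeff_zero_mul_diag h h', coeff_zero_mul_diag h h', (hLL s.neg s i i i i 0 0).symm.mul_mul_mul_comm,
      h.mul_neg, h'.mul_neg, one_mul]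
  · exact ((h.root_commute hT s s').mul_right (hww hT s s')).mul_left
      (((hww hT s' s).symm).mul_right (h'.root_commute hT s s'))
  · rw [hcoeff]
    refine Commute.sum_right _ _ _ fun k _ => Commute.sum_right _ _ _ fun r _ => ?_
    exact ((h.root_commute_coeff hT s s' i k _).mul_right (hwL hT s s' k j _)).mul_left
      ((hLw hT s s' i k _).mul_right (h'.root_commute_coeff hT s s' k j _))
  · rw [coeff_zero_mul_diag h h', coeff_zero_mul_diag h h', (hww hT s s).symm.mul_mul_mul_comm,
      (hLL s s i.rev i.rev i i 0 0).symm.mul_mul_mul_comm, h.root_sq hT s i hi, h'.root_sq hT s i hi]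
  · rw [(hww hT .minus .plus).symm.mul_mul_mul_comm, h.root_inv, h'.root_inv, one_mul]

end Constructions

section Inverse

variable {L : Sgn → Matrix (Idx T n) (Idx T n) (PowerSeries A)} {w : T ≠ .B → Sgn → A}

lemma IsRealization.isTriangularAtZero (h : IsRealization T n q p L w) (s : Sgn) :
    IsTriangularAtZero s (L s) where
  zero := h.zero s
  unit i := by
    have h2 := h.mul_neg s.neg i
    rw [s.neg_neg] at h2
    exact ⟨⟨_, _, h.mul_neg s i, h2⟩, rfl⟩

lemma IsRealization.isUnit (h : IsRealization T n q p L w) (s : Sgn) : IsUnit (L s) := by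
  have h1 := (h.isTriangularAtZero s).isUnit_block le_rfl
  have e : (Matrix.of fun a b : Idx T n => natExt (L s) a b) = L s :=
    Matrix.ext fun a b => natExt_val (L s) a b
  rwa [e] at h1

lemma IsRealization.mul_inverse (h : IsRealization T n q p L w) (s : Sgn) :
    L s * Ring.inverse (L s) = 1 := Ring.mul_inverse_cancel _ (h.isUnit s)

lemma IsRealization.inverse_mul (h : IsRealization T n q p L w) (s : Sgn) :
    Ring.inverse (L s) * L s = 1 := Ring.inverse_mul_cancel _ (h.isUnit s)

lemma IsRealization.coeff_zero_inverse (h : IsRealization T n q p L w) (s : Sgn) :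
    (∀ i j, s.isZeroAt i.val j.val → PowerSeries.coeff 0 (Ring.inverse (L s) i j) = 0) ∧
    ∀ i, PowerSeries.coeff 0 (Ring.inverse (L s) i i) = PowerSeries.coeff 0 (L s.neg i i) := by
  have h1 := congrArg (fun X => X.map (PowerSeries.constantCoeff (R := A))) (h.inverse_mul s)
  rw [← RingHom.mapMatrix_apply, ← RingHom.mapMatrix_apply, map_mul, map_one] at h1
  have e : ∀ (M : Matrix (Idx T n) (Idx T n) (PowerSeries A)) i j,
      (PowerSeries.constantCoeff (R := A)).mapMatrix M i j = PowerSeries.coeff 0 (M i j) :=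
    fun M i j => by
      rw [RingHom.mapMatrix_apply, Matrix.map_apply, PowerSeries.coeff_zero_eq_constantCoeff_apply]
  obtain ⟨h2, h3⟩ := left_inverse_triangular (s.rank_injective (dimN T n))
    (M := (PowerSeries.constantCoeff (R := A)).mapMatrix (L s))
    (fun i j hij => by rw [e]; exact h.zero s i j (s.rank_lt hij))
    (fun i => by rw [e]; exact (h.isTriangularAtZero s).unit i) h1
  simp only [e] at h2 h3
  refine ⟨fun i j hij => h2 i j ?_, fun i => ?_⟩
  · cases s <;> simp only [Sgn.isZeroAt, Sgn.rank] at hij ⊢ <;> omega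
  · rw [← mul_one (PowerSeries.coeff 0 (Ring.inverse (L s) i i)), ← h.mul_neg s i, ← mul_assoc, h3,
      one_mul]

/-- The inverse matrices form a realization in the opposite algebra; this defines the antipode. -/
lemma IsRealization.inverse (h : IsRealization T n q p L w) : IsRealization T n q p
    (fun s => (Ring.inverse (L s)).map fun f => opSeries (MulOpposite.op f))
    (fun hT s => MulOpposite.op (w hT s.neg)) := by
  have hc : ∀ s i j m, PowerSeries.coeff m
      (((Ring.inverse (L s)).map fun f => opSeries (MulOpposite.op f)) i j) =
      MulOpposite.op (PowerSeries.coeff m (Ring.inverse (L s) i j)) := fun s i j m => by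
    rw [Matrix.map_apply, coeff_opSeries, MulOpposite.unop_op]
  have hinv : ∀ hT s, w hT s * w hT s.neg = 1 := fun hT s => by
    cases s
    · exact h.root_inv hT
    · exact (h.root_commute hT _ _).eq.trans (h.root_inv hT)
  have hRLL : ∀ s s', RLL T n q p (parU s s') (parV s s') ((L s).map inU) ((L s').map inV) → _ :=
    fun s s' h1 => h1.inv_opSeries (h.mul_inverse s) (h.mul_inverse s') (h.inverse_mul s)
      (h.inverse_mul s')
  refine ⟨fun s i j hij => ?_, fun s i => ?_, fun s => hRLL s s (h.same s),
    hRLL _ _ h.mixed, fun hT s s' => (h.root_commute hT _ _).op, fun hT s s' i j m => ?_,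
    fun hT s i hi => ?_, fun hT => ?_⟩
  · rw [hc, (h.coeff_zero_inverse s).1 i j hij, MulOpposite.op_zero]
  · rw [hc, hc, (h.coeff_zero_inverse s).2, (h.coeff_zero_inverse s.neg).2, ← MulOpposite.op_mul,
      s.neg_neg, h.mul_neg, MulOpposite.op_one]
  · rw [hc]
    refine Commute.op ?_
    have h1 : Commute (Matrix.scalar (Idx T n) (PowerSeries.C (w hT s.neg))) (L s') := by
      refine Matrix.ext fun i j => PowerSeries.ext fun m => ?_
      simp only [Matrix.scalar_apply, Matrix.diagonal_mul, Matrix.mul_diagonal,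
        PowerSeries.coeff_C_mul, PowerSeries.coeff_mul_C]
      exact h.root_commute_coeff hT _ _ i j m
    have h2 := commute_of_mul_eq_one (h.mul_inverse s') (h.inverse_mul s') h1
    have h3 := congrArg (PowerSeries.coeff m) (congrFun (congrFun h2.eq i) j)
    simp only [Matrix.scalar_apply, Matrix.diagonal_mul, Matrix.mul_diagonal,
        PowerSeries.coeff_C_mul, PowerSeries.coeff_mul_C] at h3
    exact h3
  · rw [hc, hc, ← MulOpposite.op_mul, ← MulOpposite.op_mul, (h.coeff_zero_inverse s).2,
      (h.coeff_zero_inverse s).2, h.root_sq hT s.neg i hi]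
    -- the two factors commute since one of them commutes with their product, which is a unit
    set a := PowerSeries.coeff 0 (L s.neg i i)
    set b := PowerSeries.coeff 0 (L s.neg i.rev i.rev)
    have hab : w hT s.neg * w hT s.neg = a * b := h.root_sq hT s.neg i hi
    have hu : IsUnit (w hT s.neg * w hT s.neg) := by
      have h1 := hinv hT s.neg
      rw [s.neg_neg] at h1
      have : IsUnit (w hT s.neg) := ⟨⟨_, _, h1, hinv hT s⟩, rfl⟩
      exact this.mul this
    have ha : Commute (w hT s.neg) a := h.root_commute_coeff hT _ _ i i 0
    have hua : IsUnit a := (h.isTriangularAtZero s.neg).unit i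
    congr 1
    apply hua.mul_left_cancel
    rw [← hab, ← mul_assoc a b a, ← hab, (ha.mul_left ha).eq]
  · have := hinv hT .plus
    rw [← MulOpposite.op_mul]
    exact congrArg MulOpposite.op this

end Inverse

end Realizations

/-! ### The Hopf algebra structure -/

section Hopf

variable (T : ClassicalType) (n : ℕ) (q p : ℂ)

/-- The first embedding of an algebra into its tensor square. -/
abbrev inclL (A : Type*) [Ring A] [Algebra ℂ A] : A →ₐ[ℂ] A ⊗[ℂ] A :=
  Algebra.TensorProduct.includeLeft

/-- The second embedding of an algebra into its tensor square. -/
abbrev inclR (A : Type*) [Ring A] [Algebra ℂ A] : A →ₐ[ℂ] A ⊗[ℂ] A :=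
  Algebra.TensorProduct.includeRight

lemma inclL_commute_inclR {A : Type*} [Ring A] [Algebra ℂ A] (x y : A) :
    Commute (inclL A x) (inclR A y) := by
  change (x ⊗ₜ[ℂ] (1 : A)) * ((1 : A) ⊗ₜ[ℂ] y) = ((1 : A) ⊗ₜ[ℂ] y) * (x ⊗ₜ[ℂ] (1 : A))
  simp

/-- The matrices `L_{[1]}(u) L_{[2]}(u)` over the tensor square. -/
lemma isRealization_comul : IsRealization T n q p
    (fun s => serMap (inclL (Uext T n q p)) (Lmat T n q p s) *
      serMap (inclR (Uext T n q p)) (Lmat T n q p s))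
    (fun hT s => inclL (Uext T n q p) (rootgen T n q p hT s) *
      inclR (Uext T n q p) (rootgen T n q p hT s)) := by
  refine ((isRealization_Lmat T n q p).map (inclL _)).mul ((isRealization_Lmat T n q p).map (inclR _))
    ?_ ?_ ?_ ?_
  · intros
    rw [coeff_serMap, coeff_serMap]
    exact inclL_commute_inclR _ _
  · intros
    rw [coeff_serMap]
    exact inclL_commute_inclR _ _
  · intros
    rw [coeff_serMap]
    exact (inclL_commute_inclR _ _).symm
  · intros
    exact inclL_commute_inclR _ _

/-- The coproduct of the extended quantum affine algebra. -/
def Uext.comul : Uext T n q p →ₐ[ℂ] Uext T n q p ⊗[ℂ] Uext T n q p :=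
  (isRealization_comul T n q p).lift

/-- The counit of the extended quantum affine algebra. -/
def Uext.counit : Uext T n q p →ₐ[ℂ] ℂ := (isRealization_one T n q p).lift

/-- The antipode, as a homomorphism to the opposite algebra. -/
def Uext.antipodeOp : Uext T n q p →ₐ[ℂ] (Uext T n q p)ᵐᵒᵖ :=
  (isRealization_Lmat T n q p).inverse.lift

/-- The antipode of the extended quantum affine algebra. -/
def Uext.antipode : Uext T n q p →ₗ[ℂ] Uext T n q p :=
  (MulOpposite.opLinearEquiv ℂ).symm.toLinearMap ∘ₗ (Uext.antipodeOp T n q p).toLinearMap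

variable {T n q p}

lemma IsRealization.serMap_lift {A : Type*} [Ring A] [Algebra ℂ A]
    {L : Sgn → Matrix (Idx T n) (Idx T n) (PowerSeries A)} {w : T ≠ .B → Sgn → A}
    (h : IsRealization T n q p L w) (s : Sgn) : serMap h.lift (Lmat T n q p s) = L s := by
  refine Matrix.ext fun i j => PowerSeries.ext fun m => ?_
  rw [coeff_serMap, coeff_Lmat, h.lift_lgen]

lemma Uext.serMap_ext {A : Type*} [Ring A] [Algebra ℂ A] {φ ψ : Uext T n q p →ₐ[ℂ] A}
    (hl : ∀ s, serMap φ (Lmat T n q p s) = serMap ψ (Lmat T n q p s))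
    (hr : ∀ hT s, φ (rootgen T n q p hT s) = ψ (rootgen T n q p hT s)) : φ = ψ := by
  refine Uext.algHom_ext (fun s i j m => ?_) hr
  have := congrArg (PowerSeries.coeff m) (congrFun (congrFun (hl s) i) j)
  rwa [coeff_serMap, coeff_serMap, coeff_Lmat] at this

lemma Uext.serMap_comul (s : Sgn) : serMap (Uext.comul T n q p) (Lmat T n q p s) =
    serMap (inclL (Uext T n q p)) (Lmat T n q p s) * serMap (inclR (Uext T n q p)) (Lmat T n q p s) :=
  (isRealization_comul T n q p).serMap_lift s

lemma Uext.comul_root (hT : T ≠ .B) (s : Sgn) : Uext.comul T n q p (rootgen T n q p hT s) =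
    rootgen T n q p hT s ⊗ₜ[ℂ] rootgen T n q p hT s := by
  rw [Uext.comul, IsRealization.lift_rootgen]
  simp [Algebra.TensorProduct.tmul_mul_tmul]

lemma Uext.serMap_counit (s : Sgn) : serMap (Uext.counit T n q p) (Lmat T n q p s) = 1 :=
  (isRealization_one T n q p).serMap_lift s

lemma Uext.counit_root (hT : T ≠ .B) (s : Sgn) :
    Uext.counit T n q p (rootgen T n q p hT s) = 1 := by
  rw [Uext.counit, IsRealization.lift_rootgen]

lemma Uext.antipode_mul (x y : Uext T n q p) : Uext.antipode T n q p (x * y) =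
    Uext.antipode T n q p y * Uext.antipode T n q p x := by
  simp [Uext.antipode]

lemma Uext.antipode_algebraMap (r : ℂ) :
    Uext.antipode T n q p (algebraMap ℂ _ r) = algebraMap ℂ _ r := by
  simp [Uext.antipode]

lemma Uext.antipode_one : Uext.antipode T n q p 1 = 1 := by
  simp [Uext.antipode]

lemma Uext.antipode_lgen (s : Sgn) (i j : Idx T n) (m : ℕ) :
    Uext.antipode T n q p (lgen T n q p s i j m) =
      PowerSeries.coeff m (Ring.inverse (Lmat T n q p s) i j) := by
  simp only [Uext.antipode, Uext.antipodeOp, LinearMap.comp_apply, AlgHom.toLinearMap_apply,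
    IsRealization.lift_lgen, Matrix.map_apply, coeff_opSeries]
  rfl

lemma Uext.map_antipode_Lmat (s : Sgn) :
    (Lmat T n q p s).map (seriesMap (Uext.antipode T n q p)) = Ring.inverse (Lmat T n q p s) := by
  refine Matrix.ext fun i j => PowerSeries.ext fun m => ?_
  rw [Matrix.map_apply, seriesMap, PowerSeries.coeff_mk, coeff_Lmat, Uext.antipode_lgen]

lemma Uext.antipode_root (hT : T ≠ .B) (s : Sgn) :
    Uext.antipode T n q p (rootgen T n q p hT s) = rootgen T n q p hT s.neg := by
  simp only [Uext.antipode, Uext.antipodeOp, LinearMap.comp_apply, AlgHom.toLinearMap_apply,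
    IsRealization.lift_rootgen]
  rfl

/-- The antipode identity on generators is the matrix identity `L(u)⁻¹ L(u) = 1`; since the antipode
is an antihomomorphism, the identity passes to products. -/
lemma Uext.antipode_left (x : Uext T n q p) :
    LinearMap.mul' ℂ _ ((Uext.antipode T n q p).rTensor _ (Uext.comul T n q p x)) =
      algebraMap ℂ _ (Uext.counit T n q p x) := by
  set F : Uext T n q p ⊗[ℂ] Uext T n q p →ₗ[ℂ] Uext T n q p :=
    LinearMap.mul' ℂ _ ∘ₗ (Uext.antipode T n q p).rTensor _ with hF
  have hFt : ∀ a b, F (a ⊗ₜ b) = Uext.antipode T n q p a * b := fun a b => by simp [hF]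
  have hmul : ∀ t c d, F (t * (c ⊗ₜ d)) = Uext.antipode T n q p c * F t * d := by
    intro t c d
    induction t using TensorProduct.induction_on with
    | zero => simp
    | tmul a b =>
      rw [Algebra.TensorProduct.tmul_mul_tmul, hFt, hFt, Uext.antipode_mul]
      simp only [mul_assoc]
    | add t t' h h' => rw [add_mul, map_add, h, h', map_add, mul_add, add_mul]
  change F (Uext.comul T n q p x) = _
  induction x using Uext.induction with
  | hc r => simp [hF, Algebra.TensorProduct.algebraMap_apply, Uext.antipode_algebraMap]
  | hl s i j m =>
    have h1 := congrArg (PowerSeries.coeff m)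
      (congrFun (congrFun (Uext.serMap_comul (T := T) (n := n) (q := q) (p := p) s) i) j)
    rw [coeff_serMap, coeff_Lmat, Matrix.mul_apply, map_sum] at h1
    have h2 := congrArg (PowerSeries.coeff m)
      (congrFun (congrFun ((isRealization_Lmat T n q p).inverse_mul s) i) j)
    have h3 := congrArg (PowerSeries.coeff m)
      (congrFun (congrFun (Uext.serMap_counit (T := T) (n := n) (q := q) (p := p) s) i) j)
    rw [coeff_serMap, coeff_Lmat] at h3
    rw [Matrix.mul_apply, map_sum] at h2
    rw [h1, h3, map_sum]
    simp only [PowerSeries.coeff_mul, coeff_serMap, map_sum, coeff_Lmat] at h2 ⊢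
    have e : ∀ a b : Uext T n q p, F (inclL _ a * inclR _ b) = Uext.antipode T n q p a * b :=
      fun a b => by
        rw [← hFt]
        simp
    simp only [e, Uext.antipode_lgen]
    rw [h2, Matrix.one_apply, Matrix.one_apply]
    split_ifs
    · rw [PowerSeries.coeff_one, PowerSeries.coeff_one]
      split_ifs <;> simp
    · simp
  | hr hT s =>
    rw [Uext.comul_root, hFt, Uext.antipode_root, Uext.counit_root, map_one]
    cases s
    · exact ((isRealization_Lmat T n q p).root_commute hT _ _).eq.trans
        ((isRealization_Lmat T n q p).root_inv hT)
    · exact (isRealization_Lmat T n q p).root_inv hT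
  | hadd x y hx hy => rw [map_add, map_add, hx, hy, map_add, map_add]
  | hmul x y hx hy =>
    have h1 : ∀ t, F (Uext.comul T n q p x * t) =
        algebraMap ℂ _ (Uext.counit T n q p x) * F t := by
      intro t
      induction t using TensorProduct.induction_on with
      | zero => simp
      | tmul c d => rw [hmul, hx, hFt, ← mul_assoc, Algebra.commutes]
      | add t t' h h' => rw [mul_add, map_add, h, h', map_add, mul_add]
    rw [map_mul, h1, hy, map_mul, map_mul]

lemma Uext.antipode_right (x : Uext T n q p) :
    LinearMap.mul' ℂ _ ((Uext.antipode T n q p).lTensor _ (Uext.comul T n q p x)) =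
      algebraMap ℂ _ (Uext.counit T n q p x) := by
  set F : Uext T n q p ⊗[ℂ] Uext T n q p →ₗ[ℂ] Uext T n q p :=
    LinearMap.mul' ℂ _ ∘ₗ (Uext.antipode T n q p).lTensor _ with hF
  have hFt : ∀ a b, F (a ⊗ₜ b) = a * Uext.antipode T n q p b := fun a b => by simp [hF]
  have hmul : ∀ t a b, F ((a ⊗ₜ b) * t) = a * F t * Uext.antipode T n q p b := by
    intro t a b
    induction t using TensorProduct.induction_on with
    | zero => simp
    | tmul c d =>
      rw [Algebra.TensorProduct.tmul_mul_tmul, hFt, hFt, Uext.antipode_mul]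
      simp only [mul_assoc]
    | add t t' h h' => rw [mul_add, map_add, h, h', map_add, mul_add, add_mul]
  change F (Uext.comul T n q p x) = _
  induction x using Uext.induction with
  | hc r => simp [hF, Algebra.TensorProduct.algebraMap_apply, Uext.antipode_one]
  | hl s i j m =>
    have h1 := congrArg (PowerSeries.coeff m)
      (congrFun (congrFun (Uext.serMap_comul (T := T) (n := n) (q := q) (p := p) s) i) j)
    rw [coeff_serMap, coeff_Lmat, Matrix.mul_apply, map_sum] at h1
    have h2 := congrArg (PowerSeries.coeff m)
      (congrFun (congrFun ((isRealization_Lmat T n q p).mul_inverse s) i) j)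
    have h3 := congrArg (PowerSeries.coeff m)
      (congrFun (congrFun (Uext.serMap_counit (T := T) (n := n) (q := q) (p := p) s) i) j)
    rw [coeff_serMap, coeff_Lmat] at h3
    rw [Matrix.mul_apply, map_sum] at h2
    rw [h1, h3, map_sum]
    simp only [PowerSeries.coeff_mul, coeff_serMap, map_sum, coeff_Lmat] at h2 ⊢
    have e : ∀ a b : Uext T n q p, F (inclL _ a * inclR _ b) = a * Uext.antipode T n q p b :=
      fun a b => by
        rw [← hFt]
        simp
    simp only [e, Uext.antipode_lgen]
    rw [h2, Matrix.one_apply, Matrix.one_apply]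
    split_ifs
    · rw [PowerSeries.coeff_one, PowerSeries.coeff_one]
      split_ifs <;> simp
    · simp
  | hr hT s =>
    rw [Uext.comul_root, hFt, Uext.antipode_root, Uext.counit_root, map_one]
    cases s
    · exact (isRealization_Lmat T n q p).root_inv hT
    · exact ((isRealization_Lmat T n q p).root_commute hT _ _).eq.trans
        ((isRealization_Lmat T n q p).root_inv hT)
  | hadd x y hx hy => rw [map_add, map_add, hx, hy, map_add, map_add]
  | hmul x y hx hy =>
    have h1 : ∀ t, F (t * Uext.comul T n q p y) =
        F t * algebraMap ℂ _ (Uext.counit T n q p y) := by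
      intro t
      induction t using TensorProduct.induction_on with
      | zero => simp
      | tmul c d => rw [hmul, hy, hFt, mul_assoc, mul_assoc, Algebra.commutes]
      | add t t' h h' => rw [add_mul, map_add, h, h', map_add, add_mul]
    rw [map_mul, h1, hx, map_mul, map_mul]

lemma serMap_eq_of_apply {A B C : Type*} [Ring A] [Algebra ℂ A] [Ring B] [Algebra ℂ B] [Ring C]
    [Algebra ℂ C] {N : ℕ} {ψ : B →ₐ[ℂ] C} {φ : A →ₐ[ℂ] B} {χ : A →ₐ[ℂ] C}
    (h : ∀ x, ψ (φ x) = χ x) (M : Matrix (Fin N) (Fin N) (PowerSeries A)) :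
    serMap ψ (serMap φ M) = serMap χ M := by
  rw [← serMap_comp]
  exact congrArg (fun f => serMap f M) (AlgHom.ext h)

lemma serMap_id {A : Type*} [Ring A] [Algebra ℂ A] {N : ℕ}
    (M : Matrix (Fin N) (Fin N) (PowerSeries A)) : serMap (AlgHom.id ℂ A) M = M := by
  refine Matrix.ext fun i j => PowerSeries.ext fun m => ?_
  rw [coeff_serMap, AlgHom.id_apply]

section TensorMap

variable {A B C D : Type*} [Ring A] [Algebra ℂ A] [Ring B] [Algebra ℂ B] [Ring C] [Algebra ℂ C]
  [Ring D] [Algebra ℂ D] {N : ℕ}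

lemma serMap_map_left (φ : A →ₐ[ℂ] C) (ψ : B →ₐ[ℂ] D)
    (M : Matrix (Fin N) (Fin N) (PowerSeries A)) :
    serMap (Algebra.TensorProduct.map φ ψ)
      (serMap (Algebra.TensorProduct.includeLeft : A →ₐ[ℂ] A ⊗[ℂ] B) M) =
    serMap (Algebra.TensorProduct.includeLeft : C →ₐ[ℂ] C ⊗[ℂ] D) (serMap φ M) := by
  rw [← serMap_comp (Algebra.TensorProduct.includeLeft : C →ₐ[ℂ] C ⊗[ℂ] D)]
  exact serMap_eq_of_apply (fun x => by simp) M

lemma serMap_map_right (φ : A →ₐ[ℂ] C) (ψ : B →ₐ[ℂ] D)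
    (M : Matrix (Fin N) (Fin N) (PowerSeries B)) :
    serMap (Algebra.TensorProduct.map φ ψ)
      (serMap (Algebra.TensorProduct.includeRight : B →ₐ[ℂ] A ⊗[ℂ] B) M) =
    serMap (Algebra.TensorProduct.includeRight : D →ₐ[ℂ] C ⊗[ℂ] D) (serMap ψ M) := by
  rw [← serMap_comp (Algebra.TensorProduct.includeRight : D →ₐ[ℂ] C ⊗[ℂ] D)]
  exact serMap_eq_of_apply (fun x => by simp) M

end TensorMap

variable (T n q p) in
/-- The Hopf algebra structure on the extended quantum affine algebra. -/
def Uext.hopf : HopfStructure (Uext T n q p) where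
  comul := Uext.comul T n q p
  counit := Uext.counit T n q p
  antipode := Uext.antipode T n q p
  coassoc := by
    refine Uext.serMap_ext (fun s => ?_) fun hT s => ?_
    · simp only [serMap_comp, Uext.serMap_comul, map_mul, serMap_map_left, serMap_map_right,
        serMap_id]
      simp only [← serMap_comp, mul_assoc]
      congr 2
    · simp [Uext.comul_root]
  rTensor_counit_comp_comul := by
    refine Uext.serMap_ext (fun s => ?_) fun hT s => ?_
    · simp only [serMap_comp, Uext.serMap_comul, map_mul, serMap_map_left, serMap_map_right,
        serMap_id, Uext.serMap_counit, map_one, one_mul]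
      rfl
    · simp [Uext.comul_root, Uext.counit_root]
  lTensor_counit_comp_comul := by
    refine Uext.serMap_ext (fun s => ?_) fun hT s => ?_
    · simp only [serMap_comp, Uext.serMap_comul, map_mul, serMap_map_left, serMap_map_right,
        serMap_id, Uext.serMap_counit, map_one, mul_one]
      rfl
    · simp [Uext.comul_root, Uext.counit_root]
  mul_antipode_rTensor_comul := LinearMap.ext Uext.antipode_left
  mul_antipode_lTensor_comul := LinearMap.ext Uext.antipode_right

variable (T n q p) in
lemma Uext.isRMatrixHopf : IsRMatrixHopf (Uext.hopf T n q p) where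
  comul_l s i j m := by
    have h1 := congrArg (PowerSeries.coeff m)
      (congrFun (congrFun (Uext.serMap_comul (T := T) (n := n) (q := q) (p := p) s) i) j)
    simp only [coeff_serMap, coeff_Lmat, Matrix.mul_apply, map_sum, PowerSeries.coeff_mul] at h1
    refine h1.trans (Finset.sum_congr rfl fun k _ => Finset.sum_congr rfl fun r _ => ?_)
    simp
  counit_l s i j m := by
    have h3 := congrArg (PowerSeries.coeff m)
      (congrFun (congrFun (Uext.serMap_counit (T := T) (n := n) (q := q) (p := p) s) i) j)
    rw [coeff_serMap, coeff_Lmat] at h3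
    refine h3.trans ?_
    rw [Matrix.one_apply, ite_and]
    split_ifs with h1 h2
    · simp [h2]
    · simp [PowerSeries.coeff_one, h2]
    · simp
  antipode_l_mul s := by
    change (Lmat T n q p s).map (seriesMap (Uext.antipode T n q p)) * _ = 1
    rw [Uext.map_antipode_Lmat]
    exact (isRealization_Lmat T n q p).inverse_mul s
  mul_antipode_l s := by
    change _ * (Lmat T n q p s).map (seriesMap (Uext.antipode T n q p)) = 1
    rw [Uext.map_antipode_Lmat]
    exact (isRealization_Lmat T n q p).mul_inverse s
  comul_root := Uext.comul_root
  counit_root := Uext.counit_root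
  antipode_root := Uext.antipode_root

end Hopf

/-! ### The central series in the Hopf algebra -/

section CentralSeries

variable {T : ClassicalType} {n : ℕ} {q p : ℂ}

/-- The series is determined by the matrix; one of the two relations suffices. -/
lemma IsContraction.unique {A : Type*} [Ring A] [Algebra ℂ A] (hn : T.minRank ≤ n) (hp0 : p ≠ 0)
    {s : Sgn} {L : Matrix (Idx T n) (Idx T n) (PowerSeries A)} {z z' : PowerSeries A}
    (hz : IsContraction T n q p s L z)
    (hz' : ∀ a b, ∑ l, eta T n p l • (dil (xi T n q ^ s.toInt) (L l.rev a) * L l b) =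
      if a = b.rev then eta T n p b • z' else 0) : z = z' := by
  have hpos : 0 < dimN T n := by
    have := rank_pos hn
    cases T <;> simp only [dimN] <;> omega
  let b : Idx T n := ⟨0, hpos⟩
  have h1 := (hz.cols b.rev b).symm.trans (hz' b.rev b)
  rw [if_pos rfl, if_pos rfl] at h1
  exact smul_right_injective _ (eta_ne_zero hp0 b) h1

lemma root_central (hT : T ≠ .B) (s : Sgn) (x : Uext T n q p) :
    Commute (rootgen T n q p hT s) x := by
  induction x using Uext.induction with
  | hc r => exact (Algebra.commutes r _).symm
  | hl s' i j m =>
    have := (isRealization_Lmat T n q p).root_commute_coeff hT s s' i j m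
    rwa [coeff_Lmat] at this
  | hr hT s' => exact (isRealization_Lmat T n q p).root_commute hT s s'
  | hadd x y hx hy => exact hx.add_right hy
  | hmul x y hx hy => exact hx.mul_right hy

/-- The contraction of `L^±(u)` has central coefficients. -/
lemma IsContraction.central (hn : T.minRank ≤ n) (hq0 : q ≠ 0) (hp : p ^ 2 = q) {s : Sgn}
    {z : PowerSeries (Uext T n q p)} (hz : IsContraction T n q p s (Lmat T n q p s) z) (m : ℕ)
    (x : Uext T n q p) : Commute (PowerSeries.coeff m z) x := by
  have hL := isRealization_Lmat T n q p
  induction x using Uext.induction with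
  | hc r => exact (Algebra.commutes r _).symm
  | hl s' i j b =>
    rw [← coeff_Lmat]
    cases s <;> cases s'
    · exact hz.commute_right hn hq0 hp (hL.same .plus) i j m b
    · exact hz.commute_right hn hq0 hp hL.mixed i j m b
    · exact (hz.commute_left hn hq0 hp hL.mixed i j b m).symm
    · exact hz.commute_right hn hq0 hp (hL.same .minus) i j m b
  | hr hT s' => exact (root_central hT s' _).symm
  | hadd x y hx hy => exact hx.add_right hy
  | hmul x y hx hy => exact hx.mul_right hy

lemma sqrt_ne_zero (hq0 : q ≠ 0) (hp : p ^ 2 = q) : p ≠ 0 := by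
  rintro rfl
  exact hq0 (by rw [← hp, zero_pow two_ne_zero])

/-- The series `z(u)` defined by the R-matrix relation is the product of Gaussian generators. -/
lemma zser_isContraction (hn : T.minRank ≤ n) (hq0 : q ≠ 0)
    (hq : ∀ m : ℕ, 0 < m → q ^ m ≠ 1) (hp : p ^ 2 = q) (s : Sgn) :
    IsContraction T n q p s (Lmat T n q p s) (zser T n q p s) := by
  have hp0 := sqrt_ne_zero hq0 hp
  have hL := isRealization_Lmat T n q p
  obtain ⟨z, hz⟩ := exists_contraction hn hq0 hq hp0 s (hL.same s)
  have hc : ∀ f, Commute z f := fun f =>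
    commute_of_coeff fun a b => hz.central hn hq0 hp a _
  rw [hz.eq_zFormula hn hq0 hq hp0 (hL.same s) (hL.isTriangularAtZero s) hc] at hz
  exact hz

variable {A B : Type*} [Ring A] [Algebra ℂ A] [Ring B] [Algebra ℂ B]

lemma dil_map (φ : A →ₐ[ℂ] B) (c : ℂ) (f : PowerSeries A) :
    dil c (PowerSeries.map (φ : A →+* B) f) = PowerSeries.map (φ : A →+* B) (dil c f) := by
  ext m
  simp

lemma serMap_apply (φ : A →ₐ[ℂ] B) {N : ℕ} (M : Matrix (Fin N) (Fin N) (PowerSeries A))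
    (i j : Fin N) : serMap φ M i j = PowerSeries.map (φ : A →+* B) (M i j) := rfl

lemma map_series_smul (φ : A →ₐ[ℂ] B) (r : ℂ) (f : PowerSeries A) :
    PowerSeries.map (φ : A →+* B) (r • f) = r • PowerSeries.map (φ : A →+* B) f := by
  ext m
  simp

lemma IsContraction.map (φ : A →ₐ[ℂ] B) {s : Sgn} {L : Matrix (Idx T n) (Idx T n) (PowerSeries A)}
    {z : PowerSeries A} (hz : IsContraction T n q p s L z) :
    IsContraction T n q p s (serMap φ L) (PowerSeries.map (φ : A →+* B) z) where
  cols a b := by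
    have := congrArg (PowerSeries.map (φ : A →+* B)) (hz.cols a b)
    simpa only [map_sum, map_series_smul, map_mul, apply_ite (PowerSeries.map (φ : A →+* B)),
      map_zero, serMap_apply, dil_map] using this
  rows i j := by
    have := congrArg (PowerSeries.map (φ : A →+* B)) (hz.rows i j)
    simpa only [map_sum, map_series_smul, map_mul, apply_ite (PowerSeries.map (φ : A →+* B)),
      map_zero, serMap_apply, dil_map] using this

/-- Contractions are multiplicative on products of matrices with commuting entries. -/
lemma IsContraction.mul_cols {s : Sgn} {L L' : Matrix (Idx T n) (Idx T n) (PowerSeries A)}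
    {z z' : PowerSeries A} (hz : IsContraction T n q p s L z) (hz' : IsContraction T n q p s L' z')
    (hc : ∀ i j k l c, Commute (L i j) (dil c (L' k l))) (a b : Idx T n) :
    ∑ l, eta T n p l • (dil (xi T n q ^ s.toInt) ((L * L') l.rev a) * (L * L') l b) =
      if a = b.rev then eta T n p b • (z * z') else 0 := by
  set δ : PowerSeries A →+* PowerSeries A := dil (xi T n q ^ s.toInt) with hδ
  calc ∑ l, eta T n p l • (δ ((L * L') l.rev a) * (L * L') l b)
      = ∑ d, ∑ c, (∑ l, eta T n p l • (δ (L l.rev c) * L l d)) * (δ (L' c a) * L' d b) := by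
        simp only [Matrix.mul_apply, map_sum, map_mul, Finset.sum_mul, Finset.mul_sum,
          Finset.smul_sum, smul_mul_assoc]
        rw [Finset.sum_comm]
        refine Finset.sum_congr rfl fun d _ => ?_
        rw [Finset.sum_comm]
        refine Finset.sum_congr rfl fun c _ => Finset.sum_congr rfl fun l _ => ?_
        rw [(hc l d c a _).symm.mul_mul_mul_comm]
    _ = ∑ d, (eta T n p d • z) * (δ (L' d.rev a) * L' d b) := by
        refine Finset.sum_congr rfl fun d _ => ?_
        simp only [hδ, hz.cols, ite_mul, zero_mul, Finset.sum_ite_eq', Finset.mem_univ, if_true]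
    _ = z * ∑ d, eta T n p d • (δ (L' d.rev a) * L' d b) := by
        simp only [Finset.mul_sum, smul_mul_assoc, mul_smul_comm]
    _ = _ := by
        rw [hδ, hz'.cols]
        split_ifs
        · rw [mul_smul_comm]
        · rw [mul_zero]

/-- The contraction of the identity matrix is `1`. -/
lemma one_cols {s : Sgn} (a b : Idx T n) :
    ∑ l, eta T n p l • (dil (xi T n q ^ s.toInt)
      ((1 : Matrix (Idx T n) (Idx T n) (PowerSeries A)) l.rev a) *
        (1 : Matrix (Idx T n) (Idx T n) (PowerSeries A)) l b) =
      if a = b.rev then eta T n p b • (1 : PowerSeries A) else 0 := by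
  rw [Finset.sum_eq_single b]
  · rw [Matrix.one_apply_eq, mul_one, Matrix.one_apply]
    simp only [eq_comm (a := b.rev)]
    split_ifs
    · rw [map_one]
    · rw [map_zero, smul_zero]
  · intro l _ hl
    rw [Matrix.one_apply_ne hl, mul_zero, smul_zero]
  · simp

section Uext

variable (hn : T.minRank ≤ n) (hq0 : q ≠ 0) (hq : ∀ m : ℕ, 0 < m → q ^ m ≠ 1) (hp : p ^ 2 = q)

include hn hq0 hq hp

lemma zser_central (s : Sgn) (m : ℕ) (x : Uext T n q p) :
    Commute (PowerSeries.coeff m (zser T n q p s)) x :=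
  (zser_isContraction hn hq0 hq hp s).central hn hq0 hp m x

lemma comul_zser (s : Sgn) (m : ℕ) :
    Uext.comul T n q p (PowerSeries.coeff m (zser T n q p s)) =
      ∑ r ∈ Finset.HasAntidiagonal.antidiagonal m, PowerSeries.coeff r.1 (zser T n q p s) ⊗ₜ[ℂ]
        PowerSeries.coeff r.2 (zser T n q p s) := by
  have hz := zser_isContraction hn hq0 hq hp s
  have h1 := hz.map (Uext.comul T n q p)
  rw [Uext.serMap_comul] at h1
  have h2 := h1.unique hn (sqrt_ne_zero hq0 hp)
    ((hz.map (inclL _)).mul_cols (hz.map (inclR _)) fun i j k l c => commute_of_coeff fun a b => by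
      rw [coeff_dil, coeff_serMap, coeff_serMap]
      exact (inclL_commute_inclR _ _).smul_right _)
  have h3 := congrArg (PowerSeries.coeff m) h2
  rw [PowerSeries.coeff_mul] at h3
  refine Eq.trans (by simp) (h3.trans (Finset.sum_congr rfl fun r _ => ?_))
  simp

lemma counit_zser (s : Sgn) : PowerSeries.map (Uext.counit T n q p : Uext T n q p →+* ℂ)
    (zser T n q p s) = 1 := by
  have h1 := (zser_isContraction hn hq0 hq hp s).map (Uext.counit T n q p)
  rw [Uext.serMap_counit] at h1
  exact h1.unique hn (sqrt_ne_zero hq0 hp) one_cols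

/-- Since `z(u)` is group-like, the antipode identities say that `S` inverts it. -/
lemma antipode_zser_mul (s : Sgn) :
    seriesMap (Uext.antipode T n q p) (zser T n q p s) * zser T n q p s = 1 := by
  refine PowerSeries.ext fun m => ?_
  have h1 := Uext.antipode_left (PowerSeries.coeff m (zser T n q p s))
  have h2 := congrArg (PowerSeries.coeff m) (counit_zser hn hq0 hq hp s)
  rw [PowerSeries.coeff_map] at h2
  rw [comul_zser hn hq0 hq hp, map_sum, map_sum] at h1
  simp only [LinearMap.rTensor_tmul, LinearMap.mul'_apply] at h1
  rw [PowerSeries.coeff_mul]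
  simp only [seriesMap, PowerSeries.coeff_mk]
  refine h1.trans ((congrArg (algebraMap ℂ (Uext T n q p)) h2).trans ?_)
  rw [PowerSeries.coeff_one, PowerSeries.coeff_one]
  split_ifs <;> simp

lemma zser_commute (s : Sgn) (f : PowerSeries (Uext T n q p)) : Commute (zser T n q p s) f :=
  commute_of_coeff fun a _ => zser_central hn hq0 hq hp s a _

lemma isUnit_zser (s : Sgn) : IsUnit (zser T n q p s) :=
  ⟨⟨_, _, (zser_commute hn hq0 hq hp s _).eq.trans (antipode_zser_mul hn hq0 hq hp s),
    antipode_zser_mul hn hq0 hq hp s⟩, rfl⟩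

lemma antipode_zser (s : Sgn) :
    seriesMap (Uext.antipode T n q p) (zser T n q p s) = Ring.inverse (zser T n q p s) := by
  rw [← mul_one (seriesMap _ _), ← Ring.mul_inverse_cancel _ (isUnit_zser hn hq0 hq hp s),
    ← mul_assoc, antipode_zser_mul hn hq0 hq hp, one_mul]

/-- The inverse of `L(u)` in terms of the transposed matrix at `uξ`. -/
lemma smul_dil_Lmat (s : Sgn) (l k : Idx T n) :
    eta T n p l.rev • dil (xi T n q ^ s.toInt) (Lmat T n q p s k.rev l.rev) =
      eta T n p k.rev • (Ring.inverse (Lmat T n q p s) l k * zser T n q p s) := by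
  have hz := zser_isContraction hn hq0 hq hp s
  let M : Matrix (Idx T n) (Idx T n) (PowerSeries (Uext T n q p)) := Matrix.of fun l k =>
    eta T n p l.rev • dil (xi T n q ^ s.toInt) (Lmat T n q p s k.rev l.rev)
  have h1 : Lmat T n q p s * M =
      Matrix.diagonal fun k => eta T n p k.rev • zser T n q p s := by
    refine Matrix.ext fun j k => ?_
    have h2 := hz.rows k.rev j
    rw [Matrix.mul_apply, Matrix.diagonal_apply]
    simp only [M, Matrix.of_apply, mul_smul_comm]
    rw [h2]
    simp only [Fin.rev_inj, eq_comm (a := k)]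
  have h3 := congrArg (fun X => Ring.inverse (Lmat T n q p s) * X) h1
  simp only [← mul_assoc, (isRealization_Lmat T n q p).inverse_mul s, one_mul] at h3
  have h4 := congrFun (congrFun h3 l) k
  rw [Matrix.mul_diagonal, mul_smul_comm] at h4
  exact h4

omit hn hq0 hq hp in
lemma seriesMap_antipode_mul (f g : PowerSeries (Uext T n q p)) :
    seriesMap (Uext.antipode T n q p) (f * g) =
      seriesMap (Uext.antipode T n q p) g * seriesMap (Uext.antipode T n q p) f := by
  refine PowerSeries.ext fun m => ?_
  simp only [seriesMap, PowerSeries.coeff_mk, PowerSeries.coeff_mul, map_sum, Uext.antipode_mul]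
  rw [← Finset.Nat.sum_antidiagonal_swap]
  rfl

omit hn hq0 hq hp in
lemma seriesMap_smul (r : ℂ) (f : PowerSeries (Uext T n q p)) :
    seriesMap (Uext.antipode T n q p) (r • f) = r • seriesMap (Uext.antipode T n q p) f := by
  refine PowerSeries.ext fun m => ?_
  simp [seriesMap]

omit hn hq0 hq hp in
lemma seriesMap_dil (c : ℂ) (f : PowerSeries (Uext T n q p)) :
    seriesMap (Uext.antipode T n q p) (dil c f) = dil c (seriesMap (Uext.antipode T n q p) f) := by
  refine PowerSeries.ext fun m => ?_
  simp [seriesMap]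

/-- The square of the antipode: apply `S` to the formula for `L(u)⁻¹` in terms of `L(uξ)`, and
use that formula once more at `uξ`. -/
lemma antipode_antipode_Lmat (s : Sgn) (i j : Idx T n) :
    seriesMap (fun x => Uext.antipode T n q p (Uext.antipode T n q p x)) (Lmat T n q p s i j) =
      zser T n q p s * Ring.inverse (scaleArg s (xi T n q) (zser T n q p s)) *
        ((p ^ (2 * (bar2 T n i - bar2 T n j))) •
          scaleArg s (xi T n q ^ 2) (Lmat T n q p s i j)) := by
  have hp0 := sqrt_ne_zero hq0 hp
  set z := zser T n q p s with hzdef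
  set N := Ring.inverse (Lmat T n q p s) with hN
  set S := seriesMap (Uext.antipode T n q p) with hS
  set δ : PowerSeries (Uext T n q p) →+* PowerSeries (Uext T n q p) := dil (xi T n q ^ s.toInt)
    with hδ
  have hSL : ∀ a b, S (Lmat T n q p s a b) = N a b := fun a b =>
    congrFun (congrFun (Uext.map_antipode_Lmat s) a) b
  have hSz : z * S z = 1 := by
    rw [hS, hzdef, antipode_zser hn hq0 hq hp, Ring.mul_inverse_cancel _ (isUnit_zser hn hq0 hq hp s)]
  have hzδ : δ z * Ring.inverse (δ z) = 1 :=
    Ring.mul_inverse_cancel _ ((isUnit_zser hn hq0 hq hp s).map δ)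
  have h1 := congrArg S (smul_dil_Lmat hn hq0 hq hp s i j)
  have hd : ∀ f, S (δ f) = δ (S f) := fun f => seriesMap_dil _ _
  rw [hS, seriesMap_smul, seriesMap_smul, seriesMap_antipode_mul] at h1
  change _ • S (δ _) = _ • (S z * S (N i j)) at h1
  rw [hd, hSL] at h1
  have h2 : eta T n p j • δ (δ (Lmat T n q p s i j)) =
      eta T n p i • (δ (N j.rev i.rev) * δ z) := by
    have h3 := congrArg δ (smul_dil_Lmat hn hq0 hq hp s j.rev i.rev)
    rw [Fin.rev_rev, Fin.rev_rev, hδ, dil_smul, dil_smul, ← hδ, map_mul] at h3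
    exact h3
  have h4 : eta T n p i.rev • (z * δ (N j.rev i.rev)) = eta T n p j.rev • S (N i j) := by
    have := congrArg (fun f => z * f) h1
    simpa only [mul_smul_comm, ← mul_assoc, hSz, one_mul] using this
  have h5 : eta T n p i • δ (N j.rev i.rev) =
      eta T n p j • (δ (δ (Lmat T n q p s i j)) * Ring.inverse (δ z)) := by
    have := congrArg (fun f => f * Ring.inverse (δ z)) h2
    simp only [smul_mul_assoc, mul_assoc, hzδ, mul_one] at this
    exact this.symm
  have hcz : Commute (Ring.inverse (δ z)) (δ (δ (Lmat T n q p s i j))) := by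
    refine (commute_of_mul_eq_one hzδ
      (Ring.inverse_mul_cancel _ ((isUnit_zser hn hq0 hq hp s).map δ)) ?_).symm
    refine (commute_of_coeff fun a b => ?_).symm
    rw [hδ, coeff_dil]
    exact (zser_central hn hq0 hq hp s a _).smul_left _
  have hdd : scaleArg s (xi T n q ^ 2) (Lmat T n q p s i j) = δ (δ (Lmat T n q p s i j)) := by
    rw [scaleArg_eq_dil, hδ, dil_dil, sq, mul_zpow]
  have hSS : seriesMap (fun x => Uext.antipode T n q p (Uext.antipode T n q p x))
      (Lmat T n q p s i j) = S (N i j) := by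
    rw [← hSL]
    refine PowerSeries.ext fun m => ?_
    simp [hS, seriesMap]
  have hj := eta_ne_zero (T := T) (n := n) hp0 j.rev
  have hi := eta_ne_zero (T := T) (n := n) hp0 i
  rw [hSS, scaleArg_eq_dil, ← hδ, hdd, mul_assoc, mul_smul_comm, hcz.eq, mul_smul_comm]
  apply smul_right_injective _ (mul_ne_zero hi hj)
  have h6 : eta T n p i * eta T n p j.rev * p ^ (2 * (bar2 T n i - bar2 T n j)) =
      eta T n p i.rev * eta T n p j := by
    rw [eta_rev, eta_rev, eta, eta, mul_sub, zpow_sub₀ hp0, mul_comm 2, mul_comm 2, zpow_mul,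
      zpow_mul, zpow_neg, zpow_neg]
    have := zpow_ne_zero (bar2 T n i) hp0
    have := zpow_ne_zero (bar2 T n j) hp0
    norm_cast
    field_simp
  change (eta T n p i * eta T n p j.rev) • S (N i j) = (eta T n p i * eta T n p j.rev) • _
  rw [smul_smul, h6, mul_smul, ← h4, smul_comm, ← mul_smul_comm, h5, mul_smul, mul_smul_comm]

end Uext

end CentralSeries

/-! ### The subalgebra of invariants -/

section Subalgebra

/-- Over a field, the elements of `M ⊗ U` fixed by all the operators `1 ⊗ f_i` lie in `M ⊗ V`,
where `V` contains the common fixed vectors of the `f_i`. -/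
lemma mem_range_lTensor_of_fixed {ι M U : Type*} [AddCommGroup M] [Module ℂ M] [AddCommGroup U]
    [Module ℂ U] (f : ι → U →ₗ[ℂ] U) (V : Submodule ℂ U) (hV : ∀ x, (∀ i, f i x = x) → x ∈ V)
    {t : M ⊗[ℂ] U} (ht : ∀ i, (f i).lTensor M t = t) :
    t ∈ LinearMap.range (V.subtype.lTensor M) := by
  classical
  let b := Module.Basis.ofVectorSpace ℂ M
  let e := TensorProduct.equivFinsuppOfBasisLeft (N := U) b
  have he : ∀ i t j, e ((f i).lTensor M t) j = f i (e t j) := by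
    intro i t j
    induction t using TensorProduct.induction_on with
    | zero => simp
    | tmul x y => simp [e]
    | add x y hx hy => simp [hx, hy]
  have hmem : ∀ j, e t j ∈ V := fun j => hV _ fun i => by rw [← he, ht]
  rw [← e.symm_apply_apply t]
  simp only [e, TensorProduct.equivFinsuppOfBasisLeft_symm_apply]
  refine Submodule.sum_mem _ fun j _ => ⟨b j ⊗ₜ ⟨_, hmem j⟩, ?_⟩
  simp [e]

/-- The elements of `U ⊗ U` fixed by all `f_i ⊗ 1` and `1 ⊗ f_i` lie in `V ⊗ V`. -/
lemma mem_range_map_of_fixed {ι U : Type*} [AddCommGroup U] [Module ℂ U]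
    (f : ι → U →ₗ[ℂ] U) (V : Submodule ℂ U) (hV : ∀ x, (∀ i, f i x = x) → x ∈ V)
    {t : U ⊗[ℂ] U} (ht : ∀ i, (f i).lTensor U t = t) (ht' : ∀ i, (f i).rTensor U t = t) :
    t ∈ LinearMap.range (TensorProduct.map V.subtype V.subtype) := by
  obtain ⟨t1, rfl⟩ := mem_range_lTensor_of_fixed f V hV ht
  have hinj : Function.Injective (V.subtype.lTensor U) :=
    Module.Flat.lTensor_preserves_injective_linearMap _ V.subtype_injective
  have h1 : ∀ i, (f i).rTensor V t1 = t1 := fun i => by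
    apply hinj
    rw [← ht' i, ← LinearMap.comp_apply, ← LinearMap.comp_apply, LinearMap.lTensor_comp_rTensor,
      LinearMap.rTensor_comp_lTensor]
  have h2 : ∀ i, (f i).lTensor V (TensorProduct.comm ℂ U V t1) = TensorProduct.comm ℂ U V t1 :=
    fun i => by
      conv_rhs => rw [← h1 i]
      exact LinearMap.congr_fun (TensorProduct.ext' fun x y => by simp :
        (f i).lTensor V ∘ₗ (TensorProduct.comm ℂ U V).toLinearMap =
          (TensorProduct.comm ℂ U V).toLinearMap ∘ₗ (f i).rTensor V) t1
  obtain ⟨t2, h3⟩ := mem_range_lTensor_of_fixed f V hV h2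
  refine ⟨TensorProduct.comm ℂ V V t2, ?_⟩
  have h4 : t1 = TensorProduct.comm ℂ V U (V.subtype.lTensor V t2) := by
    rw [h3]
    simp
  rw [h4]
  exact LinearMap.congr_fun (TensorProduct.ext' fun x y => by simp :
    (TensorProduct.map V.subtype V.subtype) ∘ₗ (TensorProduct.comm ℂ V V).toLinearMap =
      V.subtype.lTensor U ∘ₗ (TensorProduct.comm ℂ V U).toLinearMap ∘ₗ V.subtype.lTensor V) t2

variable {T : ClassicalType} {n : ℕ} {q p : ℂ}

/-- The scalar matrix of a series with complex coefficients. -/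
def scalSeries (T : ClassicalType) (n : ℕ) (A : Type*) [Ring A] [Algebra ℂ A] (f : PowerSeries ℂ) :
    Matrix (Idx T n) (Idx T n) (PowerSeries A) :=
  Matrix.scalar _ (PowerSeries.map (algebraMap ℂ A) f)

variable {A B : Type*} [Ring A] [Algebra ℂ A] [Ring B] [Algebra ℂ B]

lemma coeff_scalSeries_mul (f : PowerSeries ℂ) (M : Matrix (Idx T n) (Idx T n) (PowerSeries A))
    (i j : Idx T n) (m : ℕ) : PowerSeries.coeff m ((scalSeries T n A f * M) i j) =
      ∑ r ∈ Finset.HasAntidiagonal.antidiagonal m,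
        PowerSeries.coeff r.1 f • PowerSeries.coeff r.2 (M i j) := by
  simp only [scalSeries, Matrix.scalar_apply, Matrix.diagonal_mul, PowerSeries.coeff_mul,
    PowerSeries.coeff_map, Algebra.smul_def]

lemma scalSeries_commute (f : PowerSeries ℂ) (M : Matrix (Idx T n) (Idx T n) (PowerSeries A)) :
    Commute (scalSeries T n A f) M := by
  refine Matrix.ext fun i j => ?_
  simp only [scalSeries, Matrix.scalar_apply, Matrix.diagonal_mul, Matrix.mul_diagonal]
  exact commute_of_coeff fun a b => by
    rw [PowerSeries.coeff_map]
    exact Algebra.commutes _ _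

lemma serMap_scalSeries (φ : A →ₐ[ℂ] B) (f : PowerSeries ℂ) :
    serMap φ (scalSeries T n A f) = scalSeries T n B f := by
  refine Matrix.ext fun i j => PowerSeries.ext fun m => ?_
  rw [coeff_serMap]
  simp only [scalSeries, Matrix.scalar_apply, Matrix.diagonal_apply]
  split_ifs <;> simp

lemma serMap_multAut {φ : Uext T n q p →ₐ[ℂ] Uext T n q p} {f : Sgn → PowerSeries ℂ}
    (hφ : ∀ s i j m, φ (lgen T n q p s i j m) =
      ∑ r ∈ Finset.HasAntidiagonal.antidiagonal m,
        PowerSeries.coeff r.1 (f s) • lgen T n q p s i j r.2) (s : Sgn) :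
    serMap φ (Lmat T n q p s) = scalSeries T n _ (f s) * Lmat T n q p s := by
  refine Matrix.ext fun i j => PowerSeries.ext fun m => ?_
  rw [coeff_serMap, coeff_Lmat, hφ, coeff_scalSeries_mul]
  simp only [coeff_Lmat]

lemma IsMultAut.comul_left {φ : Uext T n q p ≃ₐ[ℂ] Uext T n q p} (hφ : IsMultAut T n q p φ) :
    (Uext.comul T n q p).comp (φ : Uext T n q p →ₐ[ℂ] Uext T n q p) =
      (Algebra.TensorProduct.map (φ : Uext T n q p →ₐ[ℂ] Uext T n q p) (AlgHom.id ℂ _)).comp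
        (Uext.comul T n q p) := by
  obtain ⟨f, _, hl, hr⟩ := hφ
  refine Uext.serMap_ext (fun s => ?_) fun hT s => ?_
  · simp only [serMap_comp, Uext.serMap_comul, map_mul, serMap_map_left, serMap_map_right,
      serMap_id, serMap_multAut (φ := (φ : Uext T n q p →ₐ[ℂ] Uext T n q p)) hl s,
      serMap_scalSeries, mul_assoc]
  · simp [Uext.comul_root, hr, TensorProduct.smul_tmul']

lemma IsMultAut.comul_right {φ : Uext T n q p ≃ₐ[ℂ] Uext T n q p} (hφ : IsMultAut T n q p φ) :
    (Uext.comul T n q p).comp (φ : Uext T n q p →ₐ[ℂ] Uext T n q p) =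
      (Algebra.TensorProduct.map (AlgHom.id ℂ _) (φ : Uext T n q p →ₐ[ℂ] Uext T n q p)).comp
        (Uext.comul T n q p) := by
  obtain ⟨f, _, hl, hr⟩ := hφ
  refine Uext.serMap_ext (fun s => ?_) fun hT s => ?_
  · simp only [serMap_comp, Uext.serMap_comul, map_mul, serMap_map_left, serMap_map_right,
      serMap_id, serMap_multAut (φ := (φ : Uext T n q p →ₐ[ℂ] Uext T n q p)) hl s,
      serMap_scalSeries]
    rw [← mul_assoc, ← mul_assoc, (scalSeries_commute (f s) _).eq]
  · simp [Uext.comul_root, hr, TensorProduct.tmul_smul]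

/-- A multiplication automorphism intertwines the antipode with its inverse. -/
lemma IsMultAut.antipode {φ : Uext T n q p ≃ₐ[ℂ] Uext T n q p} (hφ : IsMultAut T n q p φ)
    (x : Uext T n q p) : φ (Uext.antipode T n q p (φ x)) = Uext.antipode T n q p x := by
  obtain ⟨f, hf, hl, hr⟩ := hφ
  induction x using Uext.induction with
  | hc r => simp [Uext.antipode_algebraMap]
  | hl s i j m =>
    have hL := isRealization_Lmat T n q p
    have h1 := congrArg (serMap (φ : Uext T n q p →ₐ[ℂ] Uext T n q p)) (hL.inverse_mul s)
    rw [map_mul, map_one, serMap_multAut hl s, ← mul_assoc,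
      ← (scalSeries_commute (f s) _).eq] at h1
    have h2 : scalSeries T n _ (f s) * serMap (φ : Uext T n q p →ₐ[ℂ] Uext T n q p)
        (Ring.inverse (Lmat T n q p s)) = Ring.inverse (Lmat T n q p s) := by
      rw [← mul_one (scalSeries T n _ (f s) * _), ← hL.mul_inverse s, ← mul_assoc, h1, one_mul]
    have h3 := congrArg (PowerSeries.coeff m) (congrFun (congrFun h2 i) j)
    rw [coeff_scalSeries_mul] at h3
    simp only [coeff_serMap] at h3
    rw [hl, map_sum, map_sum, Uext.antipode_lgen, ← h3]
    refine Finset.sum_congr rfl fun r _ => ?_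
    rw [map_smul, map_smul, Uext.antipode_lgen]
    rfl
  | hr hT s =>
    rw [hr, map_smul, map_smul, Uext.antipode_root, hr, smul_smul]
    have : PowerSeries.coeff 0 (f s) * PowerSeries.coeff 0 (f s.neg) = 1 := by
      cases s
      · exact hf
      · rw [mul_comm]
        exact hf
    rw [this, one_smul]
  | hadd x y hx hy => simp only [map_add, hx, hy]
  | hmul x y hx hy => simp only [map_mul, Uext.antipode_mul, hx, hy]

lemma Uq_isHopfSubalgebra : (Uext.hopf T n q p).IsHopfSubalgebra (Uq T n q p) := by
  refine ⟨fun x hx => ?_, fun x hx φ hφ => ?_⟩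
  · have h := mem_range_map_of_fixed
      (fun φ : {φ // IsMultAut T n q p φ} => φ.1.toLinearMap) (Subalgebra.toSubmodule (Uq T n q p))
      (fun x hx φ hφ => hx ⟨φ, hφ⟩) (t := Uext.comul T n q p x) (fun φ => ?_) (fun φ => ?_)
    · obtain ⟨t, ht⟩ := h
      exact ⟨t, ht⟩
    · have h1 := AlgHom.congr_fun φ.2.comul_right x
      simp only [AlgHom.comp_apply] at h1
      rw [show (φ.1 : Uext T n q p →ₐ[ℂ] Uext T n q p) x = x from hx φ.1 φ.2] at h1
      exact h1.symm
    · have h1 := AlgHom.congr_fun φ.2.comul_left x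
      simp only [AlgHom.comp_apply] at h1
      rw [show (φ.1 : Uext T n q p →ₐ[ℂ] Uext T n q p) x = x from hx φ.1 φ.2] at h1
      exact h1.symm
  · have h1 := IsMultAut.antipode hφ x
    rw [hx φ hφ] at h1
    exact h1

end Subalgebra

end QAff

end

theorem proposition3p4 (T : ClassicalType) (n : ℕ) (hn : T.minRank ≤ n) (q p : ℂ)
    (hq0 : q ≠ 0) (hq : ∀ m : ℕ, 0 < m → q ^ m ≠ 1) (hp : p ^ 2 = q) :
    ∃ H : HopfStructure (Uext T n q p), IsRMatrixHopf H ∧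
      -- the coefficients of `z^±(u)` are central
      (∀ (s : Sgn) (m : ℕ) (x : Uext T n q p),
        Commute (PowerSeries.coeff m (zser T n q p s)) x) ∧
      -- `Δ(z^±(u)) = z^±(u) ⊗ z^±(u)`
      (∀ (s : Sgn) (m : ℕ), H.comul (PowerSeries.coeff m (zser T n q p s)) =
        ∑ r ∈ Finset.HasAntidiagonal.antidiagonal m, PowerSeries.coeff r.1 (zser T n q p s) ⊗ₜ[ℂ]
          PowerSeries.coeff r.2 (zser T n q p s)) ∧
      -- `z^±(u)` is invertible and `S(z^±(u)) = z^±(u)⁻¹`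
      (∀ s : Sgn, IsUnit (zser T n q p s) ∧
        seriesMap H.antipode (zser T n q p s) = Ring.inverse (zser T n q p s)) ∧
      -- `U_q(ĝ)` is a Hopf subalgebra
      H.IsHopfSubalgebra (Uq T n q p) ∧
      -- `S²(L^±(u)) = z^±(u) z^±(u ξ)⁻¹ D² L^±(u ξ²) D⁻²`, entry by entry
      (∀ (s : Sgn) (i j : Idx T n),
        seriesMap (fun x => H.antipode (H.antipode x)) (Lmat T n q p s i j) =
          zser T n q p s * Ring.inverse (scaleArg s (xi T n q) (zser T n q p s)) *
            ((p ^ (2 * (bar2 T n i - bar2 T n j))) •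
              scaleArg s (xi T n q ^ 2) (Lmat T n q p s i j))) := by
  exact ⟨Uext.hopf T n q p, Uext.isRMatrixHopf T n q p, zser_central hn hq0 hq hp,
    comul_zser hn hq0 hq hp,
    fun s => ⟨isUnit_zser hn hq0 hq hp s, antipode_zser hn hq0 hq hp s⟩, Uq_isHopfSubalgebra,
    antipode_antipode_Lmat hn hq0 hq hp⟩
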